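/- **Theorem (Lieb-Robinson bound for long-range interactions).** Let $D\ge 1$ and $\alpha>2D$. Let $\Lambda\subset\mathbb Z^D$ be a finite set of sites, each carrying a finite-dimensional Hilbert space, and let $H(t)=\sum_{i,j\in\Lambda}h_{i,j}(t)$ be a Hamiltonian, continuous in time, where $h_{i,j}(t)$ is Hermitian, supported on $\{i,j\}$, and satisfies $\|h_{i,j}(t)\|\le \|i-j\|^{-\alpha}$ for $i\ne j$ (Euclidean distance; operator norm), while the on-site terms $h_{i,i}(t)$ are arbitrary. Let $U_T=\mathcal T\exp(-i\int_0^T H(s)\,ds)$, $T\ge0$, be the time evolution, i.e. $U_T'=-iH(T)U_T$, $U_0=1$. Let $O_X,O_Y$ be operators of norm at most $1$ supported on sets $X,Y\subset\Lambda$ at distance $R=\operatorname{dist}(X,Y)>0$, where $X$ has diameter at most $r_0$, and put $\mathcal C(T,R)=\|[U_T^\dagger O_XU_T,\,O_Y]\|$. For $\gamma\in(0,1)$ let $$\xi_\alpha(\ell)=\Big(\frac{16}{1-\gamma}\Big)^{\alpha}\frac1{\ell^{\alpha-D-1}}+e^{-\gamma\ell}.$$ There is a constant $v>0$ depending only on $D$,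 and for all $\gamma\in(0,1)$ and $r_0$ there are positive constants $c_{\rm lr},\tilde c_{\rm lr}$ depending only on $D$, $\gamma$ and $r_0$ (not on $\alpha$, $\Lambda$, $H$, $O_X$, $O_Y$, $T$, $R$), such that $$\mathcal C(T,R)\le\begin{cases} c_{\rm lr}\,e^{\alpha}\,T\,R^{D-1}\,\xi_\alpha\!\left(\dfrac{R\alpha}{vT}\right), & vT\ge\alpha,\\[2mm] \tilde c_{\rm lr}\,(e^{vT}-1)\,\xi_\alpha(R), & vT<\alpha.\end{cases}$$ Moreover, with the same $v$, for each fixed $\alpha>2D$ and $r_0$: (a) there is a constant $c_\alpha>0$, depending only on $D,r_0,\alpha$, such that $\mathcal C(T,R)\le c_\alpha\,T^{\alpha-D}/R^{\alpha-2D}$ whenever $vT\ge\alpha$; (b) (light cone) for every $\delta>0$ there is $\kappa>0$, depending only on $D,r_0,\alpha,\delta$, such that $\mathcal C(T,R)\ge\delta$ implies $T\ge\kappa\,R^{(\alpha-2D)/(\alpha-D)}$. -/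

import Mathlib

open scoped Matrix Matrix.Norms.L2Operator

noncomputable section

namespace LongRange

/-- Sites of the `D`-dimensional integer lattice (nearest-neighbour spacing one). -/
abbrev Site (D : ℕ) := Fin D → ℤ

/-- The embedding of the lattice into Euclidean space. -/
def Site.toReal {D : ℕ} (x : Site D) : EuclideanSpace ℝ (Fin D) :=
  WithLp.toLp 2 (fun k => (x k : ℝ))

/-- Euclidean distance between two sites. -/
def siteDist {D : ℕ} (x y : Site D) : ℝ := ‖x.toReal - y.toReal‖

/-- Basis configurations of a family of sites, site `i` carrying the Hilbert space `ℂ ^ (q i)`. -/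
abbrev Config {ι : Type} (q : ι → ℕ) := ∀ i : ι, Fin (q i)

/-- Operators on the tensor product `⨂ i, ℂ ^ (q i)`, as matrices in the configuration basis.
Their norm is the operator norm for the Hermitian inner product. -/
abbrev Op {ι : Type} (q : ι → ℕ) := Matrix (Config q) (Config q) ℂ

open Classical in
/-- `A` is supported on the set `S` of sites: it has the form `B ⊗ 1` with `B` an operator on the
sites in `S` and `1` the identity on all other sites. -/
def SupportedOn {ι : Type} {q : ι → ℕ} (S : Set ι) (A : Op q) : Prop :=
  ∃ B : Op (fun i : S => q i), ∀ σ τ : Config q,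
    A σ τ = if ∀ i, i ∉ S → σ i = τ i then B (fun i => σ i) (fun i => τ i) else 0

/-- A quantum system on finitely many sites of the `D`-dimensional lattice, with a (possibly)
time-dependent two-body Hamiltonian whose interactions are bounded by `1 / r ^ α` at
distance `r`. The on-site terms `h i i t` may have arbitrarily large norm. -/
structure PowerLawSystem (D : ℕ) (α : ℝ) where
  /-- the finite lattice -/
  Λ : Finset (Site D)
  /-- the local Hilbert space dimensions -/
  q : Λ → ℕ
  /-- the interaction between two sites, at each time -/
  h : Λ → Λ → ℝ → Op q
  continuous_h : ∀ i j, Continuous (h i j)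
  hermitian_h : ∀ i j t, (h i j t).IsHermitian
  supported_h : ∀ i j t, SupportedOn {i, j} (h i j t)
  norm_h_le : ∀ i j t, i ≠ j → ‖h i j t‖ ≤ 1 / siteDist (i : Site D) (j : Site D) ^ α

namespace PowerLawSystem

variable {D : ℕ} {α : ℝ}

/-- The Hamiltonian `H(t) = ∑ i j, h i j t` of the whole lattice. -/
def hamiltonian (S : PowerLawSystem D α) (t : ℝ) : Op S.q := ∑ i, ∑ j, S.h i j t

/-- `U t` is the evolution unitary `𝒯 exp (-i ∫₀ᵗ H(s) ds)` from time `0` to time `t`, i.e. the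
(unique) solution of the Schrödinger equation `U' = -i H U` with `U 0 = 1`. -/
def IsEvolution (S : PowerLawSystem D α) (U : ℝ → Op S.q) : Prop :=
  U 0 = 1 ∧ ∀ t, HasDerivAt U ((-Complex.I) • (S.hamiltonian t * U t)) t

end PowerLawSystem

/-- Data of a Lieb-Robinson commutator in the system `S`: the evolution `U`, and two operators
`OX`, `OY` supported on sets `X`, `Y` of sites, where `X` has diameter at most `r₀` and
the distance between `X` and `Y` is `R > 0`. -/
structure Probe {D : ℕ} {α : ℝ} (S : PowerLawSystem D α) (r₀ R : ℝ) where
  /-- the evolution unitaries from time `0` -/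
  U : ℝ → Op S.q
  isEvolution : S.IsEvolution U
  X : Set S.Λ
  Y : Set S.Λ
  OX : Op S.q
  OY : Op S.q
  supported_OX : SupportedOn X OX
  supported_OY : SupportedOn Y OY
  diam_X_le : ∀ x ∈ X, ∀ y ∈ X, siteDist (x : Site D) (y : Site D) ≤ r₀
  dist_pos : 0 < R
  isLeast_dist : IsLeast {r : ℝ | ∃ x ∈ X, ∃ y ∈ Y, r = siteDist (x : Site D) (y : Site D)} R

/-- The commutator norm `C(T, R) = ‖[U_T† O_X U_T, O_Y]‖`. -/
def Probe.commNorm {D : ℕ} {α : ℝ} {S : PowerLawSystem D α} {r₀ R : ℝ} (P : Probe S r₀ R)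
    (T : ℝ) : ℝ :=
  ‖⁅(P.U T)ᴴ * P.OX * P.U T, P.OY⁆‖

/-- `ξ_α(ℓ) = (16 / (1 - γ)) ^ α / ℓ ^ (α - D - 1) + exp (-γ ℓ)`. -/
def xi (D : ℕ) (γ α ℓ : ℝ) : ℝ :=
  (16 / (1 - γ)) ^ α * (1 / ℓ ^ (α - D - 1)) + Real.exp (-γ * ℓ)

end LongRange

end

/-! Let E_i be the normalised partial trace over the site i. An operator acts trivially on i when
E_i fixes it, so the defect ‖A - E_i A‖ measures how far A has reached i. Under Heisenberg evolution
this defect is driven only by the couplings of i to other sites. Commutation with the on-site term,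
or with terms not touching i, is compatible with E_i and generates an isometric flow, so on-site
terms of any size drop out. What remains is a system of differential inequalities δ_i' ≤ ∑_j 8 J_ij
(δ_i + δ_j), closed by Grönwall in a weighted sup norm (`siteDefect_le_exp`,
`siteDefect_le_exp_sub_one`).

The weights are sums of the kernel (1+s)^(-p) max(e^(-4s), (1+s)^(-(α-p))) with D+1 ≤ p ≤ D+2. Up to
a constant it dominates r^(-α) and reproduces itself under lattice convolution, both uniformly in α.
This is why the velocity depends on D alone: the bare power (1+s)^(-α) would cost a factor 2^α. The
short-time bound follows directly.

For long times, [0,T] is cut into about vT/α steps. After each step the operator is truncated to a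
slightly larger ball, the radius growing from R/2 to R. Truncation errors are sums over pairs of
sites on the two sides of a shell. Grouped by displacement z, a ball of radius ρ contributes O(|z|
ρ^(D-1)) pairs, which gives R^(D-1) l^(-(α-D-1)) per step at step width l. Evolution is a
contraction, so the errors add: the number of steps gives the factor T, and the length of one step
gives e^α.

The constants in this sum stay bounded as long as α ≥ D+1+η. Since α > 2D, only D = 1 with α near 2
is left out. There an interpolated pair count keeps the constants bounded but loses a factor
(R/l)^η, too much for many short steps. The loss is repaired by doubling the time: spreading far in
twice the time takes one large excursion or a moderate one in each half, and the squared weights of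
the moderate ones are summable over scales (`SpreadBound.double`, `spreadBound_two_pow`).

For a fixed α the exponential in ξ is absorbed into the power, which gives the algebraic bound.
Solving that for T gives the light cone. -/

noncomputable section

namespace LongRange

/-! ### Partial traces as conditional expectations -/

section SiteAverage

set_option linter.unusedSectionVars false

variable {ι : Type} [Fintype ι] [DecidableEq ι] {q : ι → ℕ}

/-- The normalised partial trace over the site `i`, tensored with the identity on that site. -/
def siteAverage (i : ι) : Op q →ₗ[ℂ] Op q where
  toFun A := Matrix.of fun σ τ => if σ i = τ i then
    (q i : ℂ)⁻¹ * ∑ x, A (Function.update σ i x) (Function.update τ i x) else 0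
  map_add' A B := by
    ext σ τ
    simp only [Matrix.add_apply, Matrix.of_apply]
    split_ifs
    · rw [Finset.sum_add_distrib, mul_add]
    · simp
  map_smul' c A := by
    ext σ τ
    simp only [Matrix.smul_apply, Matrix.of_apply, smul_eq_mul, RingHom.id_apply]
    split_ifs
    · rw [← Finset.mul_sum]; ring
    · simp

theorem siteAverage_apply (i : ι) (A : Op q) (σ τ : Config q) :
    siteAverage i A σ τ = if σ i = τ i then
      (q i : ℂ)⁻¹ * ∑ x, A (Function.update σ i x) (Function.update τ i x) else 0 := rfl

/-- Local dimension zero is allowed. It leaves no configurations at all, so any σ is a witness that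
division by `q i` is safe. -/
theorem natCast_dim_ne_zero (σ : Config q) (i : ι) : (q i : ℂ) ≠ 0 := by
  have := (σ i).pos
  exact_mod_cast this.ne'

/-- Being fixed by `siteAverage i` serves from here on as the meaning of acting trivially on i; this
is its entrywise form. -/
theorem siteAverage_eq_self_iff (i : ι) (A : Op q) :
    siteAverage i A = A ↔ (∀ σ τ, σ i ≠ τ i → A σ τ = 0) ∧
      ∀ σ τ x, σ i = τ i → A (Function.update σ i x) (Function.update τ i x) = A σ τ := by
  constructor
  · intro h
    refine ⟨fun σ τ hne => ?_, fun σ τ x he => ?_⟩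
    · rw [← h, siteAverage_apply, if_neg hne]
    · rw [← h, siteAverage_apply, siteAverage_apply, if_pos (by simp), if_pos he]
      simp
  · rintro ⟨h0, h1⟩
    ext σ τ
    rw [siteAverage_apply]
    split_ifs with he
    · simp only [h1 σ τ _ he, Finset.sum_const, Finset.card_univ, Fintype.card_fin, nsmul_eq_mul]
      rw [inv_mul_cancel_left₀ (natCast_dim_ne_zero σ i)]
    · exact (h0 σ τ he).symm

theorem siteAverage_of_supportedOn {S : Set ι} {A : Op q} (h : SupportedOn S A) {i : ι}
    (hi : i ∉ S) : siteAverage i A = A := by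
  obtain ⟨B, hB⟩ := h
  rw [siteAverage_eq_self_iff]
  refine ⟨fun σ τ hne => ?_, fun σ τ x he => ?_⟩
  · rw [hB, if_neg]
    exact fun H => hne (H i hi)
  · have hne : ∀ j : S, (j : ι) ≠ i := fun j hj => hi (hj ▸ j.2)
    have e1 : (∀ j, j ∉ S → Function.update σ i x j = Function.update τ i x j) ↔
        ∀ j, j ∉ S → σ j = τ j := by
      refine forall_congr' fun j => forall_congr' fun _ => ?_
      by_cases hj : j = i
      · subst hj; simp [he]
      · simp [hj]
    rw [hB, hB]
    simp only [Function.update_of_ne (hne _)]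
    by_cases hσ : ∀ j, j ∉ S → σ j = τ j
    · rw [if_pos hσ, if_pos (e1.2 hσ)]
    · rw [if_neg hσ, if_neg fun h => hσ (e1.1 h)]

theorem siteAverage_idem (i : ι) (A : Op q) : siteAverage i (siteAverage i A) = siteAverage i A := by
  rw [siteAverage_eq_self_iff]
  refine ⟨fun σ τ hne => by rw [siteAverage_apply, if_neg hne], fun σ τ x he => ?_⟩
  rw [siteAverage_apply, siteAverage_apply, if_pos (by simp), if_pos he]
  simp

theorem siteAverage_comm (i j : ι) (A : Op q) :
    siteAverage i (siteAverage j A) = siteAverage j (siteAverage i A) := by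
  rcases eq_or_ne i j with rfl | hij
  · rfl
  ext σ τ
  simp only [siteAverage_apply, Function.update_of_ne hij.symm, Function.update_of_ne hij]
  split_ifs
  · rw [Finset.mul_sum, Finset.mul_sum]
    simp only [Finset.mul_sum]
    rw [Finset.sum_comm]
    refine Finset.sum_congr rfl fun x _ => Finset.sum_congr rfl fun y _ => ?_
    rw [Function.update_comm hij, Function.update_comm hij]
    ring
  · simp
  · simp
  · rfl

/-- A sum over configurations of a function that vanishes unless the configuration agrees with
`σ` away from `i`. -/
theorem sum_config_eq_sum_update (i : ι) (σ : Config q) (f : Config q → ℂ)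
    (hf : ∀ κ, (∃ j, j ≠ i ∧ κ j ≠ σ j) → f κ = 0) :
    ∑ κ, f κ = ∑ x, f (Function.update σ i x) := by
  have hinj : Function.Injective (fun x => Function.update σ i x) :=
    Function.update_injective σ i
  rw [← Finset.sum_image (s := Finset.univ) (f := f) (g := fun x => Function.update σ i x)
    (fun x _ y _ h => hinj h)]
  refine (Finset.sum_subset (Finset.subset_univ _) fun κ _ hκ => hf κ ?_).symm
  by_contra hcon
  push Not at hcon
  refine hκ (Finset.mem_image.2 ⟨κ i, Finset.mem_univ _, ?_⟩)
  ext j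
  rcases eq_or_ne j i with rfl | hj
  · simp
  · simp [hj, hcon j hj]

/-- The bimodule property of a conditional expectation: a factor that is the identity on the site i
can be pulled out of the trace over i. -/
theorem siteAverage_mul_left (i : ι) {B : Op q} (hB : siteAverage i B = B) (A : Op q) :
    siteAverage i (B * A) = B * siteAverage i A := by
  obtain ⟨h0, h1⟩ := (siteAverage_eq_self_iff i B).1 hB
  ext σ τ
  simp only [siteAverage_apply, Matrix.mul_apply]
  split_ifs with he
  -- Since B preserves the state of the site i, only κ with κ i = x contribute. Resetting that
  -- coordinate to σ i makes the factor B independent of x.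
  · have key : ∀ x, ∑ κ, B (Function.update σ i x) κ * A κ (Function.update τ i x) =
        ∑ κ, if κ i = σ i then
          B σ κ * A (Function.update κ i x) (Function.update τ i x) else 0 := by
      intro x
      rw [← Finset.sum_filter, ← Finset.sum_subset (Finset.filter_subset (fun κ => κ i = x) _)]
      · refine Finset.sum_bij' (fun κ _ => Function.update κ i (σ i))
          (fun κ _ => Function.update κ i x) ?_ ?_ ?_ ?_ ?_
        · intro κ _; simp
        · intro κ _; simp
        · intro κ hκ
          simp only [Finset.mem_filter, Finset.mem_univ, true_and] at hκ
          subst hκ; simp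
        · intro κ hκ
          simp only [Finset.mem_filter, Finset.mem_univ, true_and] at hκ
          rw [← hκ]; simp
        · intro κ hκ
          simp only [Finset.mem_filter, Finset.mem_univ, true_and] at hκ
          subst hκ
          have := h1 σ (Function.update κ i (σ i)) (κ i) (by simp)
          simp only [Function.update_idem, Function.update_eq_self] at this ⊢
          rw [this]
      · intro κ _ hκ
        simp only [Finset.mem_filter, Finset.mem_univ, true_and] at hκ
        rw [h0 _ _ (by simpa using fun h => hκ h.symm), zero_mul]
    simp only [key]
    rw [Finset.sum_comm, Finset.mul_sum]
    refine Finset.sum_congr rfl fun κ _ => ?_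
    by_cases hκ : κ i = σ i
    · simp only [hκ, if_true, he, ← Finset.mul_sum]
      ring
    · simp only [hκ, if_false, Finset.sum_const_zero, mul_zero]
      rw [h0 _ _ (fun h => hκ h.symm), zero_mul]
  · refine (Finset.sum_eq_zero fun κ _ => ?_).symm
    by_cases hκ : κ i = τ i
    · rw [h0 _ _ (fun h => he (h.trans hκ)), zero_mul]
    · simp [hκ]

theorem siteAverage_conjTranspose (i : ι) (A : Op q) :
    siteAverage i Aᴴ = (siteAverage i A)ᴴ := by
  ext σ τ
  simp only [siteAverage_apply, Matrix.conjTranspose_apply, eq_comm (a := σ i)]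
  split_ifs <;> simp

theorem siteAverage_mul_right (i : ι) {B : Op q} (hB : siteAverage i B = B) (A : Op q) :
    siteAverage i (A * B) = siteAverage i A * B := by
  have hB' : siteAverage i Bᴴ = Bᴴ := by rw [siteAverage_conjTranspose, hB]
  have := congrArg Matrix.conjTranspose (siteAverage_mul_left i hB' Aᴴ)
  rw [← siteAverage_conjTranspose, Matrix.conjTranspose_mul, Matrix.conjTranspose_mul,
    siteAverage_conjTranspose] at this
  simpa only [Matrix.conjTranspose_conjTranspose] using this

theorem apply_eq_zero_of_fixed {F : Finset ι} {A : Op q} (hA : ∀ i ∈ F, siteAverage i A = A)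
    {σ τ : Config q} {i : ι} (hi : i ∈ F) (h : σ i ≠ τ i) : A σ τ = 0 :=
  ((siteAverage_eq_self_iff i A).1 (hA i hi)).1 σ τ h

theorem apply_piecewise_of_fixed {A : Op q} (F : Finset ι) (hA : ∀ i ∈ F, siteAverage i A = A)
    (σ τ κ : Config q) (h : ∀ i ∈ F, σ i = τ i) :
    A (F.piecewise κ σ) (F.piecewise κ τ) = A σ τ := by
  induction F using Finset.induction_on with
  | empty => simp
  | insert j F hj ih =>
    rw [Finset.piecewise_insert, Finset.piecewise_insert,
      ((siteAverage_eq_self_iff j A).1 (hA j (Finset.mem_insert_self _ _))).2 _ _ _ ?_]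
    · exact ih (fun i hi => hA i (Finset.mem_insert_of_mem hi))
        fun i hi => h i (Finset.mem_insert_of_mem hi)
    · rw [Finset.piecewise_eq_of_notMem _ _ _ hj, Finset.piecewise_eq_of_notMem _ _ _ hj]
      exact h j (Finset.mem_insert_self _ _)

/-- Operators acting on complementary sets of sites commute. -/
theorem mul_comm_of_fixed {A B : Op q} (F : Finset ι) (hA : ∀ i ∈ F, siteAverage i A = A)
    (hB : ∀ i ∉ F, siteAverage i B = B) : A * B = B * A := by
  have hB' : ∀ i ∈ Fᶜ, siteAverage i B = B := fun i hi => hB i (by simpa using hi)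
  ext σ τ
  simp only [Matrix.mul_apply]
  -- A leaves the coordinates in F unchanged and B those outside F, so each product passes through a
  -- single intermediate configuration.
  rw [Finset.sum_eq_single (F.piecewise σ τ), Finset.sum_eq_single (F.piecewise τ σ)]
  · have e1 := apply_piecewise_of_fixed F hA σ (F.piecewise σ τ) τ
      (fun i hi => by simp [hi])
    have e2 := apply_piecewise_of_fixed Fᶜ hB' (F.piecewise σ τ) τ σ
      (fun i hi => by simp [Finset.mem_compl.1 hi])
    rw [← e1, ← e2, mul_comm]
    congr 2
    · ext k; by_cases hk : k ∈ F <;> simp [Finset.piecewise, hk]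
    · ext k; by_cases hk : k ∈ F <;> simp [Finset.piecewise, hk]
    · ext k; by_cases hk : k ∈ F <;> simp [Finset.piecewise, hk]
  · intro κ _ hκ
    by_cases h : ∀ i ∈ F, κ i = τ i
    · have : ∃ i ∈ Fᶜ, σ i ≠ κ i := by
        by_contra hcon
        push Not at hcon
        refine hκ (funext fun k => ?_)
        by_cases hk : k ∈ F
        · simp [hk, h k hk]
        · simp [hk, hcon k (by simpa using hk)]
      obtain ⟨i, hi, hne⟩ := this
      rw [apply_eq_zero_of_fixed hB' hi hne, zero_mul]
    · push Not at h
      obtain ⟨i, hi, hne⟩ := h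
      rw [apply_eq_zero_of_fixed hA hi hne, mul_zero]
  · simp
  · intro κ _ hκ
    by_cases h : ∀ i ∈ F, σ i = κ i
    · have : ∃ i ∈ Fᶜ, κ i ≠ τ i := by
        by_contra hcon
        push Not at hcon
        refine hκ (funext fun k => ?_)
        by_cases hk : k ∈ F
        · simp [hk, h k hk]
        · simp [hk, hcon k (by simpa using hk)]
      obtain ⟨i, hi, hne⟩ := this
      rw [apply_eq_zero_of_fixed hB' hi hne, mul_zero]
    · push Not at h
      obtain ⟨i, hi, hne⟩ := h
      rw [apply_eq_zero_of_fixed hA hi hne, zero_mul]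
  · simp

/-- The partial trace over `i` is tracial for operators acting on the site `i`. -/
theorem siteAverage_mul_comm (i : ι) {B : Op q} (hB : ∀ j, j ≠ i → siteAverage j B = B)
    (A : Op q) : siteAverage i (B * A) = siteAverage i (A * B) := by
  have hB' : ∀ j ∈ ({i}ᶜ : Finset ι), siteAverage j B = B := fun j hj => hB j (by simpa using hj)
  ext σ τ
  simp only [siteAverage_apply]
  split_ifs with he
  · congr 1
    simp only [Matrix.mul_apply]
    have e1 : ∀ x, ∑ κ, B (Function.update σ i x) κ * A κ (Function.update τ i x) =
        ∑ y, B (Function.update σ i x) (Function.update σ i y) *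
          A (Function.update σ i y) (Function.update τ i x) := fun x => by
      refine sum_config_eq_sum_update i σ _ fun κ ⟨j, hj, hne⟩ => ?_
      rw [apply_eq_zero_of_fixed hB' (i := j) (by simpa using hj), zero_mul]
      simpa [hj] using hne.symm
    have e2 : ∀ x, ∑ κ, A (Function.update σ i x) κ * B κ (Function.update τ i x) =
        ∑ y, A (Function.update σ i x) (Function.update τ i y) *
          B (Function.update τ i y) (Function.update τ i x) := fun x => by
      refine sum_config_eq_sum_update i τ _ fun κ ⟨j, hj, hne⟩ => ?_
      rw [apply_eq_zero_of_fixed hB' (i := j) (by simpa using hj), mul_zero]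
      simpa [hj] using hne
    simp only [e1, e2]
    rw [Finset.sum_comm]
    refine Finset.sum_congr rfl fun x _ => Finset.sum_congr rfl fun y _ => ?_
    rw [mul_comm]
    congr 1
    have := apply_piecewise_of_fixed ({i}ᶜ : Finset ι) hB' (Function.update σ i y)
      (Function.update σ i x) τ (fun j hj => by
        have : j ≠ i := by simpa using hj
        simp [this])
    rw [← this]
    congr 1
    · ext k; by_cases hk : k = i
      · subst hk; simp [Finset.piecewise]
      · simp [Finset.piecewise, hk]
    · ext k; by_cases hk : k = i
      · subst hk; simp [Finset.piecewise]
      · simp [Finset.piecewise, hk]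
  · rfl

end SiteAverage

/-! ### Contractivity of the partial trace, and site defects -/

section SiteAverageNorm

set_option linter.unusedSectionVars false

theorem norm_matrix_one_le {n : Type*} [Fintype n] [DecidableEq n] : ‖(1 : Matrix n n ℂ)‖ ≤ 1 := by
  rw [← Matrix.diagonal_one, Matrix.l2_opNorm_diagonal]
  exact (pi_norm_le_iff_of_nonneg zero_le_one).2 fun _ => by simp

theorem norm_le_one_of_isometry {n : Type*} [Fintype n] [DecidableEq n] {U : Matrix n n ℂ}
    (h : Uᴴ * U = 1) : ‖U‖ ≤ 1 := by
  have h1 := Matrix.l2_opNorm_conjTranspose_mul_self U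
  rw [h] at h1
  nlinarith [norm_matrix_one_le (n := n), norm_nonneg U]

theorem norm_conj_le {n : Type*} [Fintype n] [DecidableEq n] {U V : Matrix n n ℂ}
    (hU : ‖U‖ ≤ 1) (hV : ‖V‖ ≤ 1) (A : Matrix n n ℂ) : ‖U * A * V‖ ≤ ‖A‖ := by
  calc ‖U * A * V‖ ≤ ‖U‖ * ‖A‖ * ‖V‖ :=
        (norm_mul_le _ _).trans (mul_le_mul_of_nonneg_right (norm_mul_le _ _) (norm_nonneg _))
    _ ≤ 1 * ‖A‖ * 1 := by gcongr
    _ = ‖A‖ := by ring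

theorem norm_submatrix_equiv_le {n : Type*} [Fintype n] [DecidableEq n] (e : n ≃ n)
    (A : Matrix n n ℂ) : ‖A.submatrix e e‖ ≤ ‖A‖ := by
  set U : Matrix n n ℂ := (1 : Matrix n n ℂ).submatrix e id with hU
  have h1 : A.submatrix e e = U * A * Uᴴ := by
    ext σ τ
    simp [hU, Matrix.mul_apply, Matrix.one_apply]
  have h2 : ‖U‖ ≤ 1 := by
    refine norm_le_one_of_isometry ?_
    rw [hU, Matrix.conjTranspose_submatrix, Matrix.conjTranspose_one,
      Matrix.submatrix_mul_equiv, one_mul]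
    rfl
  rw [h1]
  exact norm_conj_le h2 ((Matrix.l2_opNorm_conjTranspose U).le.trans h2) A

/-- For x ≠ y, flipping the sign at x permutes the sign vectors and negates the sum. -/
theorem sum_sign_mul_sign {m : ℕ} (x y : Fin m) :
    ∑ s : Fin m → ℤˣ, (((s x : ℤˣ) : ℤ) : ℂ) * (((s y : ℤˣ) : ℤ) : ℂ) =
      if x = y then (Fintype.card (Fin m → ℤˣ) : ℂ) else 0 := by
  split_ifs with h
  · subst h
    have : ∀ s : Fin m → ℤˣ, (((s x : ℤˣ) : ℤ) : ℂ) * (((s x : ℤˣ) : ℤ) : ℂ) = 1 := fun s => by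
      rcases Int.units_eq_one_or (s x) with h | h <;> simp [h]
    simp [this]
  · have h1 := Equiv.sum_comp (Equiv.mulLeft (Function.update (1 : Fin m → ℤˣ) x (-1)))
      (fun s : Fin m → ℤˣ => (((s x : ℤˣ) : ℤ) : ℂ) * (((s y : ℤˣ) : ℤ) : ℂ))
    simp only [Equiv.coe_mulLeft, Pi.mul_apply, Function.update_self,
      Function.update_of_ne (Ne.symm h), Pi.one_apply, one_mul, neg_mul, Units.val_neg,
      Int.cast_neg, Finset.sum_neg_distrib] at h1
    exact self_eq_neg.1 h1.symm

variable {ι : Type} [Fintype ι] [DecidableEq ι] {q : ι → ℕ}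

/-- The block-diagonal part of an operator with respect to the basis states of the site `i`. -/
def sitePinching (i : ι) (A : Op q) : Op q := Matrix.of fun σ τ => if σ i = τ i then A σ τ else 0

/-- By orthogonality of random signs, pinching is an average of conjugations by diagonal sign
matrices, each of norm at most one. -/
theorem norm_sitePinching_le (i : ι) (A : Op q) : ‖sitePinching i A‖ ≤ ‖A‖ := by
  set Z : (Fin (q i) → ℤˣ) → Op q :=
    fun s => Matrix.diagonal fun σ => (((s (σ i) : ℤˣ) : ℤ) : ℂ) with hZ
  have hZn : ∀ s, ‖Z s‖ ≤ 1 := fun s => by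
    rw [hZ, Matrix.l2_opNorm_diagonal]
    refine (pi_norm_le_iff_of_nonneg zero_le_one).2 fun σ => ?_
    rcases Int.units_eq_one_or (s (σ i)) with h | h <;> simp [h]
  set N : ℂ := (Fintype.card (Fin (q i) → ℤˣ) : ℂ) with hN
  have hN0 : N ≠ 0 := by
    rw [hN]; exact_mod_cast Fintype.card_ne_zero
  have h1 : sitePinching i A = N⁻¹ • ∑ s, Z s * A * Z s := by
    ext σ τ
    simp only [sitePinching, Matrix.of_apply, Matrix.smul_apply, Matrix.sum_apply, hZ,
      Matrix.mul_diagonal, Matrix.diagonal_mul, smul_eq_mul]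
    have : ∀ s : Fin (q i) → ℤˣ, (((s (σ i) : ℤˣ) : ℤ) : ℂ) * A σ τ * (((s (τ i) : ℤˣ) : ℤ) : ℂ) =
        ((((s (σ i) : ℤˣ) : ℤ) : ℂ) * (((s (τ i) : ℤˣ) : ℤ) : ℂ)) * A σ τ := fun s => by ring
    simp only [this]
    rw [← Finset.sum_mul, sum_sign_mul_sign]
    split_ifs
    · rw [inv_mul_cancel_left₀ hN0]
    · simp
  rw [h1, norm_smul, norm_inv, hN, Complex.norm_natCast, inv_mul_le_iff₀
    (by exact_mod_cast Fintype.card_pos)]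
  refine (norm_sum_le _ _).trans ((Finset.sum_le_card_nsmul _ _ ‖A‖ fun s _ =>
    norm_conj_le (hZn s) (hZn s) A).trans (le_of_eq ?_))
  simp

/-- The partial trace is the pinching averaged over cyclic shifts of the basis of the site i, and a
shift is conjugation by a permutation matrix. -/
theorem norm_siteAverage_le (i : ι) (A : Op q) : ‖siteAverage i A‖ ≤ ‖A‖ := by
  rcases isEmpty_or_nonempty (Config q) with he | ⟨⟨σ₀⟩⟩
  · have : siteAverage i A = A := by ext σ; exact he.elim σ
    rw [this]
  have hpos : 0 < q i := (σ₀ i).pos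
  have : NeZero (q i) := ⟨hpos.ne'⟩
  let e : Fin (q i) → Config q ≃ Config q := fun k =>
    { toFun := fun σ => Function.update σ i (σ i + k)
      invFun := fun σ => Function.update σ i (σ i - k)
      left_inv := fun σ => by simp
      right_inv := fun σ => by simp }
  have he : ∀ k σ, e k σ = Function.update σ i (σ i + k) := fun _ _ => rfl
  have h1 : siteAverage i A =
      (q i : ℂ)⁻¹ • ∑ k, (sitePinching i A).submatrix (e k) (e k) := by
    ext σ τ
    simp only [siteAverage_apply, Matrix.smul_apply, Matrix.sum_apply, Matrix.submatrix_apply, he,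
      sitePinching, Matrix.of_apply, Function.update_self, smul_eq_mul, add_left_inj]
    split_ifs with h
    · rw [← h]
      congr 1
      exact (Equiv.sum_comp (Equiv.addLeft (σ i))
        (fun x => A (Function.update σ i x) (Function.update τ i x))).symm
    · simp
  rw [h1, norm_smul, norm_inv, Complex.norm_natCast, inv_mul_le_iff₀ (by exact_mod_cast hpos)]
  refine (norm_sum_le _ _).trans ((Finset.sum_le_card_nsmul _ _ ‖A‖ fun s _ =>
    (norm_submatrix_equiv_le _ _).trans (norm_sitePinching_le i A)).trans (le_of_eq ?_))
  simp

/-- The distance of an operator from its average over the site `i`. -/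
def siteDefect (i : ι) (A : Op q) : ℝ := ‖A - siteAverage i A‖

theorem siteDefect_nonneg (i : ι) (A : Op q) : 0 ≤ siteDefect i A := norm_nonneg _

theorem norm_sub_siteAverage_le (i : ι) (A : Op q) : ‖A - siteAverage i A‖ ≤ 2 * ‖A‖ := by
  have := norm_sub_le A (siteAverage i A)
  linarith [norm_siteAverage_le i A]

/-- Averaging over the sites of F one after another works: the averages commute and contract, so the
errors telescope into the defects of A itself. -/
theorem exists_fixed_approx (F : Finset ι) (A : Op q) :
    ∃ A' : Op q, (∀ i, i ∈ F ∨ siteAverage i A = A → siteAverage i A' = A') ∧ ‖A'‖ ≤ ‖A‖ ∧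
      ‖A - A'‖ ≤ ∑ i ∈ F, siteDefect i A := by
  induction F using Finset.induction_on with
  | empty => exact ⟨A, by simp, le_rfl, by simp⟩
  | insert j F hj ih =>
    obtain ⟨A', h1, h2, h3⟩ := ih
    refine ⟨siteAverage j A', ?_, (norm_siteAverage_le j A').trans h2, ?_⟩
    · intro i hi
      rcases eq_or_ne i j with rfl | hij
      · exact siteAverage_idem _ _
      · rw [siteAverage_comm, h1 i]
        simpa [Finset.mem_insert, hij] using hi
    · rw [Finset.sum_insert hj]
      have : A - siteAverage j A' = (A - siteAverage j A) + siteAverage j (A - A') := by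
        rw [map_sub]; abel
      rw [this]
      exact (norm_add_le _ _).trans (add_le_add le_rfl ((norm_siteAverage_le _ _).trans h3))

/-- Averaging A over i and j gives an operator that commutes with B, so only the difference enters
the commutator. -/
theorem norm_commutator_le_siteDefect {i j : ι} {B : Op q}
    (hB : ∀ k, k ≠ i → k ≠ j → siteAverage k B = B) (A : Op q) :
    ‖B * A - A * B‖ ≤ 2 * ‖B‖ * (siteDefect i A + siteDefect j A) := by
  obtain ⟨A', h1, -, h3⟩ := exists_fixed_approx ({i, j} : Finset ι) A
  have hc : A' * B = B * A' := mul_comm_of_fixed {i, j} (fun k hk => h1 k (Or.inl hk))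
    (fun k hk => hB k (fun h => hk (by simp [h])) (fun h => hk (by simp [h])))
  have h4 : ‖A - A'‖ ≤ siteDefect i A + siteDefect j A := by
    refine h3.trans ?_
    rcases eq_or_ne i j with rfl | hij
    · simpa using siteDefect_nonneg i A
    · rw [Finset.sum_pair hij]
  have : B * A - A * B = B * (A - A') - (A - A') * B := by
    rw [mul_sub, sub_mul, hc]; abel
  rw [this]
  calc _ ≤ ‖B * (A - A')‖ + ‖(A - A') * B‖ := norm_sub_le _ _
    _ ≤ ‖B‖ * ‖A - A'‖ + ‖A - A'‖ * ‖B‖ := add_le_add (norm_mul_le _ _) (norm_mul_le _ _)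
    _ = 2 * ‖B‖ * ‖A - A'‖ := by ring
    _ ≤ _ := by gcongr

end SiteAverageNorm

/-! ### Dini derivatives of norms -/

section Dini

/-- The norm need not be differentiable; a first-order bound along the tangent line controls its
right Dini derivative, which is all that Grönwall's inequality needs. -/
theorem frequently_slope_norm_lt {E : Type*} [NormedAddCommGroup E] [NormedSpace ℝ E]
    {f : ℝ → E} {f' : E} {x b c : ℝ} (hf : HasDerivAt f f' x)
    (h : ∀ s : ℝ, 0 < s → ‖f x + s • f'‖ ≤ ‖f x‖ + s * b + c * s ^ 2) (r : ℝ) (hr : b < r) :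
    ∃ᶠ z in nhdsWithin x (Set.Ioi x), slope (norm ∘ f) x z < r := by
  apply Filter.Eventually.frequently
  have h1 := hasDerivAt_iff_isLittleO.1 hf
  have h2 := (h1.bound (c := (r - b) / 3) (by linarith)).filter_mono
    (nhdsWithin_le_nhds (s := Set.Ioi x))
  have h3 : ∀ᶠ z in nhdsWithin x (Set.Ioi x), c * (z - x) < (r - b) / 3 := by
    have : Filter.Tendsto (fun z => c * (z - x)) (nhdsWithin x (Set.Ioi x)) (nhds (c * (x - x))) :=
      ((continuous_const.mul (continuous_id.sub continuous_const)).tendsto x).mono_left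
        nhdsWithin_le_nhds
    rw [sub_self, mul_zero] at this
    exact this.eventually_lt_const (by linarith)
  filter_upwards [h2, h3, self_mem_nhdsWithin] with z hz2 hz3 hz
  have hpos : 0 < z - x := sub_pos.2 hz
  rw [slope_def_field, div_lt_iff₀ hpos]
  have e : f z = (f x + (z - x) • f') + (f z - f x - (z - x) • f') := by abel
  have h4 := norm_add_le (f x + (z - x) • f') (f z - f x - (z - x) • f')
  rw [← e] at h4
  rw [Real.norm_eq_abs, abs_of_pos hpos] at hz2
  have h5 := h (z - x) hpos
  simp only [Function.comp_apply]
  nlinarith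

/-- With W = 1 + isG, conjugation W X Wᴴ reproduces the commutator term up to s² G X G, and ‖W‖² ≤ 1
+ s²‖G‖². A Hermitian generator therefore affects the norm only at second order, however large it
is. -/
theorem norm_add_smul_commutator_le {n : Type*} [Fintype n] [DecidableEq n] {G : Matrix n n ℂ}
    (hG : G.IsHermitian) (X f : Matrix n n ℂ) {s : ℝ} (hs : 0 ≤ s) :
    ‖X + s • (Complex.I • (G * X - X * G) + f)‖ ≤
      ‖X‖ + s * ‖f‖ + 2 * ‖G‖ ^ 2 * ‖X‖ * s ^ 2 := by
  set W : Matrix n n ℂ := 1 + ((s : ℂ) * Complex.I) • G with hW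
  have hWs : Wᴴ = 1 - ((s : ℂ) * Complex.I) • G := by
    rw [hW, Matrix.conjTranspose_add, Matrix.conjTranspose_one, Matrix.conjTranspose_smul, hG.eq]
    simp [sub_eq_add_neg]
  have hc : ((s : ℂ) * Complex.I) * ((s : ℂ) * Complex.I) = -((s : ℂ) ^ 2) := by
    rw [mul_mul_mul_comm, Complex.I_mul_I]; ring
  have hWW : Wᴴ * W = 1 + ((s : ℂ) ^ 2) • (G * G) := by
    rw [hWs, hW, sub_mul, mul_add, mul_add, one_mul, mul_one, one_mul, Matrix.smul_mul,
      Matrix.mul_smul, smul_smul, hc, neg_smul]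
    abel
  have hn : ‖(((s : ℂ) ^ 2) • (G * G) : Matrix n n ℂ)‖ ≤ s ^ 2 * ‖G‖ ^ 2 := by
    rw [norm_smul, norm_pow, Complex.norm_real, Real.norm_eq_abs, sq_abs]
    have := norm_mul_le G G
    nlinarith [sq_nonneg s]
  have hW2 : ‖W‖ * ‖W‖ ≤ 1 + s ^ 2 * ‖G‖ ^ 2 := by
    rw [← Matrix.l2_opNorm_conjTranspose_mul_self, hWW]
    exact (norm_add_le _ _).trans (add_le_add norm_matrix_one_le hn)
  have hid : X + s • (Complex.I • (G * X - X * G) + f) =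
      W * X * Wᴴ - ((s : ℂ) ^ 2) • (G * X * G) + s • f := by
    have e1 : ∀ Z : Matrix n n ℂ, s • Z = (s : ℂ) • Z := fun Z => by
      ext; simp
    rw [hWs, hW, e1, e1, smul_add, smul_smul]
    simp only [add_mul, mul_sub, one_mul, mul_one, Matrix.smul_mul, Matrix.mul_smul, smul_smul, hc,
      neg_smul, smul_sub]
    abel
  rw [hid]
  have hWX : ‖W * X * Wᴴ‖ ≤ (1 + s ^ 2 * ‖G‖ ^ 2) * ‖X‖ := by
    calc ‖W * X * Wᴴ‖ ≤ ‖W‖ * ‖X‖ * ‖Wᴴ‖ :=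
          (norm_mul_le _ _).trans (mul_le_mul_of_nonneg_right (norm_mul_le _ _) (norm_nonneg _))
      _ = (‖W‖ * ‖W‖) * ‖X‖ := by rw [Matrix.l2_opNorm_conjTranspose]; ring
      _ ≤ _ := by gcongr
  have hGX : ‖(((s : ℂ) ^ 2) • (G * X * G) : Matrix n n ℂ)‖ ≤ s ^ 2 * ‖G‖ ^ 2 * ‖X‖ := by
    rw [norm_smul, norm_pow, Complex.norm_real, Real.norm_eq_abs, sq_abs]
    calc s ^ 2 * ‖G * X * G‖ ≤ s ^ 2 * (‖G‖ * ‖X‖ * ‖G‖) := by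
          gcongr
          exact (norm_mul_le _ _).trans (mul_le_mul_of_nonneg_right (norm_mul_le _ _) (norm_nonneg _))
      _ = _ := by ring
  have hf : ‖s • f‖ = s * ‖f‖ := by rw [norm_smul, Real.norm_eq_abs, abs_of_nonneg hs]
  calc _ ≤ ‖W * X * Wᴴ‖ + ‖(((s : ℂ) ^ 2) • (G * X * G) : Matrix n n ℂ)‖ + ‖s • f‖ :=
        (norm_add_le _ _).trans (add_le_add (norm_sub_le _ _) le_rfl)
    _ ≤ _ := by rw [hf]; nlinarith

end Dini

/-! ### Growth of site defects under Heisenberg evolution -/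

section Spreading

variable {ι : Type} [Fintype ι] [DecidableEq ι] {q : ι → ℕ}

/-- The interactions of the site `i` with all other sites. -/
def siteCoupling (h : ι → ι → Op q) (i : ι) : Op q :=
  ∑ j ∈ Finset.univ.erase i, (h i j + h j i)

theorem sum_eq_diag_add_coupling (h : ι → ι → Op q) (i : ι) :
    ∑ k, ∑ l, h k l = (h i i + ∑ k ∈ Finset.univ.erase i, ∑ l ∈ Finset.univ.erase i, h k l) +
      siteCoupling h i := by
  have e : ∀ k, ∑ l, h k l = h k i + ∑ l ∈ Finset.univ.erase i, h k l := fun k =>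
    (Finset.add_sum_erase _ _ (Finset.mem_univ i)).symm
  rw [← Finset.add_sum_erase _ _ (Finset.mem_univ i), siteCoupling, Finset.sum_add_distrib, e]
  simp only [e, Finset.sum_add_distrib]
  abel

/-- If B acts only on i, both sides vanish: the left by cyclicity of the trace, the right because
the average of A is trivial on i. This is what removes the on-site terms. -/
theorem siteAverage_commutator_of_local (i : ι) {B : Op q}
    (hB : siteAverage i B = B ∨ ∀ j, j ≠ i → siteAverage j B = B) (A : Op q) :
    siteAverage i (B * A - A * B) = B * siteAverage i A - siteAverage i A * B := by
  rcases hB with hB | hB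
  · rw [map_sub, siteAverage_mul_left i hB, siteAverage_mul_right i hB]
  · rw [map_sub, siteAverage_mul_comm i hB, sub_self, eq_comm, sub_eq_zero]
    refine (mul_comm_of_fixed {i} (fun k hk => ?_) (fun k hk => hB k (by simpa using hk))).symm
    rw [Finset.mem_singleton.1 hk, siteAverage_idem]

theorem siteAverage_commutator (h : ι → ι → Op q)
    (hloc : ∀ i j k, k ≠ i → k ≠ j → siteAverage k (h i j) = h i j) (i : ι) (A : Op q) :
    siteAverage i ((h i i + ∑ k ∈ Finset.univ.erase i, ∑ l ∈ Finset.univ.erase i, h k l) * A -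
        A * (h i i + ∑ k ∈ Finset.univ.erase i, ∑ l ∈ Finset.univ.erase i, h k l)) =
      (h i i + ∑ k ∈ Finset.univ.erase i, ∑ l ∈ Finset.univ.erase i, h k l) * siteAverage i A -
        siteAverage i A *
          (h i i + ∑ k ∈ Finset.univ.erase i, ∑ l ∈ Finset.univ.erase i, h k l) := by
  have h1 := siteAverage_commutator_of_local i (B := h i i)
    (Or.inr fun j hj => hloc i i j hj hj) A
  have hS : siteAverage i (∑ k ∈ Finset.univ.erase i, ∑ l ∈ Finset.univ.erase i, h k l) =
      ∑ k ∈ Finset.univ.erase i, ∑ l ∈ Finset.univ.erase i, h k l := by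
    rw [map_sum]
    refine Finset.sum_congr rfl fun k hk => ?_
    rw [map_sum]
    refine Finset.sum_congr rfl fun l hl => ?_
    exact hloc k l i (Finset.ne_of_mem_erase hk).symm (Finset.ne_of_mem_erase hl).symm
  have h2 := siteAverage_commutator_of_local i (Or.inl hS) A
  simp only [add_mul, mul_add]
  rw [add_sub_add_comm, map_add, h1, h2]
  abel

theorem norm_commutator_siteCoupling_le (h : ι → ι → Op q) (J : ι → ι → ℝ)
    (hloc : ∀ i j k, k ≠ i → k ≠ j → siteAverage k (h i j) = h i j)
    (hJ : ∀ i j, i ≠ j → ‖h i j‖ ≤ J i j) (hJs : ∀ i j, J i j = J j i) (i : ι) (A : Op q) :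
    ‖siteCoupling h i * A - A * siteCoupling h i‖ ≤
      ∑ j ∈ Finset.univ.erase i, 4 * J i j * (siteDefect i A + siteDefect j A) := by
  have e : siteCoupling h i * A - A * siteCoupling h i =
      ∑ j ∈ Finset.univ.erase i, ((h i j * A - A * h i j) + (h j i * A - A * h j i)) := by
    rw [siteCoupling, Finset.sum_mul, Finset.mul_sum, ← Finset.sum_sub_distrib]
    refine Finset.sum_congr rfl fun j _ => ?_
    rw [add_mul, mul_add]; abel
  rw [e]
  refine (norm_sum_le _ _).trans (Finset.sum_le_sum fun j hj => ?_)
  have hne : i ≠ j := (Finset.ne_of_mem_erase hj).symm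
  have h1 := norm_commutator_le_siteDefect (hloc i j) A
  have h2 := norm_commutator_le_siteDefect (hloc j i) A
  have h3 := hJ i j hne
  have h4 := hJ j i hne.symm
  rw [hJs j i] at h4
  have d1 := siteDefect_nonneg i A
  have d2 := siteDefect_nonneg j A
  refine (norm_add_le _ _).trans ?_
  nlinarith [mul_le_mul_of_nonneg_right h3 (add_nonneg d1 d2),
    mul_le_mul_of_nonneg_right h4 (add_nonneg d1 d2)]

/-- `siteDefect` evolves, to first order, by the couplings of the site only. -/
theorem norm_defect_step_le (h : ι → ι → Op q) (J : ι → ι → ℝ)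
    (hloc : ∀ i j k, k ≠ i → k ≠ j → siteAverage k (h i j) = h i j)
    (hherm : ∀ i j, (h i j).IsHermitian)
    (hJ : ∀ i j, i ≠ j → ‖h i j‖ ≤ J i j) (hJs : ∀ i j, J i j = J j i) (i : ι) :
    ∃ c : ℝ, 0 ≤ c ∧ ∀ A A' : Op q,
      A' = Complex.I • ((∑ k, ∑ l, h k l) * A - A * ∑ k, ∑ l, h k l) → ∀ s : ℝ, 0 ≤ s →
      ‖(A - siteAverage i A) + s • (A' - siteAverage i A')‖ ≤ siteDefect i A +
        s * (∑ j ∈ Finset.univ.erase i, 8 * J i j * (siteDefect i A + siteDefect j A)) +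
        c * siteDefect i A * s ^ 2 := by
  -- G is the Hamiltonian without the couplings of i. Commutation with it respects the average, so A
  -- - E_i A evolves by G up to a source f made of couplings.
  set G := h i i + ∑ k ∈ Finset.univ.erase i, ∑ l ∈ Finset.univ.erase i, h k l with hG
  have hGh : G.IsHermitian := by
    refine (hherm i i).add ?_
    exact isSelfAdjoint_sum _ fun k _ => isSelfAdjoint_sum _ fun l _ => hherm k l
  refine ⟨2 * ‖G‖ ^ 2, by positivity, fun A A' hA' s hs => ?_⟩
  set C := siteCoupling h i
  set f : Op q := Complex.I • ((C * A - A * C) - siteAverage i (C * A - A * C)) with hf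
  have e1 : A' - siteAverage i A' =
      Complex.I • (G * (A - siteAverage i A) - (A - siteAverage i A) * G) + f := by
    have h1 := siteAverage_commutator h hloc i A
    rw [← hG] at h1
    have h2 : (∑ k, ∑ l, h k l) * A - A * ∑ k, ∑ l, h k l = (G * A - A * G) + (C * A - A * C) := by
      rw [sum_eq_diag_add_coupling h i, add_mul, mul_add]; abel
    rw [hA', h2, map_smul, ← smul_sub, map_add, h1, hf, ← smul_add]
    congr 1
    rw [mul_sub, sub_mul]
    abel
  -- The 8 is 2 (norm of 1 - E_i) times 2 (commutator) times 2 (both `h i j` and `h j i`).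
  have hfn : ‖f‖ ≤ ∑ j ∈ Finset.univ.erase i, 8 * J i j * (siteDefect i A + siteDefect j A) := by
    rw [hf, norm_smul, Complex.norm_I, one_mul]
    refine (norm_sub_siteAverage_le i _).trans ?_
    have := norm_commutator_siteCoupling_le h J hloc hJ hJs i A
    refine (mul_le_mul_of_nonneg_left this zero_le_two).trans (le_of_eq ?_)
    rw [Finset.mul_sum]
    exact Finset.sum_congr rfl fun j _ => by ring
  rw [e1]
  refine (norm_add_smul_commutator_le hGh _ f hs).trans ?_
  rw [← siteDefect]
  gcongr

theorem hasDerivAt_siteAverage {O : ℝ → Op q} {O' : Op q} {u : ℝ} (hO : HasDerivAt O O' u) (i : ι) :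
    HasDerivAt (fun u => siteAverage i (O u)) (siteAverage i O') u :=
  (((siteAverage i : Op q →ₗ[ℂ] Op q).restrictScalars ℝ).mkContinuous 1
    (fun A => by simpa using norm_siteAverage_le i A)).hasFDerivAt.comp_hasDerivAt u hO

variable {h : ι → ι → ℝ → Op q} {J : ι → ι → ℝ} {O : ℝ → Op q} {w : ι → ℝ} {v N : ℝ}

/-- Exponential growth of weighted defects under the Heisenberg evolution. -/
theorem siteDefect_le_exp
    (hloc : ∀ i j k u, k ≠ i → k ≠ j → siteAverage k (h i j u) = h i j u)
    (hherm : ∀ i j u, (h i j u).IsHermitian)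
    (hJ : ∀ i j u, i ≠ j → ‖h i j u‖ ≤ J i j) (hJs : ∀ i j, J i j = J j i) (hJ0 : ∀ i j, 0 ≤ J i j)
    (hO : ∀ u, HasDerivAt O
      (Complex.I • ((∑ k, ∑ l, h k l u) * O u - O u * ∑ k, ∑ l, h k l u)) u)
    (hw : ∀ i, 0 < w i)
    (hv : ∀ i, ∑ j ∈ Finset.univ.erase i, 8 * J i j * (w i + w j) ≤ v * w i)
    (hv0 : 0 ≤ v) (hN : 0 ≤ N) (h0 : ∀ i, siteDefect i (O 0) ≤ N * w i) {u : ℝ} (hu : 0 ≤ u)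
    (i : ι) : siteDefect i (O u) ≤ N * Real.exp (v * u) * w i := by
  -- Dividing by the weights turns the claim into a bound on one sup norm, whose growth rate is v by
  -- `hv`.
  set Ξ : ℝ → ι → Op q := fun u i => (w i)⁻¹ • (O u - siteAverage i (O u)) with hΞ
  set O' : ℝ → Op q := fun u =>
    Complex.I • ((∑ k, ∑ l, h k l u) * O u - O u * ∑ k, ∑ l, h k l u) with hO'
  have hΞd : ∀ u, HasDerivAt Ξ (fun i => (w i)⁻¹ • (O' u - siteAverage i (O' u))) u := fun u =>
    hasDerivAt_pi.2 fun i => ((hO u).sub (hasDerivAt_siteAverage (hO u) i)).const_smul (w i)⁻¹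
  have hnorm : ∀ u i, ‖Ξ u i‖ = (w i)⁻¹ * siteDefect i (O u) := fun u i => by
    rw [hΞ, norm_smul, norm_inv, Real.norm_eq_abs, abs_of_pos (hw i)]; rfl
  have hle : ∀ u i, siteDefect i (O u) ≤ ‖Ξ u‖ * w i := fun u i => by
    have := norm_le_pi_norm (Ξ u) i
    rw [hnorm, inv_mul_le_iff₀ (hw i)] at this
    linarith
  have hΞ0 : ‖Ξ 0‖ ≤ N := by
    refine (pi_norm_le_iff_of_nonneg hN).2 fun i => ?_
    rw [hnorm, inv_mul_le_iff₀ (hw i)]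
    linarith [h0 i]
  have hslope : ∀ x, ∀ r, v * ‖Ξ x‖ < r →
      ∃ᶠ z in nhdsWithin x (Set.Ioi x), slope (norm ∘ Ξ) x z < r := by
    intro x
    choose c hc0 hc using fun i => norm_defect_step_le (fun i j => h i j x) J
      (fun i j k => hloc i j k x) (fun i j => hherm i j x) (fun i j => hJ i j x) hJs i
    refine frequently_slope_norm_lt (c := (∑ i, c i) * ‖Ξ x‖) (hΞd x) fun s hs => ?_
    have hc1 : 0 ≤ ∑ i, c i := Finset.sum_nonneg fun i _ => hc0 i
    refine (pi_norm_le_iff_of_nonneg (by positivity)).2 fun i => ?_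
    have h1 := hc i (O x) (O' x) rfl s hs.le
    have e : Ξ x i + s • ((w i)⁻¹ • (O' x - siteAverage i (O' x))) =
        (w i)⁻¹ • ((O x - siteAverage i (O x)) + s • (O' x - siteAverage i (O' x))) := by
      rw [smul_add, smul_comm s]
    simp only [Pi.add_apply, Pi.smul_apply]
    rw [e, norm_smul, norm_inv, Real.norm_eq_abs, abs_of_pos (hw i), inv_mul_le_iff₀ (hw i)]
    refine h1.trans ?_
    have h2 : ∑ j ∈ Finset.univ.erase i, 8 * J i j * (siteDefect i (O x) + siteDefect j (O x)) ≤
        w i * (v * ‖Ξ x‖) := by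
      calc _ ≤ ∑ j ∈ Finset.univ.erase i, ‖Ξ x‖ * (8 * J i j * (w i + w j)) := by
            refine Finset.sum_le_sum fun j _ => ?_
            have := hle x i; have := hle x j; have := hJ0 i j
            nlinarith
        _ = ‖Ξ x‖ * ∑ j ∈ Finset.univ.erase i, 8 * J i j * (w i + w j) := by
            rw [Finset.mul_sum]
        _ ≤ ‖Ξ x‖ * (v * w i) := by gcongr; exact hv i
        _ = _ := by ring
    have h3 : c i ≤ ∑ i, c i := Finset.single_le_sum (fun i _ => hc0 i) (Finset.mem_univ i)
    have h4 : c i * siteDefect i (O x) ≤ w i * ((∑ i, c i) * ‖Ξ x‖) := by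
      calc _ ≤ (∑ i, c i) * (‖Ξ x‖ * w i) :=
            mul_le_mul h3 (hle x i) (siteDefect_nonneg _ _) hc1
        _ = _ := by ring
    have h5 := hle x i
    nlinarith [sq_nonneg s, mul_le_mul_of_nonneg_left h2 hs.le,
      mul_le_mul_of_nonneg_right h4 (sq_nonneg s)]
  have hcont : ContinuousOn (norm ∘ Ξ) (Set.Icc 0 u) :=
    continuous_norm.comp_continuousOn fun x _ => (hΞd x).continuousAt.continuousWithinAt
  have hG := le_gronwallBound_of_liminf_deriv_right_le (f := norm ∘ Ξ)
    (f' := fun x => v * ‖Ξ x‖) (δ := N) (K := v) (ε := 0) (a := 0) (b := u) hcont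
    (fun x _ r hr => by
      refine (hslope x r hr).mono fun z hz => ?_
      rwa [slope_def_field, div_eq_inv_mul] at hz) hΞ0 (fun x _ => by simp)
    u ⟨hu, le_rfl⟩
  rw [gronwallBound_ε0, sub_zero] at hG
  exact (hle u i).trans (mul_le_mul_of_nonneg_right hG (hw i).le)

/-- Lieb-Robinson growth of the defect at a site outside the initial support. -/
theorem siteDefect_le_exp_sub_one
    (hloc : ∀ i j k u, k ≠ i → k ≠ j → siteAverage k (h i j u) = h i j u)
    (hherm : ∀ i j u, (h i j u).IsHermitian)
    (hJ : ∀ i j u, i ≠ j → ‖h i j u‖ ≤ J i j) (hJs : ∀ i j, J i j = J j i) (hJ0 : ∀ i j, 0 ≤ J i j)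
    (hO : ∀ u, HasDerivAt O
      (Complex.I • ((∑ k, ∑ l, h k l u) * O u - O u * ∑ k, ∑ l, h k l u)) u)
    (hw : ∀ i, 0 < w i)
    (hv : ∀ i, ∑ j ∈ Finset.univ.erase i, 8 * J i j * (w i + w j) ≤ v * w i)
    (hv0 : 0 ≤ v) (hN : 0 ≤ N) (h0 : ∀ i, siteDefect i (O 0) ≤ N * w i) {u : ℝ} (hu : 0 ≤ u)
    {i : ι} (hi : siteDefect i (O 0) = 0) :
    siteDefect i (O u) ≤ N * (Real.exp (v * u) - 1) * w i := by
  set X : ℝ → Op q := fun u => O u - siteAverage i (O u) with hX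
  have hXd : ∀ u, HasDerivAt X _ u := fun u => (hO u).sub (hasDerivAt_siteAverage (hO u) i)
  have hcont : ContinuousOn (norm ∘ X) (Set.Icc 0 u) :=
    continuous_norm.comp_continuousOn fun x _ => (hXd x).continuousAt.continuousWithinAt
  have hB : ∀ x, HasDerivAt (fun x => N * (Real.exp (v * x) - 1) * w i)
      (N * (Real.exp (v * x) * (v * 1)) * w i) x := fun x =>
    (((((hasDerivAt_id x).const_mul v).exp).sub_const 1).const_mul N).mul_const (w i)
  -- The exponential bound holds at every site, so the defect at i grows at rate at most N v e^(vx)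
  -- w_i. Integrating from zero gives e^(vu) - 1.
  refine image_le_of_liminf_slope_right_le_deriv_boundary (f := norm ∘ X) hcont
    (B := fun x => N * (Real.exp (v * x) - 1) * w i)
    (B' := fun x => N * (Real.exp (v * x) * (v * 1)) * w i) ?_
    (fun x _ => (hB x).continuousAt.continuousWithinAt) (fun x _ => (hB x).hasDerivWithinAt) ?_
    ⟨hu, le_rfl⟩
  · simpa using norm_le_zero_iff.1 hi.le
  · intro x hx r hr
    obtain ⟨c, hc0, hc⟩ := norm_defect_step_le (fun i j => h i j x) J
      (fun i j k => hloc i j k x) (fun i j => hherm i j x) (fun i j => hJ i j x) hJs i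
    refine frequently_slope_norm_lt (c := c * siteDefect i (O x)) (hXd x)
      (fun s hs => hc (O x) _ rfl s hs.le) r (lt_of_le_of_lt ?_ hr)
    have hle := siteDefect_le_exp hloc hherm hJ hJs hJ0 hO hw hv hv0 hN h0 hx.1
    calc _ ≤ ∑ j ∈ Finset.univ.erase i,
          N * Real.exp (v * x) * (8 * J i j * (w i + w j)) := by
          refine Finset.sum_le_sum fun j _ => ?_
          have := hle i; have := hle j; have := hJ0 i j
          nlinarith
      _ = N * Real.exp (v * x) * ∑ j ∈ Finset.univ.erase i, 8 * J i j * (w i + w j) := by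
          rw [Finset.mul_sum]
      _ ≤ N * Real.exp (v * x) * (v * w i) := by gcongr; exact hv i
      _ = _ := by ring

end Spreading

/-! ### A reproducing kernel uniform in the exponent -/

section Kernel

/-- The larger of an exponential and a power law. -/
def decay (β s : ℝ) : ℝ := max (Real.exp (-4 * s)) ((1 + s) ^ (-β))

theorem decay_pos (β s : ℝ) : 0 < decay β s := lt_max_of_lt_left (Real.exp_pos _)

theorem decay_antitone {β s t : ℝ} (hβ : 0 ≤ β) (hs : 0 ≤ s) (hst : s ≤ t) :
    decay β t ≤ decay β s :=
  max_le_max (Real.exp_le_exp.2 (by linarith))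
    (Real.rpow_le_rpow_of_nonpos (by linarith) (by linarith) (by linarith))

theorem decay_le_add {β s : ℝ} (hβ : 0 ≤ β) (hs : 0 < s) :
    decay β s ≤ Real.exp (-4 * s) + s ^ (-β) := by
  have h1 : (1 + s) ^ (-β) ≤ s ^ (-β) :=
    Real.rpow_le_rpow_of_nonpos hs (by linarith) (by linarith)
  exact max_le (le_add_of_nonneg_right (Real.rpow_nonneg hs.le _))
    (h1.trans (le_add_of_nonneg_left (Real.exp_pos _).le))

theorem decay_zero (β : ℝ) : decay β 0 = 1 := by simp [decay]

theorem decay_le_one {β s : ℝ} (hβ : 0 ≤ β) (hs : 0 ≤ s) : decay β s ≤ 1 := by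
  rw [← decay_zero β]; exact decay_antitone hβ le_rfl hs

/-- Where the power exceeds the exponential at b, β ≤ 4(1+b). Beyond b the power then has
logarithmic slope at most 4, so over a further distance a it loses no more than e^(-4a). -/
theorem exp_mul_rpow_le {β a b : ℝ} (ha : 0 ≤ a) (hb : 0 ≤ b) (hβ : 0 ≤ β)
    (h : Real.exp (-4 * b) ≤ (1 + b) ^ (-β)) :
    Real.exp (-4 * a) * (1 + b) ^ (-β) ≤ decay β (a + b) := by
  have hb1 : 0 < 1 + b := by linarith
  rcases hb.eq_or_lt with rfl | hb0
  · simp [decay]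
  have h1 : β * Real.log (1 + b) ≤ 4 * b := by
    rw [Real.rpow_def_of_pos hb1, Real.exp_le_exp] at h
    linarith
  have h2 : b / (1 + b) ≤ Real.log (1 + b) := by
    have := Real.one_sub_inv_le_log_of_pos hb1
    have e : 1 - (1 + b)⁻¹ = b / (1 + b) := by field_simp; ring
    linarith
  -- From β log(1+b) ≤ 4b and log(1+b) ≥ b/(1+b).
  have h3 : β ≤ 4 * (1 + b) := by
    have h4 : β * (b / (1 + b)) ≤ 4 * b := (mul_le_mul_of_nonneg_left h2 hβ).trans h1
    rw [mul_div_assoc', div_le_iff₀ hb1] at h4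
    nlinarith
  refine le_max_of_le_right ?_
  rw [Real.rpow_def_of_pos hb1, Real.rpow_def_of_pos (by linarith), ← Real.exp_add,
    Real.exp_le_exp]
  have h5 : Real.log (1 + (a + b)) - Real.log (1 + b) ≤ a / (1 + b) := by
    rw [← Real.log_div (by linarith) (by linarith)]
    have := Real.log_le_sub_one_of_pos (x := (1 + (a + b)) / (1 + b)) (by positivity)
    have e : (1 + (a + b)) / (1 + b) - 1 = a / (1 + b) := by field_simp; ring
    linarith
  have h6 : β * (a / (1 + b)) ≤ 4 * a := by
    rw [mul_div_assoc', div_le_iff₀ hb1]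
    nlinarith
  nlinarith [mul_le_mul_of_nonneg_left h5 hβ]

/-- Two exponentials multiply exactly, two powers satisfy (1+a)(1+b) ≥ 1+a+b, and the mixed cases
are `exp_mul_rpow_le`. No β-dependent constant appears. -/
theorem decay_mul_le {β a b : ℝ} (hβ : 0 ≤ β) (ha : 0 ≤ a) (hb : 0 ≤ b) :
    decay β a * decay β b ≤ decay β (a + b) := by
  rcases le_total (Real.exp (-4 * a)) ((1 + a) ^ (-β)) with h1 | h1 <;>
  rcases le_total (Real.exp (-4 * b)) ((1 + b) ^ (-β)) with h2 | h2
  · rw [decay, decay, max_eq_right h1, max_eq_right h2,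
      ← Real.mul_rpow (by linarith) (by linarith)]
    exact le_max_of_le_right
      (Real.rpow_le_rpow_of_nonpos (by linarith) (by nlinarith) (by linarith))
  · rw [decay, decay, max_eq_right h1, max_eq_left h2, mul_comm, add_comm a b]
    exact exp_mul_rpow_le hb ha hβ h1
  · rw [decay, decay, max_eq_left h1, max_eq_right h2]
    exact exp_mul_rpow_le ha hb hβ h2
  · rw [decay, decay, max_eq_left h1, max_eq_left h2, ← Real.exp_add]
    exact le_max_of_le_left (Real.exp_le_exp.2 (by linarith))

/-- For β ≥ 4s, s log s ≥ s - 1 gives s^(-β) ≤ e^(4-4s). For β ≤ 4s, replacing s by 1+s costs at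
most e^(β/s) ≤ e^4. -/
theorem rpow_neg_le_decay {β s : ℝ} (hβ : 0 ≤ β) (hs : 1 ≤ s) :
    s ^ (-β) ≤ Real.exp 4 * decay β s := by
  have hs0 : 0 < s := by linarith
  rcases le_total (4 * s) β with h | h
  · have : s ^ (-β) ≤ Real.exp 4 * Real.exp (-4 * s) := by
      rw [Real.rpow_def_of_pos hs0, ← Real.exp_add, Real.exp_le_exp]
      have h1 := Real.one_sub_inv_le_log_of_pos hs0
      have h2 : 0 ≤ Real.log s := Real.log_nonneg hs
      have h3 : 4 * (s * (1 - s⁻¹)) ≤ 4 * (s * Real.log s) := by gcongr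
      have e : s * (1 - s⁻¹) = s - 1 := by field_simp
      nlinarith
    exact this.trans (mul_le_mul_of_nonneg_left (le_max_left _ _) (Real.exp_pos _).le)
  · have : s ^ (-β) ≤ Real.exp 4 * (1 + s) ^ (-β) := by
      rw [Real.rpow_def_of_pos hs0, Real.rpow_def_of_pos (by linarith), ← Real.exp_add,
        Real.exp_le_exp]
      have h5 : Real.log (1 + s) - Real.log s ≤ 1 / s := by
        rw [← Real.log_div (by linarith) (by linarith)]
        have := Real.log_le_sub_one_of_pos (x := (1 + s) / s) (by positivity)
        have e : (1 + s) / s - 1 = 1 / s := by field_simp; ring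
        linarith
      have h6 : β * (1 / s) ≤ 4 := by
        rw [mul_one_div, div_le_iff₀ hs0]; linarith
      nlinarith [mul_le_mul_of_nonneg_left h5 hβ]
    exact this.trans (mul_le_mul_of_nonneg_left (le_max_right _ _) (Real.exp_pos _).le)

/-- A reproducing decay function dominating the power law with exponent `p + β`. -/
def kernel (p β s : ℝ) : ℝ := (1 + s) ^ (-p) * decay β s

theorem kernel_pos {p β s : ℝ} (hs : 0 ≤ s) : 0 < kernel p β s :=
  mul_pos (Real.rpow_pos_of_pos (by linarith) _) (decay_pos _ _)

theorem kernel_zero (p β : ℝ) : kernel p β 0 = 1 := by simp [kernel, decay_zero]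

theorem rpow_neg_le_kernel {p β s : ℝ} (hp : 0 ≤ p) (hβ : 0 ≤ β) (hs : 1 ≤ s) :
    s ^ (-(p + β)) ≤ 2 ^ p * Real.exp 4 * kernel p β s := by
  have hs0 : 0 < s := by linarith
  have h1 : s ^ (-p) ≤ 2 ^ p * (1 + s) ^ (-p) := by
    rw [Real.rpow_neg hs0.le, Real.rpow_neg (by linarith), ← div_eq_mul_inv,
      le_div_iff₀ (Real.rpow_pos_of_pos (by linarith) _), inv_mul_le_iff₀
      (Real.rpow_pos_of_pos hs0 _), ← Real.mul_rpow hs0.le zero_le_two]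
    exact Real.rpow_le_rpow (by linarith) (by linarith) hp
  rw [neg_add, Real.rpow_add hs0]
  calc s ^ (-p) * s ^ (-β) ≤ (2 ^ p * (1 + s) ^ (-p)) * (Real.exp 4 * decay β s) :=
        mul_le_mul h1 (rpow_neg_le_decay hβ hs) (Real.rpow_nonneg hs0.le _)
          (mul_nonneg (by positivity) (Real.rpow_nonneg (by linarith) _))
    _ = _ := by rw [kernel]; ring

/-- The larger of a and b is at least c/2, so its factor is comparable to (1+c)^(-p) and the other
is left to be summed. The 2^p involves only p because `decay` is submultiplicative. -/
theorem kernel_mul_le {p β a b c : ℝ} (hp : 0 ≤ p) (hβ : 0 ≤ β) (ha : 0 ≤ a) (hb : 0 ≤ b)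
    (hc : 0 ≤ c) (h : c ≤ a + b) :
    kernel p β a * kernel p β b ≤
      2 ^ p * ((1 + a) ^ (-p) + (1 + b) ^ (-p)) * kernel p β c := by
  have aux : ∀ x y : ℝ, 0 ≤ x → y ≤ x → 0 ≤ y → c ≤ x + y →
      (1 + x) ^ (-p) ≤ 2 ^ p * (1 + c) ^ (-p) := by
    intro x y hx hyx hy hcx
    rw [Real.rpow_neg (by linarith), Real.rpow_neg (by linarith), ← div_eq_mul_inv,
      le_div_iff₀ (Real.rpow_pos_of_pos (by linarith) _), inv_mul_le_iff₀
      (Real.rpow_pos_of_pos (by linarith) _), ← Real.mul_rpow (by linarith) zero_le_two]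
    exact Real.rpow_le_rpow (by linarith) (by linarith) hp
  have hA : 0 ≤ (1 + a) ^ (-p) := Real.rpow_nonneg (by linarith) _
  have hB : 0 ≤ (1 + b) ^ (-p) := Real.rpow_nonneg (by linarith) _
  have hC : 0 ≤ 2 ^ p * (1 + c) ^ (-p) :=
    mul_nonneg (by positivity) (Real.rpow_nonneg (by linarith) _)
  have h1 : (1 + a) ^ (-p) * (1 + b) ^ (-p) ≤
      (2 ^ p * (1 + c) ^ (-p)) * ((1 + a) ^ (-p) + (1 + b) ^ (-p)) := by
    rcases le_total b a with hab | hab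
    · have := mul_le_mul_of_nonneg_right (aux a b ha hab hb h) hB
      nlinarith [mul_nonneg hC hA]
    · have := mul_le_mul_of_nonneg_right (aux b a hb hab ha (by linarith)) hA
      nlinarith [mul_nonneg hC hB]
  have h2 : decay β a * decay β b ≤ decay β c :=
    (decay_mul_le hβ ha hb).trans (decay_antitone hβ hc h)
  calc kernel p β a * kernel p β b =
      ((1 + a) ^ (-p) * (1 + b) ^ (-p)) * (decay β a * decay β b) := by
        rw [kernel, kernel]; ring
    _ ≤ ((2 ^ p * (1 + c) ^ (-p)) * ((1 + a) ^ (-p) + (1 + b) ^ (-p))) * decay β c :=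
        mul_le_mul h1 h2 (mul_nonneg (decay_pos _ _).le (decay_pos _ _).le)
          (mul_nonneg hC (add_nonneg hA hB))
    _ = _ := by rw [kernel]; ring

end Kernel

/-! ### Counting lattice points and tails of lattice sums -/

section Lattice

variable {D : ℕ}

theorem toReal_sub (x y : Site D) : (x - y).toReal = x.toReal - y.toReal := by
  ext k; simp [Site.toReal]

theorem siteDist_eq_norm (x y : Site D) : siteDist x y = ‖(x - y).toReal‖ := by
  rw [siteDist, toReal_sub]

theorem siteDist_comm (x y : Site D) : siteDist x y = siteDist y x := norm_sub_rev _ _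

theorem siteDist_self (x : Site D) : siteDist x x = 0 := by simp [siteDist]

theorem siteDist_nonneg (x y : Site D) : 0 ≤ siteDist x y := norm_nonneg _

theorem siteDist_triangle (x y z : Site D) : siteDist x z ≤ siteDist x y + siteDist y z :=
  norm_sub_le_norm_sub_add_norm_sub _ _ _

theorem norm_toReal_sq (z : Site D) : ‖z.toReal‖ ^ 2 = ∑ k, (z k : ℝ) ^ 2 := by
  rw [EuclideanSpace.norm_sq_eq]
  simp [Site.toReal]

theorem abs_coord_le_norm (z : Site D) (k : Fin D) : |(z k : ℝ)| ≤ ‖z.toReal‖ := by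
  have := PiLp.norm_apply_le (p := 2) z.toReal k
  simpa [Site.toReal] using this

theorem one_le_norm_toReal {z : Site D} (hz : z ≠ 0) : 1 ≤ ‖z.toReal‖ := by
  obtain ⟨k, hk⟩ : ∃ k, z k ≠ 0 := by
    by_contra hcon
    push Not at hcon
    exact hz (funext hcon)
  refine le_trans ?_ (abs_coord_le_norm z k)
  exact_mod_cast Int.one_le_abs hk

theorem one_le_siteDist {x y : Site D} (h : x ≠ y) : 1 ≤ siteDist x y := by
  rw [siteDist_eq_norm]; exact one_le_norm_toReal (sub_ne_zero.2 h)

theorem sum_abs_coord_le (z : Site D) : ∑ k, |(z k : ℝ)| ≤ D * ‖z.toReal‖ := by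
  refine (Finset.sum_le_card_nsmul _ _ _ fun k _ => abs_coord_le_norm z k).trans (le_of_eq ?_)
  simp

theorem card_le_of_norm_le (s : Finset (Site D)) {ρ : ℝ} (hρ : 0 ≤ ρ)
    (h : ∀ z ∈ s, ‖z.toReal‖ ≤ ρ) : (s.card : ℝ) ≤ (2 * ρ + 1) ^ D := by
  have hsub : s ⊆ Fintype.piFinset fun _ : Fin D => Finset.Icc (-⌊ρ⌋) ⌊ρ⌋ := by
    intro z hz
    rw [Fintype.mem_piFinset]
    intro k
    have h1 := abs_le.1 ((abs_coord_le_norm z k).trans (h z hz))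
    rw [Finset.mem_Icc]
    refine ⟨?_, Int.le_floor.2 h1.2⟩
    rw [neg_le]
    refine Int.le_floor.2 ?_
    push_cast
    linarith
  have h2 := Finset.card_le_card hsub
  rw [Fintype.card_piFinset_const, Int.card_Icc] at h2
  have h3 : 0 ≤ ⌊ρ⌋ := Int.floor_nonneg.2 hρ
  have h4 : (((⌊ρ⌋ + 1 - -⌊ρ⌋).toNat : ℕ) : ℝ) ≤ 2 * ρ + 1 := by
    have : (((⌊ρ⌋ + 1 - -⌊ρ⌋).toNat : ℤ) : ℝ) = ((⌊ρ⌋ + 1 - -⌊ρ⌋ : ℤ) : ℝ) := by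
      rw [Int.toNat_of_nonneg (by linarith)]
    have h5 := Int.floor_le ρ
    push_cast at this ⊢
    linarith
  calc (s.card : ℝ) ≤ (((⌊ρ⌋ + 1 - -⌊ρ⌋).toNat ^ D : ℕ) : ℝ) := by exact_mod_cast h2
    _ ≤ _ := by push_cast; gcongr

/-- Tails of the lattice sum of `|z| ^ (-(D + η))`. -/
theorem exists_tail_bound (D : ℕ) {η : ℝ} (hη : 0 < η) : ∃ C : ℝ, 0 < C ∧
    ∀ (l : ℝ), 1 ≤ l → ∀ s : Finset (Site D), (∀ z ∈ s, l ≤ ‖z.toReal‖) →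
      ∑ z ∈ s, ‖z.toReal‖ ^ (-((D : ℝ) + η)) ≤ C * l ^ (-η) := by
  have hr1 : (2 : ℝ) ^ (-η) < 1 := Real.rpow_lt_one_of_one_lt_of_neg one_lt_two (by linarith)
  have hr0 : 0 < (2 : ℝ) ^ (-η) := by positivity
  refine ⟨5 ^ D * (1 - (2 : ℝ) ^ (-η))⁻¹,
    mul_pos (by positivity) (inv_pos.2 (by linarith)), fun l hl s hs => ?_⟩
  have hl0 : 0 < l := by linarith
  -- κ z is the index of the dyadic shell l 2^κ ≤ |z| ≤ l 2^(κ+1).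
  let κ : Site D → ℕ := fun z => Nat.log 2 ⌊‖z.toReal‖ / l⌋₊
  have hκ : ∀ z ∈ s, l * 2 ^ κ z ≤ ‖z.toReal‖ ∧ ‖z.toReal‖ ≤ l * 2 ^ (κ z + 1) := by
    intro z hz
    have h1 : 1 ≤ ‖z.toReal‖ / l := (one_le_div hl0).2 (hs z hz)
    have h2 : 1 ≤ ⌊‖z.toReal‖ / l⌋₊ := Nat.le_floor (by simpa using h1)
    constructor
    · have h3 : 2 ^ κ z ≤ ⌊‖z.toReal‖ / l⌋₊ := Nat.pow_log_le_self 2 (by omega)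
      have h4 : ((2 ^ κ z : ℕ) : ℝ) ≤ ‖z.toReal‖ / l :=
        (Nat.cast_le.2 h3).trans (Nat.floor_le (by linarith))
      rw [le_div_iff₀ hl0] at h4
      push_cast at h4
      linarith
    · have h3 : ⌊‖z.toReal‖ / l⌋₊ < 2 ^ (κ z + 1) := Nat.lt_pow_succ_log_self (by norm_num) _
      have h4 : ‖z.toReal‖ / l < ((2 ^ (κ z + 1) : ℕ) : ℝ) := (Nat.floor_lt (by linarith)).1 h3
      rw [div_lt_iff₀ hl0] at h4
      push_cast at h4
      linarith
  obtain ⟨K, hK⟩ : ∃ K, ∀ z ∈ s, κ z < K := by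
    refine ⟨s.sup κ + 1, fun z hz => Nat.lt_succ_of_le (Finset.le_sup hz)⟩
  rw [← Finset.sum_fiberwise_of_maps_to (t := Finset.range K) (g := κ)
    (fun z hz => Finset.mem_range.2 (hK z hz))]
  have hfib : ∀ k ∈ Finset.range K, ∑ z ∈ s.filter (fun z => κ z = k),
      ‖z.toReal‖ ^ (-((D : ℝ) + η)) ≤ 5 ^ D * l ^ (-η) * ((2 : ℝ) ^ (-η)) ^ k := by
    intro k _
    have hL : 1 ≤ l * 2 ^ k := by
      have : (1 : ℝ) ≤ 2 ^ k := one_le_pow₀ (by norm_num)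
      nlinarith
    have hL0 : 0 < l * 2 ^ k := by linarith
    -- With L = l 2^k ≥ 1, the shell lies in the ball of radius 2L, and 2(2L) + 1 ≤ 5L.
    have hcard : ((s.filter (fun z => κ z = k)).card : ℝ) ≤ (5 * (l * 2 ^ k)) ^ D := by
      refine (card_le_of_norm_le _ (ρ := l * 2 ^ (k + 1)) (by positivity) fun z hz => ?_).trans ?_
      · rw [Finset.mem_filter] at hz
        rw [← hz.2]; exact (hκ z hz.1).2
      · gcongr
        rw [pow_succ]; linarith
    have hterm : ∀ z ∈ s.filter (fun z => κ z = k),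
        ‖z.toReal‖ ^ (-((D : ℝ) + η)) ≤ (l * 2 ^ k) ^ (-((D : ℝ) + η)) := by
      intro z hz
      rw [Finset.mem_filter] at hz
      refine Real.rpow_le_rpow_of_nonpos hL0 ?_ (by
        have : (0 : ℝ) ≤ D := Nat.cast_nonneg D
        linarith)
      rw [← hz.2]; exact (hκ z hz.1).1
    refine (Finset.sum_le_card_nsmul _ _ _ hterm).trans ?_
    rw [nsmul_eq_mul]
    calc _ ≤ (5 * (l * 2 ^ k)) ^ D * (l * 2 ^ k) ^ (-((D : ℝ) + η)) := by
          gcongr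
      _ = 5 ^ D * (l * 2 ^ k) ^ (-η) := by
          rw [mul_pow, neg_add, Real.rpow_add hL0, Real.rpow_neg hL0.le, Real.rpow_natCast]
          field_simp
      _ = _ := by
          have e : ((2 : ℝ) ^ k) ^ (-η) = ((2 : ℝ) ^ (-η)) ^ k := by
            rw [← Real.rpow_natCast, ← Real.rpow_natCast, ← Real.rpow_mul (by norm_num),
              ← Real.rpow_mul (by norm_num), mul_comm]
          rw [Real.mul_rpow hl0.le (by positivity), e]
          ring
  refine (Finset.sum_le_sum hfib).trans ?_
  rw [← Finset.mul_sum]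
  have hgeo : ∑ k ∈ Finset.range K, ((2 : ℝ) ^ (-η)) ^ k ≤ (1 - (2 : ℝ) ^ (-η))⁻¹ := by
    have := (summable_geometric_of_lt_one hr0.le hr1).sum_le_tsum (Finset.range K)
      (fun k _ => by positivity)
    rwa [tsum_geometric_of_lt_one hr0.le hr1] at this
  calc _ ≤ 5 ^ D * l ^ (-η) * (1 - (2 : ℝ) ^ (-η))⁻¹ := by gcongr
    _ = _ := by ring

/-- Lattice sums of `(1 + |x - y|) ^ (-p)`, `p ≥ D + 1`. -/
theorem exists_sum_bound (D : ℕ) : ∃ C : ℝ, 1 ≤ C ∧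
    ∀ p : ℝ, (D : ℝ) + 1 ≤ p → ∀ (s : Finset (Site D)) (x : Site D),
      ∑ y ∈ s, (1 + siteDist x y) ^ (-p) ≤ C := by
  obtain ⟨C, hC0, hC⟩ := exists_tail_bound D one_pos
  refine ⟨1 + C, by linarith, fun p hp s x => ?_⟩
  have hD : (0 : ℝ) ≤ D := Nat.cast_nonneg D
  have h1 : ∑ y ∈ s.erase x, (1 + siteDist x y) ^ (-p) ≤ C := by
    have h2 := hC 1 le_rfl ((s.erase x).map ⟨fun y => x - y, sub_right_injective⟩) (by
      intro z hz
      simp only [Finset.mem_map, Function.Embedding.coeFn_mk] at hz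
      obtain ⟨y, hy, rfl⟩ := hz
      exact one_le_norm_toReal (sub_ne_zero.2 (Finset.ne_of_mem_erase hy).symm))
    rw [Finset.sum_map, Real.one_rpow, mul_one] at h2
    refine (Finset.sum_le_sum fun y hy => ?_).trans h2
    have h3 := one_le_siteDist (Finset.ne_of_mem_erase hy).symm
    simp only [Function.Embedding.coeFn_mk]
    rw [← siteDist_eq_norm]
    calc (1 + siteDist x y) ^ (-p) ≤ (1 + siteDist x y) ^ (-((D : ℝ) + 1)) :=
          Real.rpow_le_rpow_of_exponent_le (by linarith) (by linarith)
      _ ≤ _ := Real.rpow_le_rpow_of_nonpos (by linarith) (by linarith) (by linarith)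
  by_cases hx : x ∈ s
  · rw [← Finset.add_sum_erase _ _ hx, siteDist_self]
    simp only [add_zero, Real.one_rpow]
    linarith
  · rw [Finset.erase_eq_of_notMem hx] at h1
    linarith

end Lattice

/-! ### Pairs of sites across a spherical shell -/

section BoundarySums

variable {D : ℕ}

/-- The lattice points in the open Euclidean ball of radius `ρ` about the origin. -/
def latticeBall (D : ℕ) (ρ : ℝ) : Finset (Site D) :=
  (Fintype.piFinset fun _ : Fin D => Finset.Icc (-⌈ρ⌉) ⌈ρ⌉).filter fun z => ‖z.toReal‖ < ρ

theorem mem_latticeBall {ρ : ℝ} {z : Site D} : z ∈ latticeBall D ρ ↔ ‖z.toReal‖ < ρ := by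
  rw [latticeBall, Finset.mem_filter, and_iff_right_iff_imp]
  intro hz
  rw [Fintype.mem_piFinset]
  intro k
  have h1 := abs_le.1 ((abs_coord_le_norm z k).trans hz.le)
  have h2 := Int.le_ceil ρ
  rw [Finset.mem_Icc]
  constructor
  · have : (-(⌈ρ⌉ : ℝ)) ≤ z k := by linarith
    exact_mod_cast this
  · have : (z k : ℝ) ≤ (⌈ρ⌉ : ℝ) := by linarith
    exact_mod_cast this

/-- The number of points of the ball that leave it under translation by `z`. -/
def exitCount (D : ℕ) (ρ : ℝ) (z : Site D) : ℕ :=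
  ((latticeBall D ρ).filter fun a => a + z ∉ latticeBall D ρ).card

theorem exitCount_le_card (ρ : ℝ) (z : Site D) : exitCount D ρ z ≤ (latticeBall D ρ).card :=
  Finset.card_filter_le _ _

theorem exitCount_zero (ρ : ℝ) : exitCount D ρ 0 = 0 := by
  rw [exitCount, Finset.card_eq_zero, Finset.filter_eq_empty_iff]
  intro a ha
  simpa using ha

/-- A point leaving under z + w either leaves under z, or moves by z inside the ball to a point that
leaves under w. -/
theorem exitCount_add_le (ρ : ℝ) (z w : Site D) :
    exitCount D ρ (z + w) ≤ exitCount D ρ z + exitCount D ρ w := by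
  classical
  have hsub : (latticeBall D ρ).filter (fun a => a + (z + w) ∉ latticeBall D ρ) ⊆
      (latticeBall D ρ).filter (fun a => a + z ∉ latticeBall D ρ) ∪
      ((latticeBall D ρ).filter (fun a => a + w ∉ latticeBall D ρ)).image (fun a => a - z) := by
    intro a ha
    rw [Finset.mem_filter] at ha
    rw [Finset.mem_union]
    by_cases h : a + z ∈ latticeBall D ρ
    · refine Or.inr (Finset.mem_image.2 ⟨a + z, Finset.mem_filter.2 ⟨h, ?_⟩, by simp⟩)
      rw [add_assoc]; exact ha.2
    · exact Or.inl (Finset.mem_filter.2 ⟨ha.1, h⟩)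
  calc exitCount D ρ (z + w) ≤ _ := Finset.card_le_card hsub
    _ ≤ _ := Finset.card_union_le _ _
    _ ≤ _ := Nat.add_le_add_left Finset.card_image_le _

theorem exitCount_sum_le {κ : Type*} (ρ : ℝ) (s : Finset κ) (z : κ → Site D) :
    exitCount D ρ (∑ k ∈ s, z k) ≤ ∑ k ∈ s, exitCount D ρ (z k) := by
  classical
  induction s using Finset.induction_on with
  | empty => simp [exitCount_zero]
  | insert k s hk ih =>
    rw [Finset.sum_insert hk, Finset.sum_insert hk]
    exact (exitCount_add_le ρ _ _).trans (Nat.add_le_add_left ih _)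

theorem exitCount_nsmul_le (ρ : ℝ) (n : ℕ) (z : Site D) :
    exitCount D ρ (n • z) ≤ n * exitCount D ρ z := by
  have := exitCount_sum_le ρ (Finset.range n) (fun _ => z)
  simpa using this

theorem norm_sq_eq_coord_add (z : Site D) (k : Fin D) :
    ‖z.toReal‖ ^ 2 = (z k : ℝ) ^ 2 + ∑ j ∈ Finset.univ.erase k, (z j : ℝ) ^ 2 := by
  rw [norm_toReal_sq, Finset.add_sum_erase _ (fun j => (z j : ℝ) ^ 2) (Finset.mem_univ k)]

/-- By convexity, each line parallel to the axis k has at most one exit point per direction.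
Dropping the coordinate k is thus injective on exit points, which gives a count of the size of the
surface. -/
theorem exitCount_unit_le {ρ : ℝ} (hρ : 0 ≤ ρ) (k : Fin D) {e : ℤ} (he : e = 1 ∨ e = -1) :
    (exitCount D ρ (Pi.single k e) : ℝ) ≤ (2 * ρ + 3) ^ (D - 1) := by
  classical
  set E := (latticeBall D ρ).filter fun a => a + Pi.single k e ∉ latticeBall D ρ with hE
  have hc0 : 0 ≤ ⌈ρ⌉ := Int.ceil_nonneg hρ
  set T := Fintype.piFinset fun _ : {j : Fin D // j ≠ k} => Finset.Icc (-⌈ρ⌉) ⌈ρ⌉ with hT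
  have hmaps : Set.MapsTo (fun (a : Site D) (j : {j : Fin D // j ≠ k}) => a j) E T := by
    intro a ha
    have ha' := (Finset.mem_filter.1 (Finset.mem_coe.1 ha)).1
    rw [latticeBall, Finset.mem_filter, Fintype.mem_piFinset] at ha'
    rw [Finset.mem_coe, hT, Fintype.mem_piFinset]
    exact fun j => ha'.1 j
  -- If a lies behind b on a common line, one step from a does not pass b, so its squared coordinate
  -- is at most the larger of the two and the step stays in the ball.
  have key : ∀ a ∈ E, ∀ b ∈ E, (∀ j, j ≠ k → a j = b j) → ¬ (e * a k < e * b k) := by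
    intro a ha b hb hab hlt
    rw [hE, Finset.mem_filter, mem_latticeBall, mem_latticeBall] at ha hb
    apply ha.2
    have h1 : ‖(a + Pi.single k e : Site D).toReal‖ ^ 2 ≤ max (‖a.toReal‖ ^ 2) (‖b.toReal‖ ^ 2) := by
      rw [norm_sq_eq_coord_add _ k, norm_sq_eq_coord_add a k, norm_sq_eq_coord_add b k]
      have e1 : ∑ j ∈ Finset.univ.erase k, (((a + Pi.single k e : Site D) j : ℤ) : ℝ) ^ 2 =
          ∑ j ∈ Finset.univ.erase k, (a j : ℝ) ^ 2 :=
        Finset.sum_congr rfl fun j hj => by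
          simp [Finset.ne_of_mem_erase hj]
      have e2 : ∑ j ∈ Finset.univ.erase k, (b j : ℝ) ^ 2 =
          ∑ j ∈ Finset.univ.erase k, (a j : ℝ) ^ 2 :=
        Finset.sum_congr rfl fun j hj => by rw [hab j (Finset.ne_of_mem_erase hj)]
      rw [e1, e2, max_add_add_right]
      gcongr
      have h2 : (a k + e) ^ 2 ≤ max ((a k) ^ 2) ((b k) ^ 2) := by
        rcases he with rfl | rfl
        · rcases le_total 0 (a k) with h | h
          · exact le_max_of_le_right (by nlinarith)
          · rcases lt_or_eq_of_le h with h | h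
            · exact le_max_of_le_left (by nlinarith)
            · exact le_max_of_le_right (by rw [h] at hlt ⊢; nlinarith)
        · rcases le_total (a k) 0 with h | h
          · exact le_max_of_le_right (by nlinarith)
          · rcases lt_or_eq_of_le h with h | h
            · exact le_max_of_le_left (by nlinarith)
            · exact le_max_of_le_right (by rw [← h] at hlt ⊢; nlinarith)
      simp only [Pi.add_apply, Pi.single_eq_same]
      exact_mod_cast h2
    have h3 : max (‖a.toReal‖ ^ 2) (‖b.toReal‖ ^ 2) < ρ ^ 2 :=
      max_lt (pow_lt_pow_left₀ ha.1 (norm_nonneg _) two_ne_zero)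
        (pow_lt_pow_left₀ hb.1 (norm_nonneg _) two_ne_zero)
    exact lt_of_pow_lt_pow_left₀ 2 hρ (h1.trans_lt h3)
  have hinj : Set.InjOn (fun (a : Site D) (j : {j : Fin D // j ≠ k}) => a j) E := by
    intro a ha b hb hab
    have hab' : ∀ j, j ≠ k → a j = b j := fun j hj => congrFun hab ⟨j, hj⟩
    have h1 := key a ha b hb hab'
    have h2 := key b hb a ha fun j hj => (hab' j hj).symm
    ext j
    by_cases hj : j = k
    · subst hj
      rcases he with rfl | rfl <;> omega
    · exact hab' j hj
  have hcard := Finset.card_le_card_of_injOn _ hmaps hinj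
  rw [hT, Fintype.card_piFinset, Finset.prod_const, Finset.card_univ, Int.card_Icc,
    Fintype.card_subtype_compl, Fintype.card_fin, Fintype.card_subtype_eq] at hcard
  have h4 : (((⌈ρ⌉ + 1 - -⌈ρ⌉).toNat : ℕ) : ℝ) ≤ 2 * ρ + 3 := by
    have : (((⌈ρ⌉ + 1 - -⌈ρ⌉).toNat : ℤ) : ℝ) = ((⌈ρ⌉ + 1 - -⌈ρ⌉ : ℤ) : ℝ) := by
      rw [Int.toNat_of_nonneg (by linarith)]
    have h5 := Int.ceil_lt_add_one ρ
    push_cast at this ⊢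
    linarith
  calc (exitCount D ρ (Pi.single k e) : ℝ) ≤ (((⌈ρ⌉ + 1 - -⌈ρ⌉).toNat ^ (D - 1) : ℕ) : ℝ) := by
        exact_mod_cast hcard
    _ ≤ _ := by push_cast; gcongr

/-- The displacement is a sum of unit steps along the axes, at most D|z| of them, and the count is
subadditive. -/
theorem exitCount_le {ρ : ℝ} (hρ : 0 ≤ ρ) (z : Site D) :
    (exitCount D ρ z : ℝ) ≤ D * ‖z.toReal‖ * (2 * ρ + 3) ^ (D - 1) := by
  have hk : ∀ k, (exitCount D ρ (Pi.single k (z k)) : ℝ) ≤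
      |(z k : ℝ)| * (2 * ρ + 3) ^ (D - 1) := by
    intro k
    obtain ⟨e, he, hz⟩ : ∃ e : ℤ, (e = 1 ∨ e = -1) ∧ z k = (z k).natAbs * e := by
      rcases le_total 0 (z k) with h | h
      · exact ⟨1, Or.inl rfl, by omega⟩
      · exact ⟨-1, Or.inr rfl, by omega⟩
    have h1 : (Pi.single k (z k) : Site D) = (z k).natAbs • (Pi.single k e : Site D) := by
      rw [← Pi.single_smul, nsmul_eq_mul]
      congr 1
    rw [h1]
    have h2 : (exitCount D ρ ((z k).natAbs • (Pi.single k e : Site D)) : ℝ) ≤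
        ((z k).natAbs * exitCount D ρ (Pi.single k e) : ℕ) :=
      Nat.cast_le.2 (exitCount_nsmul_le ρ _ _)
    refine h2.trans ?_
    push_cast
    rw [Nat.cast_natAbs, Int.cast_abs]
    exact mul_le_mul_of_nonneg_left (exitCount_unit_le hρ k he) (abs_nonneg _)
  have h0 : exitCount D ρ z ≤ ∑ k, exitCount D ρ (Pi.single k (z k)) := by
    have := exitCount_sum_le ρ Finset.univ (fun k => (Pi.single k (z k) : Site D))
    rwa [Finset.univ_sum_single] at this
  calc (exitCount D ρ z : ℝ) ≤ ∑ k, (exitCount D ρ (Pi.single k (z k)) : ℝ) := by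
        exact_mod_cast h0
    _ ≤ ∑ k, |(z k : ℝ)| * (2 * ρ + 3) ^ (D - 1) := Finset.sum_le_sum fun k _ => hk k
    _ = (∑ k, |(z k : ℝ)|) * (2 * ρ + 3) ^ (D - 1) := by rw [Finset.sum_mul]
    _ ≤ _ := by gcongr; exact sum_abs_coord_le z

/-- Sums over pairs of sites inside a ball and outside a larger concentric ball. -/
theorem exists_pair_sum_bound (D : ℕ) {η : ℝ} (hη : 0 < η) : ∃ C : ℝ, 0 < C ∧
    ∀ (l ρ K : ℝ) (f : ℝ → ℝ) (x : Site D) (s t : Finset (Site D)), 1 ≤ l →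
      (∀ a ∈ s, siteDist a x < ρ) → (∀ b ∈ t, ρ + l ≤ siteDist b x) →
      (∀ r, 0 ≤ f r) → 0 ≤ K →
      (∀ z : Site D, l ≤ ‖z.toReal‖ →
        f ‖z.toReal‖ * exitCount D ρ z ≤ K * ‖z.toReal‖ ^ (-((D : ℝ) + η))) →
      ∑ a ∈ s, ∑ b ∈ t, f (siteDist a b) ≤ K * (C * l ^ (-η)) := by
  classical
  obtain ⟨C, hC0, hC⟩ := exists_tail_bound D hη
  refine ⟨C, hC0, fun l ρ K f x s t hl hs ht hf hK hfz => ?_⟩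
  rw [← Finset.sum_product']
  -- Pairs are grouped by displacement z = b - a; the gap between the balls forces |z| ≥ l.
  set Z := (s ×ˢ t).image fun ab => ab.2 - ab.1 with hZ
  rw [← Finset.sum_fiberwise_of_maps_to (t := Z) (g := fun ab : Site D × Site D => ab.2 - ab.1)
    (fun ab hab => Finset.mem_image_of_mem _ hab)]
  have hZl : ∀ z ∈ Z, l ≤ ‖z.toReal‖ := by
    intro z hz
    obtain ⟨⟨a, b⟩, hab, rfl⟩ := Finset.mem_image.1 hz
    rw [Finset.mem_product] at hab
    have h1 := hs a hab.1
    have h2 := ht b hab.2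
    have h3 := siteDist_triangle b a x
    rw [siteDist_eq_norm b a] at h3
    simp only
    linarith
  have hfib : ∀ z ∈ Z, ∑ ab ∈ (s ×ˢ t).filter (fun ab => ab.2 - ab.1 = z),
      f (siteDist ab.1 ab.2) ≤ K * ‖z.toReal‖ ^ (-((D : ℝ) + η)) := by
    intro z hz
    refine le_trans ?_ (hfz z (hZl z hz))
    have h1 : ∀ ab ∈ (s ×ˢ t).filter (fun ab => ab.2 - ab.1 = z),
        f (siteDist ab.1 ab.2) = f ‖z.toReal‖ := by
      intro ab hab
      rw [Finset.mem_filter] at hab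
      rw [siteDist_comm, siteDist_eq_norm, hab.2]
    rw [Finset.sum_congr rfl h1, Finset.sum_const, nsmul_eq_mul, mul_comm]
    refine mul_le_mul_of_nonneg_left (Nat.cast_le.2 ?_) (hf _)
    -- For a given z the pair is determined by a, and a - x leaves the centred ball under z.
    refine Finset.card_le_card_of_injOn (fun ab => ab.1 - x) ?_ ?_
    · intro ab hab
      rw [Finset.mem_coe, Finset.mem_filter, Finset.mem_product] at hab
      rw [Finset.mem_coe, Finset.mem_filter, mem_latticeBall, mem_latticeBall, ← siteDist_eq_norm]
      refine ⟨hs _ hab.1.1, ?_⟩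
      have e : ab.1 - x + z = ab.2 - x := by rw [← hab.2]; abel
      rw [e, ← siteDist_eq_norm]
      have := ht _ hab.1.2
      linarith
    · intro ab hab cd hcd h
      rw [Finset.mem_coe, Finset.mem_filter] at hab hcd
      have h1 : ab.1 = cd.1 := sub_left_injective h
      refine Prod.ext h1 ?_
      have h2 : ab.2 = z + ab.1 := by rw [← hab.2]; abel
      have h3 : cd.2 = z + cd.1 := by rw [← hcd.2]; abel
      rw [h2, h3, h1]
  refine (Finset.sum_le_sum hfib).trans ?_
  rw [← Finset.mul_sum]
  exact mul_le_mul_of_nonneg_left (hC l hl Z hZl) hK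

end BoundarySums

/-! ### Admissible weights for the Grönwall argument -/

section Weights

variable {D : ℕ}

theorem kernel_le_rpow {p β s : ℝ} (hβ : 0 ≤ β) (hs : 0 ≤ s) : kernel p β s ≤ (1 + s) ^ (-p) :=
  mul_le_of_le_one_right (Real.rpow_nonneg (by linarith) _) (decay_le_one hβ hs)

/-- Sums of the kernel against a set of sites grow at most at a rate independent of the exponent. -/
theorem exists_weight_bound (D : ℕ) : ∃ v : ℝ, 0 < v ∧
    ∀ (p α : ℝ), (D : ℝ) + 1 ≤ p → p ≤ D + 2 → p ≤ α → ∀ (L : Finset (Site D)) (A : Finset L)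
      (i : L), ∑ j ∈ Finset.univ.erase i, 8 * (1 / siteDist (i : Site D) j ^ α) *
        (∑ a ∈ A, kernel p (α - p) (siteDist (i : Site D) a) +
          ∑ a ∈ A, kernel p (α - p) (siteDist (j : Site D) a)) ≤
        v * ∑ a ∈ A, kernel p (α - p) (siteDist (i : Site D) a) := by
  obtain ⟨C, hC1, hC⟩ := exists_sum_bound D
  have hC0 : 0 < C := by linarith
  -- The range D+1 ≤ p ≤ D+2 allows every p-dependent constant to be replaced by one depending on D
  -- only.
  set k : ℝ := 2 ^ ((D : ℝ) + 2) * Real.exp 4 with hk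
  have hk0 : 0 < k := by positivity
  have h20 : (0 : ℝ) < 2 ^ ((D : ℝ) + 2) := Real.rpow_pos_of_pos two_pos _
  have hv0 : 0 < 8 * k * (C + 2 ^ ((D : ℝ) + 2) * (2 * C)) :=
    mul_pos (mul_pos (by norm_num) hk0) (add_pos hC0 (mul_pos h20 (by linarith)))
  refine ⟨8 * k * (C + 2 ^ ((D : ℝ) + 2) * (2 * C)), hv0,
    fun p α hp1 hp2 hpα L A i => ?_⟩
  have hD : (0 : ℝ) ≤ D := Nat.cast_nonneg D
  have hp0 : 0 ≤ p := by linarith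
  have hβ : 0 ≤ α - p := by linarith
  have h2p : (2 : ℝ) ^ p ≤ 2 ^ ((D : ℝ) + 2) := Real.rpow_le_rpow_of_exponent_le one_le_two hp2
  set F : L → L → ℝ := fun i j => kernel p (α - p) (siteDist (i : Site D) j) with hF
  have hF0 : ∀ i j, 0 ≤ F i j := fun i j => (kernel_pos (siteDist_nonneg _ _)).le
  set w : L → ℝ := fun i => ∑ a ∈ A, F i a with hw
  have hw0 : ∀ i, 0 ≤ w i := fun i => Finset.sum_nonneg fun a _ => hF0 i a
  have hsum : ∀ x : L, ∑ j : L, (1 + siteDist (x : Site D) (j : Site D)) ^ (-p) ≤ C := fun x => by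
    have := hC p hp1 L x
    rwa [← Finset.sum_coe_sort L (fun y => (1 + siteDist (x : Site D) y) ^ (-p))] at this
  have hJ : ∀ j ∈ Finset.univ.erase i,
      1 / siteDist (i : Site D) j ^ α ≤ k * F i j := by
    intro j hj
    have hne := (Finset.ne_of_mem_erase hj).symm
    have h1 : 1 ≤ siteDist (i : Site D) j := one_le_siteDist fun h => hne (Subtype.ext h)
    have h2 := rpow_neg_le_kernel hp0 hβ h1
    rw [add_sub_cancel, Real.rpow_neg (siteDist_nonneg _ _), inv_eq_one_div] at h2
    refine h2.trans (mul_le_mul_of_nonneg_right ?_ (hF0 i j))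
    exact mul_le_mul_of_nonneg_right h2p (Real.exp_pos _).le
  have hS1 : ∑ j, F i j ≤ C :=
    (Finset.sum_le_sum fun j _ => kernel_le_rpow hβ (siteDist_nonneg _ _)).trans (hsum i)
  -- The reproducing property, applied to each a in A separately.
  have hS2 : ∑ j, F i j * w j ≤ 2 ^ ((D : ℝ) + 2) * (2 * C) * w i := by
    simp only [hw, Finset.mul_sum]
    rw [Finset.sum_comm]
    refine Finset.sum_le_sum fun a _ => ?_
    calc ∑ j, F i j * F j a ≤ ∑ j : L, 2 ^ p * ((1 + siteDist (i : Site D) j) ^ (-p) +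
          (1 + siteDist (a : Site D) j) ^ (-p)) * F i a := by
          refine Finset.sum_le_sum fun j _ => ?_
          rw [siteDist_comm (a : Site D) j]
          exact kernel_mul_le hp0 hβ (siteDist_nonneg _ _) (siteDist_nonneg _ _)
            (siteDist_nonneg _ _) (siteDist_triangle _ _ _)
      _ = 2 ^ p * (∑ j : L, (1 + siteDist (i : Site D) j) ^ (-p) +
          ∑ j : L, (1 + siteDist (a : Site D) j) ^ (-p)) * F i a := by
          rw [← Finset.sum_add_distrib, Finset.mul_sum, Finset.sum_mul]
      _ ≤ 2 ^ ((D : ℝ) + 2) * (2 * C) * F i a := by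
          refine mul_le_mul_of_nonneg_right ?_ (hF0 i a)
          refine mul_le_mul h2p (by linarith [hsum i, hsum a]) ?_ h20.le
          exact add_nonneg (Finset.sum_nonneg fun j _ => Real.rpow_nonneg
            (by linarith [siteDist_nonneg (i : Site D) j]) _)
            (Finset.sum_nonneg fun j _ => Real.rpow_nonneg
            (by linarith [siteDist_nonneg (a : Site D) j]) _)
  calc _ ≤ ∑ j ∈ Finset.univ.erase i, 8 * (k * F i j) * (w i + w j) := by
        refine Finset.sum_le_sum fun j hj => ?_
        have := hJ j hj
        refine mul_le_mul_of_nonneg_right ?_ (add_nonneg (hw0 i) (hw0 j))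
        linarith
    _ ≤ ∑ j, 8 * (k * F i j) * (w i + w j) := by
        refine Finset.sum_le_sum_of_subset_of_nonneg (Finset.erase_subset _ _) fun j _ _ => ?_
        exact mul_nonneg (mul_nonneg (by norm_num) (mul_nonneg hk0.le (hF0 i j)))
          (add_nonneg (hw0 i) (hw0 j))
    _ = 8 * k * ((∑ j, F i j) * w i + ∑ j, F i j * w j) := by
        rw [Finset.sum_mul, ← Finset.sum_add_distrib, Finset.mul_sum]
        exact Finset.sum_congr rfl fun j _ => by ring
    _ ≤ 8 * k * (C * w i + 2 ^ ((D : ℝ) + 2) * (2 * C) * w i) := by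
        exact mul_le_mul_of_nonneg_left
          (add_le_add (mul_le_mul_of_nonneg_right hS1 (hw0 i)) hS2) (by linarith)
    _ = _ := by ring

end Weights

/-! ### Unitary and Heisenberg evolution -/

namespace PowerLawSystem

variable {D : ℕ} {α : ℝ} {S : PowerLawSystem D α} {U : ℝ → Op S.q}

theorem hamiltonian_isHermitian (S : PowerLawSystem D α) (t : ℝ) : (S.hamiltonian t).IsHermitian :=
  isSelfAdjoint_sum _ fun i _ => isSelfAdjoint_sum _ fun j _ => S.hermitian_h i j t

theorem hasDerivAt_conjTranspose (hU : S.IsEvolution U) (t : ℝ) :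
    HasDerivAt (fun t => (U t)ᴴ) (Complex.I • ((U t)ᴴ * S.hamiltonian t)) t := by
  have h := (hU.2 t).star
  have e : star ((-Complex.I) • (S.hamiltonian t * U t)) =
      Complex.I • ((U t)ᴴ * S.hamiltonian t) := by
    rw [Matrix.star_eq_conjTranspose, Matrix.conjTranspose_smul, Matrix.conjTranspose_mul,
      (S.hamiltonian_isHermitian t).eq]
    simp
  rw [e] at h
  exact h

theorem conjTranspose_mul_self (hU : S.IsEvolution U) (t : ℝ) : (U t)ᴴ * U t = 1 := by
  have hd : ∀ t, HasDerivAt (fun t => (U t)ᴴ * U t) 0 t := fun t => by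
    have h := (hasDerivAt_conjTranspose hU t).mul (hU.2 t)
    have e : Complex.I • ((U t)ᴴ * S.hamiltonian t) * U t +
        (U t)ᴴ * ((-Complex.I) • (S.hamiltonian t * U t)) = 0 := by
      rw [Matrix.smul_mul, Matrix.mul_smul, neg_smul, Matrix.mul_assoc, add_neg_cancel]
    rw [e] at h
    exact h
  have h := is_const_of_deriv_eq_zero (fun t => (hd t).differentiableAt) (fun t => (hd t).deriv) t 0
  rw [hU.1] at h
  simpa using h

theorem mul_conjTranspose_self (hU : S.IsEvolution U) (t : ℝ) : U t * (U t)ᴴ = 1 :=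
  mul_eq_one_comm.1 (conjTranspose_mul_self hU t)

theorem norm_evolution_le (hU : S.IsEvolution U) (t : ℝ) : ‖U t‖ ≤ 1 :=
  norm_le_one_of_isometry (conjTranspose_mul_self hU t)

theorem norm_evolution_conjTranspose_le (hU : S.IsEvolution U) (t : ℝ) : ‖(U t)ᴴ‖ ≤ 1 :=
  (Matrix.l2_opNorm_conjTranspose _).le.trans (norm_evolution_le hU t)

end PowerLawSystem

/-- The operator `A` evolved in the Heisenberg picture from time `t` back to time `s`. -/
def heisenberg {D : ℕ} {α : ℝ} {S : PowerLawSystem D α} (U : ℝ → Op S.q) (s t : ℝ) (A : Op S.q) :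
    Op S.q := U s * ((U t)ᴴ * A * U t) * (U s)ᴴ

namespace PowerLawSystem

variable {D : ℕ} {α : ℝ} {S : PowerLawSystem D α} {U : ℝ → Op S.q}

theorem heisenberg_self (hU : S.IsEvolution U) (t : ℝ) (A : Op S.q) : heisenberg U t t A = A := by
  rw [heisenberg, ← Matrix.mul_assoc, ← Matrix.mul_assoc, mul_conjTranspose_self hU,
    Matrix.one_mul, Matrix.mul_assoc, mul_conjTranspose_self hU, Matrix.mul_one]

theorem heisenberg_trans (hU : S.IsEvolution U) (r s t : ℝ) (A : Op S.q) :
    heisenberg U r s (heisenberg U s t A) = heisenberg U r t A := by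
  have e : (U s)ᴴ * (U s * ((U t)ᴴ * A * U t) * (U s)ᴴ) * U s = (U t)ᴴ * A * U t := by
    calc _ = ((U s)ᴴ * U s) * ((U t)ᴴ * A * U t) * ((U s)ᴴ * U s) := by
          simp only [Matrix.mul_assoc]
      _ = _ := by rw [conjTranspose_mul_self hU, Matrix.one_mul, Matrix.mul_one]
  rw [heisenberg, heisenberg, e, heisenberg]

theorem heisenberg_zero (hU : S.IsEvolution U) (t : ℝ) (A : Op S.q) :
    heisenberg U 0 t A = (U t)ᴴ * A * U t := by
  simp [heisenberg, hU.1]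

theorem heisenberg_sub (s t : ℝ) (A B : Op S.q) :
    heisenberg U s t (A - B) = heisenberg U s t A - heisenberg U s t B := by
  simp only [heisenberg, Matrix.mul_sub, Matrix.sub_mul]

theorem norm_heisenberg_le (hU : S.IsEvolution U) (s t : ℝ) (A : Op S.q) :
    ‖heisenberg U s t A‖ ≤ ‖A‖ :=
  (norm_conj_le (norm_evolution_le hU s) (norm_evolution_conjTranspose_le hU s) _).trans
    (norm_conj_le (norm_evolution_conjTranspose_le hU t) (norm_evolution_le hU t) A)

/-- Moving the earlier time backwards from t gives an initial value problem that starts at A when u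
= 0 and has the sign used in the defect estimates. -/
theorem hasDerivAt_heisenberg (hU : S.IsEvolution U) (t u : ℝ) (A : Op S.q) :
    HasDerivAt (fun u => heisenberg U (t - u) t A)
      (Complex.I • (S.hamiltonian (t - u) * heisenberg U (t - u) t A -
        heisenberg U (t - u) t A * S.hamiltonian (t - u))) u := by
  have hs : ∀ s, HasDerivAt (fun s => heisenberg U s t A)
      ((-Complex.I) • (S.hamiltonian s * heisenberg U s t A -
        heisenberg U s t A * S.hamiltonian s)) s := fun s => by
    have h := ((hU.2 s).mul_const ((U t)ᴴ * A * U t)).mul (hasDerivAt_conjTranspose hU s)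
    refine h.congr_deriv ?_
    simp only [heisenberg, Matrix.smul_mul, Matrix.mul_smul, smul_sub, neg_smul, neg_mul,
      Matrix.mul_assoc]
    abel
  have h := (hs (t - u)).scomp u ((hasDerivAt_id u).const_sub t)
  refine h.congr_deriv ?_
  rw [neg_smul, neg_smul, smul_neg, neg_neg, one_smul]

end PowerLawSystem

/-! ### Truncating Heisenberg operators to balls -/

/-- Lieb-Robinson bound: a Heisenberg operator is approximated by one acting trivially on a given
set of sites, with an error governed by the kernel. -/
theorem exists_truncation_bound (D : ℕ) : ∃ v : ℝ, 0 < v ∧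
    ∀ (p α : ℝ), (D : ℝ) + 1 ≤ p → p ≤ D + 2 → p ≤ α → ∀ (S : PowerLawSystem D α) (U : ℝ → Op S.q),
      S.IsEvolution U → ∀ (s t : ℝ), s ≤ t → ∀ (A B : Finset S.Λ), A.Nonempty → Disjoint A B →
      ∀ O : Op S.q, (∀ i, i ∉ A → siteAverage i O = O) →
      ∃ O' : Op S.q, (∀ i ∈ B, siteAverage i O' = O') ∧ ‖O'‖ ≤ ‖O‖ ∧
        ‖heisenberg U s t O - O'‖ ≤ 2 * ‖O‖ * (Real.exp (v * (t - s)) - 1) *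
          ∑ a ∈ A, ∑ b ∈ B, kernel p (α - p) (siteDist (a : Site D) b) := by
  obtain ⟨v, hv0, hv⟩ := exists_weight_bound D
  refine ⟨v, hv0, fun p α hp1 hp2 hpα S U hU s t hst A B hA hAB O hO => ?_⟩
  set w : S.Λ → ℝ := fun i => ∑ a ∈ A, kernel p (α - p) (siteDist (i : Site D) a) with hw
  have hF0 : ∀ i a : S.Λ, 0 < kernel p (α - p) (siteDist (i : Site D) a) := fun i a =>
    kernel_pos (siteDist_nonneg _ _)
  have hw0 : ∀ i, 0 < w i := fun i => Finset.sum_pos (fun a _ => hF0 i a) hA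
  set J : S.Λ → S.Λ → ℝ := fun i j => 1 / siteDist (i : Site D) j ^ α with hJ
  have hN : 0 ≤ 2 * ‖O‖ := mul_nonneg zero_le_two (norm_nonneg _)
  -- On A the defect is at most 2‖O‖ and the weight at least kernel(0) = 1; off A the defect
  -- vanishes.
  have h0 : ∀ i, siteDefect i (heisenberg U (t - 0) t O) ≤ 2 * ‖O‖ * w i := by
    intro i
    rw [sub_zero, PowerLawSystem.heisenberg_self hU]
    by_cases hi : i ∈ A
    · refine (norm_sub_siteAverage_le i O).trans (le_mul_of_one_le_right hN ?_)
      have h1 := Finset.single_le_sum (f := fun a : S.Λ =>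
        kernel p (α - p) (siteDist (i : Site D) a)) (fun a _ => (hF0 i a).le) hi
      simpa [siteDist_self, kernel_zero] using h1
    · rw [siteDefect, hO i hi, sub_self, norm_zero]
      exact mul_nonneg hN (hw0 i).le
  obtain ⟨O', h1, h2, h3⟩ := exists_fixed_approx B (heisenberg U s t O)
  refine ⟨O', fun i hi => h1 i (Or.inl hi), h2.trans (PowerLawSystem.norm_heisenberg_le hU s t O),
    h3.trans ?_⟩
  rw [Finset.sum_comm, Finset.mul_sum]
  refine Finset.sum_le_sum fun b hb => ?_
  have hbA : b ∉ A := fun h => (Finset.disjoint_left.1 hAB h) hb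
  have key := siteDefect_le_exp_sub_one (h := fun i j u => S.h i j (t - u)) (J := J)
    (O := fun u => heisenberg U (t - u) t O) (w := w) (v := v) (N := 2 * ‖O‖)
    (fun i j k u hki hkj => siteAverage_of_supportedOn (S.supported_h i j (t - u))
      (by simp [hki, hkj]))
    (fun i j u => S.hermitian_h i j (t - u))
    (fun i j u hij => S.norm_h_le i j (t - u) hij)
    (fun i j => by rw [hJ]; simp only [siteDist_comm (i : Site D)])
    (fun i j => div_nonneg zero_le_one (Real.rpow_nonneg (siteDist_nonneg _ _) _))
    (fun u => PowerLawSystem.hasDerivAt_heisenberg hU t u O) hw0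
    (fun i => hv p α hp1 hp2 hpα S.Λ A i) hv0.le hN h0 (u := t - s)
    (sub_nonneg.2 hst) (i := b) (by
      simp only [sub_zero]
      rw [PowerLawSystem.heisenberg_self hU, siteDefect, hO b hbA, sub_self, norm_zero])
  rw [sub_sub_cancel] at key
  refine key.trans (le_of_eq ?_)
  rw [hw]
  congr 1
  exact Finset.sum_congr rfl fun a _ => by rw [siteDist_comm]

/-- A Lieb-Robinson velocity for all interactions with exponent at least `D + 1`. -/
def velocity (D : ℕ) : ℝ := (exists_truncation_bound D).choose

theorem velocity_pos (D : ℕ) : 0 < velocity D := (exists_truncation_bound D).choose_spec.1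

/-- `A` acts trivially on all sites at distance at least `ρ` from `x`. -/
def ActsInBall {D : ℕ} {α : ℝ} {S : PowerLawSystem D α} (x : Site D) (ρ : ℝ) (A : Op S.q) : Prop :=
  ∀ i : S.Λ, ρ ≤ siteDist (i : Site D) x → siteAverage i A = A

theorem ActsInBall.mono {D : ℕ} {α : ℝ} {S : PowerLawSystem D α} {x : Site D} {ρ ρ' : ℝ}
    {A : Op S.q} (h : ActsInBall x ρ A) (hρ : ρ ≤ ρ') : ActsInBall x ρ' A :=
  fun i hi => h i (hρ.trans hi)

theorem ActsInBall.add {D : ℕ} {α : ℝ} {S : PowerLawSystem D α} {x : Site D} {ρ : ℝ}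
    {A B : Op S.q} (hA : ActsInBall x ρ A) (hB : ActsInBall x ρ B) : ActsInBall x ρ (A + B) :=
  fun i hi => by rw [map_add, hA i hi, hB i hi]

theorem ActsInBall.sub {D : ℕ} {α : ℝ} {S : PowerLawSystem D α} {x : Site D} {ρ : ℝ}
    {A B : Op S.q} (hA : ActsInBall x ρ A) (hB : ActsInBall x ρ B) : ActsInBall x ρ (A - B) :=
  fun i hi => by rw [map_sub, hA i hi, hB i hi]

/-- Truncation of a Heisenberg operator to a larger ball. -/
theorem exists_ball_truncation (D : ℕ) {η : ℝ} (hη : 0 < η) : ∃ C : ℝ, 0 < C ∧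
    ∀ (p α l ρ K : ℝ), (D : ℝ) + 1 ≤ p → p ≤ D + 2 → p ≤ α → 1 ≤ l → 0 < ρ → 0 ≤ K →
      (∀ z : Site D, l ≤ ‖z.toReal‖ →
        (1 + ‖z.toReal‖) ^ (-p) * exitCount D ρ z ≤ K * ‖z.toReal‖ ^ (-((D : ℝ) + η))) →
      ∀ (S : PowerLawSystem D α) (U : ℝ → Op S.q), S.IsEvolution U → ∀ (s t : ℝ), s ≤ t →
      ∀ x : S.Λ, ∀ O : Op S.q, ActsInBall (x : Site D) ρ O →
      ∃ O' : Op S.q, ActsInBall (x : Site D) (ρ + l) O' ∧ ‖O'‖ ≤ ‖O‖ ∧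
        ‖heisenberg U s t O - O'‖ ≤ C * K * (l ^ (-η) * decay (α - p) l) *
          (Real.exp (velocity D * (t - s)) - 1) * ‖O‖ := by
  obtain ⟨C, hC0, hC⟩ := exists_pair_sum_bound D hη
  refine ⟨2 * C, by linarith, fun p α l ρ K hp1 hp2 hpα hl hρ hK hz S U hU s t hst x O hO => ?_⟩
  classical
  set A : Finset S.Λ := Finset.univ.filter fun i => siteDist (i : Site D) x < ρ with hA
  set B : Finset S.Λ := Finset.univ.filter fun i => ρ + l ≤ siteDist (i : Site D) x with hB
  have hAB : ∀ a ∈ A, ∀ b ∈ B, l ≤ siteDist (a : Site D) b := by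
    intro a ha b hb
    have h1 := (Finset.mem_filter.1 ha).2
    have h2 := (Finset.mem_filter.1 hb).2
    have h3 := siteDist_triangle (b : Site D) a x
    rw [siteDist_comm (b : Site D) a] at h3
    linarith
  have hdisj : Disjoint A B := by
    refine Finset.disjoint_left.2 fun a ha hb => ?_
    have := hAB a ha a hb
    rw [siteDist_self] at this
    linarith
  obtain ⟨O', h1, h2, h3⟩ := (exists_truncation_bound D).choose_spec.2 p α hp1 hp2 hpα S U hU s t hst
    A B ⟨x, by simpa [hA, siteDist_self] using hρ⟩ hdisj O (fun i hi => hO i (by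
      by_contra hcon
      exact hi (Finset.mem_filter.2 ⟨Finset.mem_univ _, not_le.1 hcon⟩)))
  refine ⟨O', fun i hi => h1 i (Finset.mem_filter.2 ⟨Finset.mem_univ _, hi⟩), h2, h3.trans ?_⟩
  have hβ : 0 ≤ α - p := by linarith
  have hsum : ∑ a ∈ A, ∑ b ∈ B, kernel p (α - p) (siteDist (a : Site D) b) ≤
      decay (α - p) l * (K * (C * l ^ (-η))) := by
    calc _ ≤ ∑ a ∈ A, ∑ b ∈ B,
          decay (α - p) l * (1 + siteDist (a : Site D) b) ^ (-p) := by
          refine Finset.sum_le_sum fun a ha => Finset.sum_le_sum fun b hb => ?_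
          rw [kernel, mul_comm]
          refine mul_le_mul_of_nonneg_right (decay_antitone hβ (by linarith) (hAB a ha b hb)) ?_
          exact Real.rpow_nonneg (by linarith [siteDist_nonneg (a : Site D) b]) _
      _ = decay (α - p) l * ∑ a ∈ A, ∑ b ∈ B, (1 + siteDist (a : Site D) b) ^ (-p) := by
          simp only [Finset.mul_sum]
      _ ≤ _ := by
          refine mul_le_mul_of_nonneg_left ?_ (decay_pos _ _).le
          -- The absolute value only secures nonnegativity at negative arguments; distances never
          -- reach them.
          have h4 := hC l ρ K (fun r => |1 + r| ^ (-p)) (x : Site D)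
            (A.map (Function.Embedding.subtype _)) (B.map (Function.Embedding.subtype _)) hl
            (by
              intro a ha
              obtain ⟨a', ha', rfl⟩ := Finset.mem_map.1 ha
              exact (Finset.mem_filter.1 ha').2)
            (by
              intro b hb
              obtain ⟨b', hb', rfl⟩ := Finset.mem_map.1 hb
              exact (Finset.mem_filter.1 hb').2)
            (fun r => Real.rpow_nonneg (abs_nonneg _) _) hK
            (fun z hzl => by
              have := hz z hzl
              rwa [← abs_of_nonneg (a := 1 + ‖z.toReal‖) (by positivity)] at this)
          rw [Finset.sum_map] at h4
          simp only [Finset.sum_map, Function.Embedding.coe_subtype] at h4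
          refine le_trans (le_of_eq ?_) h4
          refine Finset.sum_congr rfl fun a _ => Finset.sum_congr rfl fun b _ => ?_
          rw [abs_of_nonneg (by linarith [siteDist_nonneg (a : Site D) b])]
  have hexp : 0 ≤ Real.exp (velocity D * (t - s)) - 1 :=
    sub_nonneg.2 (Real.one_le_exp (mul_nonneg (velocity_pos D).le (sub_nonneg.2 hst)))
  calc _ ≤ 2 * ‖O‖ * (Real.exp (velocity D * (t - s)) - 1) *
        (decay (α - p) l * (K * (C * l ^ (-η)))) :=
        mul_le_mul_of_nonneg_left hsum (mul_nonneg (mul_nonneg zero_le_two (norm_nonneg _)) hexp)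
    _ = _ := by ring

theorem rpow_neg_mul_decay_le {β η l : ℝ} (hβ : 0 ≤ β) (hη : 0 ≤ η) (hl : 1 ≤ l) :
    l ^ (-η) * decay β l ≤ Real.exp (-4 * l) + l ^ (-(β + η)) := by
  have hl0 : 0 < l := by linarith
  have h1 : l ^ (-η) ≤ 1 := Real.rpow_le_one_of_one_le_of_nonpos hl (by linarith)
  have h2 : 0 ≤ l ^ (-η) := Real.rpow_nonneg hl0.le _
  have h3 := mul_le_mul_of_nonneg_left (decay_le_add hβ hl0) h2
  have h4 : l ^ (-η) * l ^ (-β) = l ^ (-(β + η)) := by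
    rw [← Real.rpow_add hl0]; congr 1; ring
  rw [mul_add, h4] at h3
  have h5 := mul_le_mul_of_nonneg_right h1 (Real.exp_pos (-4 * l)).le
  linarith

/-- Area-law truncation error in a ball. -/
theorem exists_ball_truncation_area (D : ℕ) {η : ℝ} (hη : 0 < η) (hη1 : η ≤ 1) : ∃ C : ℝ, 0 < C ∧
    ∀ (α l ρ P : ℝ), (D : ℝ) + 1 + η ≤ α → 1 ≤ l → 0 < ρ → ρ ≤ P → 1 ≤ P →
      ∀ (S : PowerLawSystem D α) (U : ℝ → Op S.q), S.IsEvolution U → ∀ (s t : ℝ), s ≤ t →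
      ∀ x : S.Λ, ∀ O : Op S.q, ActsInBall (x : Site D) ρ O →
      ∃ O' : Op S.q, ActsInBall (x : Site D) (ρ + l) O' ∧ ‖O'‖ ≤ ‖O‖ ∧
        ‖heisenberg U s t O - O'‖ ≤ C * P ^ (D - 1) *
          (Real.exp (-4 * l) + l ^ (-(α - D - 1))) *
          (Real.exp (velocity D * (t - s)) - 1) * ‖O‖ := by
  obtain ⟨C, hC0, hC⟩ := exists_ball_truncation D hη
  refine ⟨C * ((D + 1) * 5 ^ (D - 1)), by positivity, fun α l ρ P hα hl hρ hρP hP S U hU s t hst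
    x O hO => ?_⟩
  have hD : (0 : ℝ) ≤ D := Nat.cast_nonneg D
  -- With p = D+1+η, one power of |z| pays for the exit count and D+η remain for a convergent tail.
  -- This is where α ≥ D+1+η is needed.
  obtain ⟨O', h1, h2, h3⟩ := hC (D + 1 + η) α l ρ ((D + 1) * 5 ^ (D - 1) * P ^ (D - 1))
    (by linarith) (by linarith) hα hl hρ (by positivity) (fun z hz => by
      have hz0 : 0 < ‖z.toReal‖ := by linarith
      have e1 := exitCount_le hρ.le z
      have e2 : (2 * ρ + 3) ^ (D - 1) ≤ (5 * P) ^ (D - 1) :=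
        pow_le_pow_left₀ (by linarith) (by linarith) _
      have e3 : (exitCount D ρ z : ℝ) ≤ ((D + 1) * 5 ^ (D - 1) * P ^ (D - 1)) * ‖z.toReal‖ := by
        calc (exitCount D ρ z : ℝ) ≤ D * ‖z.toReal‖ * (2 * ρ + 3) ^ (D - 1) := e1
          _ ≤ (D + 1) * ‖z.toReal‖ * (5 * P) ^ (D - 1) := by
              gcongr
              linarith
          _ = _ := by rw [mul_pow]; ring
      have e4 : (1 + ‖z.toReal‖) ^ (-((D : ℝ) + 1 + η)) ≤ ‖z.toReal‖ ^ (-((D : ℝ) + 1 + η)) :=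
        Real.rpow_le_rpow_of_nonpos hz0 (by linarith) (by linarith)
      have e5 : ‖z.toReal‖ ^ (-((D : ℝ) + η)) = ‖z.toReal‖ ^ (-((D : ℝ) + 1 + η)) * ‖z.toReal‖ := by
        rw [← Real.rpow_add_one hz0.ne']; congr 1; ring
      calc _ ≤ ‖z.toReal‖ ^ (-((D : ℝ) + 1 + η)) *
            (((D + 1) * 5 ^ (D - 1) * P ^ (D - 1)) * ‖z.toReal‖) :=
            mul_le_mul e4 e3 (Nat.cast_nonneg _) (Real.rpow_nonneg hz0.le _)
        _ = _ := by rw [e5]; ring) S U hU s t hst x O hO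
  refine ⟨O', h1, h2, h3.trans ?_⟩
  have hexp : 0 ≤ Real.exp (velocity D * (t - s)) - 1 :=
    sub_nonneg.2 (Real.one_le_exp (mul_nonneg (velocity_pos D).le (sub_nonneg.2 hst)))
  have h4 := rpow_neg_mul_decay_le (β := α - (D + 1 + η)) (by linarith) hη.le hl
  rw [show α - ((D : ℝ) + 1 + η) + η = α - D - 1 by ring] at h4
  have hc : 0 ≤ C * ((D + 1) * 5 ^ (D - 1) * P ^ (D - 1)) := by positivity
  refine mul_le_mul_of_nonneg_right (mul_le_mul_of_nonneg_right ?_ hexp) (norm_nonneg _)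
  refine (mul_le_mul_of_nonneg_left h4 hc).trans (le_of_eq (by ring))

/-- Truncation error in one dimension, uniform as the exponent tends to two. -/
theorem exists_interval_truncation {η : ℝ} (hη : 0 < η) (hη1 : η ≤ 1) : ∃ C : ℝ, 0 < C ∧
    ∀ (ε l ρ P : ℝ), 0 ≤ ε → ε ≤ 1 → 1 ≤ l → 0 < ρ → ρ ≤ P → 1 ≤ P →
      ∀ (S : PowerLawSystem 1 (2 + ε)) (U : ℝ → Op S.q), S.IsEvolution U → ∀ (s t : ℝ), s ≤ t →
      ∀ x : S.Λ, ∀ O : Op S.q, ActsInBall (x : Site 1) ρ O →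
      ∃ O' : Op S.q, ActsInBall (x : Site 1) (ρ + l) O' ∧ ‖O'‖ ≤ ‖O‖ ∧
        ‖heisenberg U s t O - O'‖ ≤ C * (l ^ (-(ε + η)) * P ^ η) *
          (Real.exp (velocity 1 * (t - s)) - 1) * ‖O‖ := by
  obtain ⟨C, hC0, hC⟩ := exists_ball_truncation 1 hη
  refine ⟨C * 5 ^ η, by positivity, fun ε l ρ P hε hε1 hl hρ hρP hP S U hU s t hst x O hO => ?_⟩
  have hl0 : 0 < l := by linarith
  obtain ⟨O', h1, h2, h3⟩ := hC 2 (2 + ε) l ρ ((5 * P) ^ η) (by norm_num) (by norm_num)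
    (by linarith) hl hρ (by positivity) (fun z hz => by
      have hz0 : 0 < ‖z.toReal‖ := by linarith
      have e1 : (exitCount 1 ρ z : ℝ) ≤ ‖z.toReal‖ := by
        have := exitCount_le hρ.le z
        simpa using this
      have e2 : (exitCount 1 ρ z : ℝ) ≤ 5 * P := by
        have h4 := card_le_of_norm_le (latticeBall 1 ρ) hρ.le fun z hz => (mem_latticeBall.1 hz).le
        have h5 : (exitCount 1 ρ z : ℝ) ≤ (latticeBall 1 ρ).card :=
          Nat.cast_le.2 (exitCount_le_card ρ z)
        rw [pow_one] at h4
        linarith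
      have e0 : (0 : ℝ) ≤ exitCount 1 ρ z := Nat.cast_nonneg _
      -- In one dimension the count is at most |z| and at most the number of points in the ball.
      -- Interpolating makes the tail converge with p = 2, at the price of P^η.
      have e3 : (exitCount 1 ρ z : ℝ) ≤ ‖z.toReal‖ ^ (1 - η) * (5 * P) ^ η := by
        calc (exitCount 1 ρ z : ℝ) = (exitCount 1 ρ z : ℝ) ^ ((1 - η) + η) := by
              rw [sub_add_cancel, Real.rpow_one]
          _ = (exitCount 1 ρ z : ℝ) ^ (1 - η) * (exitCount 1 ρ z : ℝ) ^ η :=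
              Real.rpow_add_of_nonneg e0 (by linarith) hη.le
          _ ≤ _ := mul_le_mul (Real.rpow_le_rpow e0 e1 (by linarith))
              (Real.rpow_le_rpow e0 e2 hη.le) (Real.rpow_nonneg e0 _) (Real.rpow_nonneg hz0.le _)
      have e4 : (1 + ‖z.toReal‖) ^ (-(2 : ℝ)) ≤ ‖z.toReal‖ ^ (-(2 : ℝ)) :=
        Real.rpow_le_rpow_of_nonpos hz0 (by linarith) (by norm_num)
      calc _ ≤ ‖z.toReal‖ ^ (-(2 : ℝ)) * (‖z.toReal‖ ^ (1 - η) * (5 * P) ^ η) :=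
            mul_le_mul e4 e3 e0 (Real.rpow_nonneg hz0.le _)
        _ = _ := by
            rw [← mul_assoc, ← Real.rpow_add hz0, mul_comm]
            congr 2
            push_cast
            ring) S U hU s t hst x O hO
  refine ⟨O', h1, h2, h3.trans ?_⟩
  have hexp : 0 ≤ Real.exp (velocity 1 * (t - s)) - 1 :=
    sub_nonneg.2 (Real.one_le_exp (mul_nonneg (velocity_pos 1).le (sub_nonneg.2 hst)))
  have h4 : decay (2 + ε - 2) l ≤ l ^ (-ε) := by
    rw [add_sub_cancel_left]
    refine max_le ?_ (Real.rpow_le_rpow_of_nonpos hl0 (by linarith) (by linarith))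
    calc Real.exp (-4 * l) ≤ l ^ (-(1 : ℝ)) := by
          rw [Real.rpow_neg_one, show -4 * l = -(4 * l) by ring, Real.exp_neg]
          refine inv_anti₀ hl0 ?_
          linarith [Real.add_one_le_exp (4 * l)]
      _ ≤ l ^ (-ε) := Real.rpow_le_rpow_of_exponent_le hl (by linarith)
  have h5 : l ^ (-η) * decay (2 + ε - 2) l ≤ l ^ (-(ε + η)) := by
    calc _ ≤ l ^ (-η) * l ^ (-ε) := mul_le_mul_of_nonneg_left h4 (Real.rpow_nonneg hl0.le _)
      _ = _ := by rw [← Real.rpow_add hl0]; congr 1; ring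
  refine mul_le_mul_of_nonneg_right (mul_le_mul_of_nonneg_right ?_ hexp) (norm_nonneg _)
  refine (mul_le_mul_of_nonneg_left h5 (by positivity)).trans (le_of_eq ?_)
  rw [Real.mul_rpow (by norm_num) (by linarith)]
  ring

/-- Iterated truncation: errors of successive time steps add up. -/
theorem iterate_truncation {D : ℕ} {α : ℝ} {S : PowerLawSystem D α} {U : ℝ → Op S.q}
    (hU : S.IsEvolution U) {x : Site D} {ρ l τ a : ℝ} (N : ℕ) (hτ : 0 ≤ τ)
    (hstep : ∀ k < N, ∀ s t, s ≤ t → t - s ≤ τ → ∀ O : Op S.q, ActsInBall x (ρ + k * l) O →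
      ∃ O', ActsInBall x (ρ + k * l + l) O' ∧ ‖O'‖ ≤ ‖O‖ ∧ ‖heisenberg U s t O - O'‖ ≤ a * ‖O‖)
    (ha : 0 ≤ a) (k : ℕ) (hk : k ≤ N) (s t : ℝ) (hst : s ≤ t) (hkt : t - s ≤ k * τ) (O : Op S.q)
    (hO : ActsInBall x ρ O) :
    ∃ O', ActsInBall x (ρ + k * l) O' ∧ ‖O'‖ ≤ ‖O‖ ∧ ‖heisenberg U s t O - O'‖ ≤ k * a * ‖O‖ := by
  induction k generalizing s t with
  | zero =>
    have : s = t := le_antisymm hst (by simpa using hkt)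
    subst this
    exact ⟨O, by simpa using hO, le_rfl, by simp [PowerLawSystem.heisenberg_self hU]⟩
  | succ k ih =>
    -- The last k steps cover [m, t] by induction; what precedes, [s, m], has length at most τ.
    set m := max s (t - k * τ) with hm
    have hkτ : 0 ≤ k * τ := by positivity
    have hmt : m ≤ t := max_le hst (by linarith)
    obtain ⟨O₁, h1, h2, h3⟩ := ih (by omega) m t hmt (by
      have := le_max_right s (t - k * τ)
      linarith)
    obtain ⟨O₂, g1, g2, g3⟩ := hstep k (by omega) s m (le_max_left _ _) (by
      push_cast at hkt
      rw [hm, sub_le_iff_le_add]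
      exact max_le (by linarith) (by linarith)) O₁ h1
    refine ⟨O₂, ?_, g2.trans h2, ?_⟩
    · push_cast
      rw [add_mul, one_mul, ← add_assoc]
      exact g1
    · rw [← PowerLawSystem.heisenberg_trans hU s m t]
      have e : heisenberg U s m (heisenberg U m t O) - O₂ =
          heisenberg U s m (heisenberg U m t O - O₁) + (heisenberg U s m O₁ - O₂) := by
        rw [PowerLawSystem.heisenberg_sub]; abel
      rw [e]
      calc _ ≤ k * a * ‖O‖ + a * ‖O₁‖ := (norm_add_le _ _).trans
            (add_le_add ((PowerLawSystem.norm_heisenberg_le hU _ _ _).trans h3) g3)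
        _ ≤ k * a * ‖O‖ + a * ‖O‖ := by gcongr
        _ = _ := by push_cast; ring

/-! ### Spreading in twice the time -/

section Doubling

variable {D : ℕ} {α : ℝ} {S : PowerLawSystem D α} {U : ℝ → Op S.q}

/-- Within time `τ` an operator in the ball of radius `ρ` spreads beyond radius `ρ + l` with
relative weight at most `a`. -/
def SpreadBound (U : ℝ → Op S.q) (x : Site D) (τ ρ l a : ℝ) : Prop :=
  ∀ s t, s ≤ t → t - s ≤ τ → ∀ O : Op S.q, ActsInBall x ρ O →
    ∃ O', ActsInBall x (ρ + l) O' ∧ ‖heisenberg U s t O - O'‖ ≤ a * ‖O‖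

theorem SpreadBound.mono {x : Site D} {τ ρ l a b : ℝ} (h : SpreadBound U x τ ρ l a) (hab : a ≤ b) :
    SpreadBound U x τ ρ l b := fun s t hst htau O hO => by
  obtain ⟨O', h1, h2⟩ := h s t hst htau O hO
  exact ⟨O', h1, h2.trans (mul_le_mul_of_nonneg_right hab (norm_nonneg _))⟩

/-- Doubling the time: a single large excursion in either half, or one moderate excursion in each
half, is needed to spread far. -/
theorem SpreadBound.double (hU : S.IsEvolution U) {x : Site D} {τ ρ l r a b : ℝ} (hτ : 0 ≤ τ)
    (hr : 0 ≤ r)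
    (h1 : SpreadBound U x τ ρ l b) (h2 : SpreadBound U x τ ρ (l + r) a)
    (h3 : SpreadBound U x τ (ρ + l) (l + r) a) (h4 : SpreadBound U x τ (ρ + l + r) l b)
    (ha : 0 ≤ a) (hab : a ≤ b) :
    SpreadBound U x (2 * τ) ρ (2 * l + r) (2 * a + 3 * b ^ 2) := by
  intro s t hst htau O hO
  set m := max s (t - τ) with hm
  have hmt : m ≤ t := max_le hst (by linarith)
  have hsm : s ≤ m := le_max_left _ _
  have htm : t - m ≤ τ := by
    have := le_max_right s (t - τ)
    linarith
  have hms : m - s ≤ τ := by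
    rw [hm, sub_le_iff_le_add]
    exact max_le (by linarith) (by linarith)
  have hb : 0 ≤ b := ha.trans hab
  obtain ⟨A₁, f1, f2⟩ := h1 m t hmt htm O hO
  obtain ⟨A₂, g1, g2⟩ := h2 m t hmt htm O hO
  obtain ⟨B₁, k1, k2⟩ := h3 s m hsm hms A₁ f1
  have g1' : ActsInBall x (ρ + l + r) A₂ := by rwa [add_assoc]
  have hd : ActsInBall x (ρ + l + r) (A₂ - A₁) := g1'.sub (f1.mono (by linarith))
  obtain ⟨B₂, n1, n2⟩ := h4 s m hsm hms (A₂ - A₁) hd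
  refine ⟨B₁ + B₂, (k1.mono (by linarith)).add (n1.mono (by linarith)), ?_⟩
  set Om := heisenberg U m t O with hOm
  have hOmn : ‖Om‖ ≤ ‖O‖ := PowerLawSystem.norm_heisenberg_le hU _ _ _
  have hA₁ : ‖A₁‖ ≤ (1 + b) * ‖O‖ := by
    have e : A₁ = Om - (Om - A₁) := by abel
    rw [e]
    refine (norm_sub_le _ _).trans ?_
    linarith
  have hA₂ : ‖A₂ - A₁‖ ≤ 2 * b * ‖O‖ := by
    have e : A₂ - A₁ = (Om - A₁) - (Om - A₂) := by abel
    rw [e]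
    refine (norm_sub_le _ _).trans ?_
    nlinarith [mul_le_mul_of_nonneg_right hab (norm_nonneg O)]
  have e : heisenberg U s t O - (B₁ + B₂) = heisenberg U s m (Om - A₂) +
      (heisenberg U s m A₁ - B₁) + (heisenberg U s m (A₂ - A₁) - B₂) := by
    rw [← PowerLawSystem.heisenberg_trans hU s m t, ← hOm, PowerLawSystem.heisenberg_sub,
      PowerLawSystem.heisenberg_sub]
    abel
  rw [e]
  have hO0 := norm_nonneg O
  -- The total a + a(1+b) + 2b² is at most 2a + 3b² because a ≤ b.
  calc _ ≤ a * ‖O‖ + a * ‖A₁‖ + b * ‖A₂ - A₁‖ := by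
        refine (norm_add_le _ _).trans (add_le_add ((norm_add_le _ _).trans (add_le_add ?_ k2)) n2)
        exact (PowerLawSystem.norm_heisenberg_le hU _ _ _).trans g2
    _ ≤ a * ‖O‖ + a * ((1 + b) * ‖O‖) + b * (2 * b * ‖O‖) := by gcongr
    _ ≤ (2 * a + 3 * b ^ 2) * ‖O‖ := by
        nlinarith [mul_le_mul_of_nonneg_right (mul_le_mul_of_nonneg_right hab hb) hO0]

end Doubling

/-! ### Induction over dyadic time scales -/

section Multiscale

/-- The one-step bound is available only for l ≥ 1. Smallness of the weight already excludes l < 1,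
so this need not be assumed separately. -/
theorem one_le_of_rpow_small {l P σ η : ℝ} (hl : 0 < l) (hlP : l ≤ P) (hη : 0 ≤ η) (hησ : η ≤ σ)
    (h : l ^ (-σ) * P ^ η < 1) : 1 ≤ l := by
  by_contra hcon
  push Not at hcon
  have h1 : l ^ η ≤ P ^ η := Real.rpow_le_rpow hl.le hlP hη
  have h2 : l ^ (-σ) * l ^ η ≤ l ^ (-σ) * P ^ η :=
    mul_le_mul_of_nonneg_left h1 (Real.rpow_nonneg hl.le _)
  rw [← Real.rpow_add hl] at h2
  have h3 : 1 ≤ l ^ (-σ + η) :=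
    Real.one_le_rpow_of_pos_of_le_one_of_nonpos hl hcon.le (by linarith)
  linarith

/-- Shrinking the length by 2^(m+1) enlarges the weight by this power. For σ ≤ 1/8 its eighth power
is at most 2^(m+1) ≤ 4^m, so even its square is beaten by the factor 2^(-m) gained from the shorter
time. -/
theorem two_pow_rpow_bounds {σ : ℝ} (hσ0 : 0 ≤ σ) (hσ : σ ≤ 1 / 8) {m : ℕ} (hm : 1 ≤ m) :
    1 ≤ ((2 : ℝ) ^ (m + 1)) ^ σ ∧ (((2 : ℝ) ^ (m + 1)) ^ σ) ^ 2 ≤ (3 / 2) ^ m ∧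
      ((2 : ℝ) ^ (m + 1)) ^ σ ≤ 2 ^ m := by
  set u : ℝ := ((2 : ℝ) ^ (m + 1)) ^ σ with hu
  have h2 : (1 : ℝ) ≤ 2 ^ (m + 1) := one_le_pow₀ (by norm_num)
  have h1 : 1 ≤ u := Real.one_le_rpow h2 hσ0
  have h8 : u ^ 8 ≤ 2 ^ (m + 1) := by
    rw [hu, ← Real.rpow_natCast, ← Real.rpow_mul (by positivity)]
    calc ((2 : ℝ) ^ (m + 1)) ^ (σ * (8 : ℕ)) ≤ ((2 : ℝ) ^ (m + 1)) ^ (1 : ℝ) :=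
          Real.rpow_le_rpow_of_exponent_le h2 (by push_cast; linarith)
      _ = _ := Real.rpow_one _
  have h4 : u ^ 4 ≤ 2 ^ m := by
    have h5 : (u ^ 4) ^ 2 ≤ ((2 : ℝ) ^ m) ^ 2 := by
      rw [← pow_mul, ← pow_mul]
      exact h8.trans (pow_le_pow_right₀ (by norm_num) (by omega))
    exact le_of_sq_le_sq h5 (by positivity)
  refine ⟨h1, ?_, ?_⟩
  · have h5 : (u ^ 2) ^ 2 ≤ ((3 / 2 : ℝ) ^ m) ^ 2 := by
      rw [← pow_mul, ← pow_mul, mul_comm m 2, pow_mul (3 / 2 : ℝ)]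
      exact h4.trans (pow_le_pow_left₀ (by norm_num) (by norm_num) m)
    exact le_of_sq_le_sq h5 (by positivity)
  · exact (le_self_pow₀ h1 (by norm_num)).trans h4

variable {D : ℕ} {α : ℝ} {S : PowerLawSystem D α} {U : ℝ → Op S.q}

set_option maxHeartbeats 1000000 in
/-- A spreading bound linear in time, obtained from the bound for a single time step by doubling
the time repeatedly. Excursions on length scales below the final one have to occur twice within the
corresponding time, which is why their total contribution is summable over scales. -/
theorem spreadBound_two_pow (hU : S.IsEvolution U) {x : Site D} {τ P A σ η : ℝ} (hτ : 0 ≤ τ)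
    (hA : 1 ≤ A) (hη : 0 ≤ η) (hησ : η ≤ σ) (hσ : σ ≤ 1 / 8) (hP : 0 < P)
    (hbase : ∀ ρ l, 1 ≤ l → 0 < ρ → ρ + l ≤ P → SpreadBound U x τ ρ l (A * (l ^ (-σ) * P ^ η)))
    (n : ℕ) : ∀ ρ l, 0 < ρ → 0 < l → ρ + l ≤ P → 2 ^ n * (l ^ (-σ) * P ^ η) ≤ 1 / (48 * A) →
      SpreadBound U x (2 ^ n * τ) ρ l (6 * A * (2 ^ n * (l ^ (-σ) * P ^ η))) := by
  induction n using Nat.strong_induction_on with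
  | _ n IH =>
  intro ρ l hρ hl hlP hY
  have hA0 : 0 < A := by linarith
  have hPη : 0 < P ^ η := Real.rpow_pos_of_pos hP _
  set Y : ℝ := 2 ^ n * (l ^ (-σ) * P ^ η) with hYdef
  have hY0 : 0 < Y := by
    have := Real.rpow_pos_of_pos hl (-σ)
    positivity
  have hAY : 48 * A * Y ≤ 1 := by
    rw [le_div_iff₀ (by positivity)] at hY
    linarith
  have hY48 : Y ≤ 1 / 48 := by nlinarith
  -- The induction closes because 48AY ≤ 1 gives Q ≤ 27A/8, hence 2A + Q ≤ 6A. The 9/2 in Q is what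
  -- the recursion of `chain` requires.
  set B : ℝ := 6 * A with hB
  set Q : ℝ := 9 / 2 * B ^ 2 * Y with hQ
  have hQ0 : 0 ≤ Q := by positivity
  have hQA : 2 * A + Q ≤ B := by
    have h1 : Q = 27 / 8 * A * (48 * A * Y) := by rw [hQ, hB]; ring
    have h2 : 27 / 8 * A * (48 * A * Y) ≤ 27 / 8 * A * 1 :=
      mul_le_mul_of_nonneg_left hAY (by positivity)
    rw [h1, hB]
    linarith
  have hYl : l ^ (-σ) * P ^ η = Y / 2 ^ n := by
    rw [hYdef]; field_simp
  -- For the fixed final l, the time is doubled n times while the range grows from just above l/2 to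
  -- l. Each doubling doubles the weight, apart from a correction controlled by Q (3/4)^(n-j).
  have chain : ∀ j, j ≤ n → ∀ ρ', 0 < ρ' → ρ' + l * (1 / 2 + 1 / 2 * (1 / 2) ^ (n - j)) ≤ P →
      SpreadBound U x (2 ^ j * τ) ρ' (l * (1 / 2 + 1 / 2 * (1 / 2) ^ (n - j)))
        (Y * (1 / 2) ^ (n - j) * (2 * A + Q * (3 / 4) ^ (n - j))) := by
    intro j
    induction j with
    | zero =>
      intro _ ρ' hρ' hP'
      rw [pow_zero, one_mul, Nat.sub_zero] at *
      set l' := l * (1 / 2 + 1 / 2 * (1 / 2) ^ n) with hl'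
      have hpow : (0 : ℝ) < (1 / 2) ^ n := by positivity
      have hl2 : l / 2 ≤ l' := by rw [hl']; nlinarith
      have hl0' : 0 < l' := by linarith
      have h2σ : (1 / 2 : ℝ) ^ (-σ) ≤ 2 := by
        rw [one_div, Real.inv_rpow (by norm_num), ← Real.rpow_neg (by norm_num), neg_neg]
        calc (2 : ℝ) ^ σ ≤ 2 ^ (1 : ℝ) :=
              Real.rpow_le_rpow_of_exponent_le one_le_two (by linarith)
          _ = 2 := Real.rpow_one 2
      have h3 : l' ^ (-σ) ≤ 2 * l ^ (-σ) := by
        calc l' ^ (-σ) ≤ (l / 2) ^ (-σ) :=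
              Real.rpow_le_rpow_of_nonpos (by linarith) hl2 (by linarith)
          _ = (1 / 2) ^ (-σ) * l ^ (-σ) := by
              rw [← Real.mul_rpow (by norm_num) hl.le]; congr 1; ring
          _ ≤ _ := mul_le_mul_of_nonneg_right h2σ (Real.rpow_nonneg hl.le _)
      have h4 : l' ^ (-σ) * P ^ η ≤ 2 * (Y * (1 / 2) ^ n) := by
        calc l' ^ (-σ) * P ^ η ≤ 2 * l ^ (-σ) * P ^ η := mul_le_mul_of_nonneg_right h3 hPη.le
          _ = 2 * (l ^ (-σ) * P ^ η) := by ring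
          _ = _ := by rw [hYl, one_div, inv_pow]; ring
      have h5 : l' ^ (-σ) * P ^ η < 1 := by
        have : (1 / 2 : ℝ) ^ n ≤ 1 := pow_le_one₀ (by norm_num) (by norm_num)
        nlinarith
      have h6 := one_le_of_rpow_small hl0' (by linarith) hη hησ h5
      refine (hbase ρ' l' h6 hρ' hP').mono ?_
      have h7 : 0 ≤ Y * (1 / 2) ^ n * (Q * (3 / 4) ^ n) := by positivity
      calc A * (l' ^ (-σ) * P ^ η) ≤ A * (2 * (Y * (1 / 2) ^ n)) :=
            mul_le_mul_of_nonneg_left h4 hA0.le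
        _ ≤ _ := by linarith
    | succ j ihj =>
      intro hj ρ' hρ' hP'
      obtain ⟨m, hm⟩ : ∃ m, n - j = m + 1 := ⟨n - j - 1, by omega⟩
      have hm' : n - (j + 1) = m := by omega
      have hnj : n = j + (m + 1) := by omega
      have ih := ihj (by omega)
      rw [hm] at ih
      rw [hm'] at hP' ⊢
      -- Δ is the moderate excursion: 2Δ + l/2 is the range after the doubling and Δ + l/2 the range
      -- before it. Its weight comes from the outer induction at the smaller index j.
      set Δ : ℝ := l * ((1 / 2) ^ (m + 1 + 1)) with hΔ
      have hΔ0 : 0 < Δ := by positivity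
      have el : l * (1 / 2 + 1 / 2 * (1 / 2) ^ m) = 2 * Δ + l / 2 := by
        rw [hΔ]; ring
      have el' : l * (1 / 2 + 1 / 2 * (1 / 2) ^ (m + 1)) = Δ + l / 2 := by
        rw [hΔ]; ring
      rw [el] at hP' ⊢
      rw [el'] at ih
      obtain ⟨hu1, hu2, hu3⟩ := two_pow_rpow_bounds (hη.trans hησ) hσ
        (m := m + 1) (by omega)
      set u : ℝ := ((2 : ℝ) ^ (m + 1 + 1)) ^ σ with hu
      have hΔσ : Δ ^ (-σ) = u * l ^ (-σ) := by
        rw [hΔ, Real.mul_rpow hl.le (by positivity), one_div, inv_pow, Real.inv_rpow (by positivity),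
          ← Real.rpow_neg (by positivity), neg_neg, mul_comm]
      set y : ℝ := 2 ^ j * (Δ ^ (-σ) * P ^ η) with hy
      have hyY : y = Y * (1 / 2) ^ (m + 1) * u := by
        rw [hy, hΔσ, mul_assoc u, hYl, hnj, pow_add, one_div, inv_pow]
        field_simp
      have hpm : (0 : ℝ) < (1 / 2) ^ (m + 1) := by positivity
      have hpu : (1 / 2 : ℝ) ^ (m + 1) * u ≤ 1 := by
        calc (1 / 2 : ℝ) ^ (m + 1) * u ≤ (1 / 2) ^ (m + 1) * 2 ^ (m + 1) :=
              mul_le_mul_of_nonneg_left hu3 hpm.le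
          _ = 1 := by rw [← mul_pow]; norm_num
      have hyle : y ≤ Y := by
        rw [hyY, mul_assoc]
        exact mul_le_of_le_one_right hY0.le hpu
      have hysq : y ^ 2 ≤ Y ^ 2 * (1 / 2) ^ (m + 1) * (3 / 4) ^ (m + 1) := by
        calc y ^ 2 = Y ^ 2 * (1 / 2) ^ (m + 1) * ((1 / 2) ^ (m + 1) * u ^ 2) := by
              rw [hyY]; ring
          _ ≤ Y ^ 2 * (1 / 2) ^ (m + 1) * ((1 / 2) ^ (m + 1) * (3 / 2) ^ (m + 1)) := by
              gcongr
          _ = _ := by rw [← mul_pow]; norm_num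
      have h34 : (3 / 4 : ℝ) ^ (m + 1) ≤ 1 := pow_le_one₀ (by norm_num) (by norm_num)
      have h340 : (0 : ℝ) < (3 / 4) ^ (m + 1) := by positivity
      have hexc : ∀ ρ'', 0 < ρ'' → ρ'' + Δ ≤ P → SpreadBound U x (2 ^ j * τ) ρ'' Δ (B * y) :=
        fun ρ'' h1 h2 => IH j (by omega) ρ'' Δ h1 hΔ0 h2 (hyle.trans hY)
      have hab : Y * (1 / 2) ^ (m + 1) * (2 * A + Q * (3 / 4) ^ (m + 1)) ≤ B * y := by
        have h1 : 2 * A + Q * (3 / 4) ^ (m + 1) ≤ B := by nlinarith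
        have h0 : 0 < Y * (1 / 2) ^ (m + 1) := by positivity
        calc _ ≤ Y * (1 / 2) ^ (m + 1) * B := mul_le_mul_of_nonneg_left h1 h0.le
          _ ≤ Y * (1 / 2) ^ (m + 1) * B * u := le_mul_of_one_le_right (by positivity) hu1
          _ = _ := by rw [hyY]; ring
      have hdouble := SpreadBound.double hU (x := x) (τ := 2 ^ j * τ) (ρ := ρ') (l := Δ)
        (r := l / 2) (a := Y * (1 / 2) ^ (m + 1) * (2 * A + Q * (3 / 4) ^ (m + 1))) (b := B * y)
        (by positivity) (by positivity) (hexc ρ' hρ' (by linarith))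
        (ih ρ' hρ' (by linarith)) (ih (ρ' + Δ) (by linarith) (by linarith))
        (hexc (ρ' + Δ + l / 2) (by linarith) (by linarith)) (by positivity) hab
      rw [show (2 : ℝ) ^ (j + 1) * τ = 2 * (2 ^ j * τ) by rw [pow_succ]; ring]
      refine hdouble.mono ?_
      -- The squared excursions add a third of the Q-term in 2a, and 4/3 · (3/4)^(m+1) = (3/4)^m
      -- restores the claimed form.
      have h5 : 3 * (B * y) ^ 2 ≤
          Y * (1 / 2) ^ (m + 1) * (2 / 3 * Q * (3 / 4) ^ (m + 1)) := by
        calc 3 * (B * y) ^ 2 = 3 * B ^ 2 * y ^ 2 := by ring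
          _ ≤ 3 * B ^ 2 * (Y ^ 2 * (1 / 2) ^ (m + 1) * (3 / 4) ^ (m + 1)) := by gcongr
          _ = _ := by rw [hQ]; ring
      have e1 : (1 / 2 : ℝ) ^ m = 2 * (1 / 2) ^ (m + 1) := by rw [pow_succ]; ring
      have e2 : (3 / 4 : ℝ) ^ m = 4 / 3 * (3 / 4) ^ (m + 1) := by rw [pow_succ]; ring
      rw [e1, e2]
      linarith
  have hfin := chain n le_rfl ρ hρ (by simpa using hlP.trans_eq' (by norm_num))
  rw [Nat.sub_self, pow_zero, pow_zero, mul_one, mul_one, mul_one,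
    show (1 / 2 + 1 / 2 : ℝ) = 1 by norm_num, mul_one] at hfin
  refine hfin.mono ?_
  rw [mul_comm B]
  exact mul_le_mul_of_nonneg_left hQA hY0.le

end Multiscale

/-! ### From truncation to commutators -/

namespace Probe

variable {D : ℕ} {α : ℝ} {S : PowerLawSystem D α} {r₀ R : ℝ}

/-- An operator acting trivially on Y commutes with `OY`, so the commutator sees only the truncation
error. -/
theorem commNorm_le_of_fixed (P : Probe S r₀ R) (T : ℝ) (O' : Op S.q)
    (h : ∀ i ∈ P.Y, siteAverage i O' = O') :
    P.commNorm T ≤ 2 * ‖heisenberg P.U 0 T P.OX - O'‖ * ‖P.OY‖ := by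
  classical
  have hc : O' * P.OY = P.OY * O' :=
    mul_comm_of_fixed P.Y.toFinset (fun i hi => h i (Set.mem_toFinset.1 hi))
      (fun i hi => siteAverage_of_supportedOn P.supported_OY (fun h => hi (Set.mem_toFinset.2 h)))
  rw [Probe.commNorm, ← PowerLawSystem.heisenberg_zero P.isEvolution, Ring.lie_def]
  set Z := heisenberg P.U 0 T P.OX
  have e : Z * P.OY - P.OY * Z = (Z - O') * P.OY - P.OY * (Z - O') := by
    rw [sub_mul, mul_sub, hc]; abel
  rw [e]
  calc _ ≤ ‖Z - O'‖ * ‖P.OY‖ + ‖P.OY‖ * ‖Z - O'‖ :=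
        (norm_sub_le _ _).trans (add_le_add (norm_mul_le _ _) (norm_mul_le _ _))
    _ = _ := by ring

theorem commNorm_le_two (P : Probe S r₀ R) (T : ℝ) :
    P.commNorm T ≤ 2 * (‖P.OX‖ * ‖P.OY‖) := by
  have h := P.commNorm_le_of_fixed T 0 (fun i _ => map_zero _)
  rw [sub_zero] at h
  have h1 := PowerLawSystem.norm_heisenberg_le P.isEvolution 0 T P.OX
  calc _ ≤ _ := h
    _ ≤ 2 * ‖P.OX‖ * ‖P.OY‖ := by gcongr
    _ = _ := by ring

theorem exists_mem (P : Probe S r₀ R) : ∃ x, x ∈ P.X := by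
  obtain ⟨x, hx, -⟩ := P.isLeast_dist.1
  exact ⟨x, hx⟩

theorem le_dist (P : Probe S r₀ R) {x y : S.Λ} (hx : x ∈ P.X) (hy : y ∈ P.Y) :
    R ≤ siteDist (x : Site D) y := P.isLeast_dist.2 ⟨x, hx, y, hy, rfl⟩

theorem one_le_dist (P : Probe S r₀ R) : 1 ≤ R := by
  obtain ⟨x, hx, y, hy, hR⟩ := P.isLeast_dist.1
  have hne : (x : Site D) ≠ y := fun h => by
    have := P.dist_pos
    rw [hR, h, siteDist_self] at this
    exact lt_irrefl _ this
  rw [hR]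
  exact one_le_siteDist hne

theorem actsInBall (P : Probe S r₀ R) {x : S.Λ} (hx : x ∈ P.X) {ρ : ℝ} (hρ : r₀ < ρ) :
    ActsInBall (x : Site D) ρ P.OX := fun i hi =>
  siteAverage_of_supportedOn P.supported_OX fun h => by
    have := P.diam_X_le i h x hx
    linarith

/-- Operators truncated to the ball of radius `R` around a point of `X` commute with `OY`. -/
theorem commNorm_le_of_actsInBall (P : Probe S r₀ R) (T : ℝ) {x : S.Λ} (hx : x ∈ P.X) {ρ : ℝ}
    (hρ : ρ ≤ R) {O' : Op S.q} (hO : ActsInBall (x : Site D) ρ O') :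
    P.commNorm T ≤ 2 * ‖heisenberg P.U 0 T P.OX - O'‖ * ‖P.OY‖ :=
  P.commNorm_le_of_fixed T O' fun i hi => hO i (by
    rw [siteDist_comm]; exact hρ.trans (P.le_dist hx hi))

end Probe

/-! ### Short and long times, with constants uniform in the exponent -/

theorem one_le_prefactor {γ α : ℝ} (hγ : 0 < γ) (hγ1 : γ < 1) (hα : 0 ≤ α) :
    (4 : ℝ) ^ α ≤ (16 / (1 - γ)) ^ α ∧ 1 ≤ (16 / (1 - γ)) ^ α := by
  have h1 : 4 ≤ 16 / (1 - γ) := by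
    rw [le_div_iff₀ (by linarith)]; linarith
  exact ⟨Real.rpow_le_rpow (by norm_num) h1 hα, Real.one_le_rpow (by linarith) hα⟩

/-- Truncation steps have width only at least l/4. The rate 4 in `decay` still leaves e^(-l) ≤
e^(-γl), and the 4^(α-D-1) lost in the power is absorbed by the prefactor of ξ. -/
theorem le_xi {D : ℕ} {γ α l m : ℝ} (hγ : 0 < γ) (hγ1 : γ < 1) (hα : (D : ℝ) + 1 ≤ α) (hl : 0 < l)
    (hm : l / 4 ≤ m) : Real.exp (-4 * m) + m ^ (-(α - D - 1)) ≤ xi D γ α l := by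
  have hD : (0 : ℝ) ≤ D := Nat.cast_nonneg D
  have h1 : Real.exp (-4 * m) ≤ Real.exp (-γ * l) := Real.exp_le_exp.2 (by nlinarith)
  have h2 : m ^ (-(α - D - 1)) ≤ (16 / (1 - γ)) ^ α * (1 / l ^ (α - D - 1)) := by
    calc m ^ (-(α - D - 1)) ≤ (l / 4) ^ (-(α - D - 1)) :=
          Real.rpow_le_rpow_of_nonpos (by linarith) hm (by linarith)
      _ = 4 ^ (α - D - 1) * (1 / l ^ (α - D - 1)) := by
          rw [Real.rpow_neg (by linarith), Real.div_rpow hl.le (by norm_num), inv_div, div_eq_mul_one_div]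
      _ ≤ (16 / (1 - γ)) ^ α * (1 / l ^ (α - D - 1)) := by
          refine mul_le_mul_of_nonneg_right ?_
            (div_nonneg zero_le_one (Real.rpow_nonneg hl.le _))
          exact (Real.rpow_le_rpow_of_exponent_le (by norm_num) (by linarith)).trans
            (one_le_prefactor hγ hγ1 (by linarith)).1
  rw [xi]
  linarith

theorem xi_pos {D : ℕ} {γ α l : ℝ} (hγ1 : γ < 1) (hl : 0 < l) : 0 < xi D γ α l :=
  add_pos_of_nonneg_of_pos (mul_nonneg
    (Real.rpow_nonneg (div_nonneg (by norm_num) (by linarith)) _)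
    (div_nonneg zero_le_one (Real.rpow_nonneg hl.le _))) (Real.exp_pos _)

/-- For bounded l, ξ is bounded below uniformly in α and γ, so there the trivial commutator bound
suffices. -/
theorem exp_neg_le_xi {D : ℕ} {γ α l L : ℝ} (hγ1 : γ < 1) (hl : 0 < l) (hlL : l ≤ L) :
    Real.exp (-L) ≤ xi D γ α l := by
  have h1 : 0 ≤ (16 / (1 - γ)) ^ α * (1 / l ^ (α - D - 1)) :=
    mul_nonneg (Real.rpow_nonneg (div_nonneg (by norm_num) (by linarith)) _)
      (div_nonneg zero_le_one (Real.rpow_nonneg hl.le _))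
  have h2 : Real.exp (-L) ≤ Real.exp (-γ * l) := Real.exp_le_exp.2 (by nlinarith)
  rw [xi]
  linarith

/-- Lieb-Robinson bound for an operator initially supported on a set of bounded diameter. -/
theorem exists_short_time_bound (D : ℕ) (r₀ : ℝ) : ∃ C : ℝ, 0 < C ∧
    ∀ α : ℝ, (D : ℝ) + 1 ≤ α → ∀ (S : PowerLawSystem D α) (R : ℝ) (P : Probe S r₀ R) (T : ℝ),
      0 ≤ T → P.commNorm T ≤ C * (Real.exp (velocity D * T) - 1) *
        (Real.exp (-4 * R) + R ^ (-(α - D - 1))) * (‖P.OX‖ * ‖P.OY‖) := by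
  obtain ⟨C, hC1, hC⟩ := exists_sum_bound D
  set K : ℝ := (2 * |r₀| + 1) ^ D with hK
  have hK0 : 0 < K := pow_pos (by linarith [abs_nonneg r₀]) _
  refine ⟨4 * (K * C), by positivity, fun α hα S R P T hT => ?_⟩
  classical
  have hR1 := P.one_le_dist
  obtain ⟨x, hx⟩ := P.exists_mem
  set A : Finset S.Λ := P.X.toFinset with hA
  set B : Finset S.Λ := P.Y.toFinset with hB
  have hAB : ∀ a ∈ A, ∀ b ∈ B, R ≤ siteDist (a : Site D) b := fun a ha b hb =>
    P.le_dist (Set.mem_toFinset.1 ha) (Set.mem_toFinset.1 hb)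
  have hdisj : Disjoint A B := Finset.disjoint_left.2 fun a ha hb => by
    have := hAB a ha a hb
    rw [siteDist_self] at this
    linarith
  obtain ⟨O', h1, h2, h3⟩ := (exists_truncation_bound D).choose_spec.2 (D + 1) α le_rfl
    (by linarith) hα S P.U P.isEvolution 0 T hT A B ⟨x, Set.mem_toFinset.2 hx⟩ hdisj P.OX
    (fun i hi => siteAverage_of_supportedOn P.supported_OX fun h => hi (Set.mem_toFinset.2 h))
  have hβ : 0 ≤ α - (D + 1) := by linarith
  -- X lies in a ball of radius |r₀| about one of its points; this is how the constant depends on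
  -- r₀.
  have hcard : (A.card : ℝ) ≤ K := by
    have h4 := card_le_of_norm_le (A.image fun a : S.Λ => (a : Site D) - (x : Site D)) (abs_nonneg r₀)
      (fun z hz => by
        obtain ⟨a, ha, rfl⟩ := Finset.mem_image.1 hz
        rw [← siteDist_eq_norm]
        exact (P.diam_X_le a (Set.mem_toFinset.1 ha) x hx).trans (le_abs_self _))
    rwa [Finset.card_image_of_injective _
      (fun a b hab => Subtype.ext (sub_left_injective hab))] at h4
  have hsum : ∑ a ∈ A, ∑ b ∈ B, kernel (D + 1) (α - (D + 1)) (siteDist (a : Site D) b) ≤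
      K * (decay (α - (D + 1)) R * C) := by
    have h5 : ∀ a ∈ A, ∑ b ∈ B, kernel (D + 1) (α - (D + 1)) (siteDist (a : Site D) b) ≤
        decay (α - (D + 1)) R * C := by
      intro a ha
      have h6 := hC (D + 1) le_rfl (B.map (Function.Embedding.subtype _)) (a : Site D)
      rw [Finset.sum_map] at h6
      simp only [Function.Embedding.coe_subtype] at h6
      refine le_trans ?_ (mul_le_mul_of_nonneg_left h6 (decay_pos _ _).le)
      rw [Finset.mul_sum]
      refine Finset.sum_le_sum fun b hb => ?_
      rw [kernel, mul_comm]
      refine mul_le_mul_of_nonneg_right (decay_antitone hβ (by linarith) (hAB a ha b hb)) ?_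
      exact Real.rpow_nonneg (by linarith [siteDist_nonneg (a : Site D) b]) _
    refine (Finset.sum_le_card_nsmul _ _ _ h5).trans ?_
    rw [nsmul_eq_mul]
    exact mul_le_mul_of_nonneg_right hcard (mul_nonneg (decay_pos _ _).le (by linarith))
  have hexp : 0 ≤ Real.exp (velocity D * T) - 1 :=
    sub_nonneg.2 (Real.one_le_exp (mul_nonneg (velocity_pos D).le hT))
  have hdec := decay_le_add hβ (by linarith : 0 < R)
  rw [show α - ((D : ℝ) + 1) = α - D - 1 by ring] at hdec hsum
  have h7 : ‖heisenberg P.U 0 T P.OX - O'‖ ≤ 2 * ‖P.OX‖ * (Real.exp (velocity D * T) - 1) *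
      (K * ((Real.exp (-4 * R) + R ^ (-(α - D - 1))) * C)) := by
    rw [sub_zero] at h3
    refine h3.trans ?_
    rw [show α - ((D : ℝ) + 1) = α - D - 1 by ring]
    refine mul_le_mul_of_nonneg_left (hsum.trans ?_)
      (mul_nonneg (mul_nonneg zero_le_two (norm_nonneg _)) hexp)
    exact mul_le_mul_of_nonneg_left (mul_le_mul_of_nonneg_right hdec (by linarith)) hK0.le
  refine (P.commNorm_le_of_fixed T O' fun i hi => h1 i (Set.mem_toFinset.2 hi)).trans ?_
  calc _ ≤ 2 * (2 * ‖P.OX‖ * (Real.exp (velocity D * T) - 1) *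
        (K * ((Real.exp (-4 * R) + R ^ (-(α - D - 1))) * C))) * ‖P.OY‖ :=
        mul_le_mul_of_nonneg_right (mul_le_mul_of_nonneg_left h7 zero_le_two) (norm_nonneg _)
    _ = _ := by ring

/-- The long-time bound holds trivially when the effective length is bounded. -/
theorem trivial_long_time_bound {D : ℕ} (hD : 1 ≤ D) {γ α r₀ R T L v : ℝ}
    (hγ1 : γ < 1) (hα : 2 * (D : ℝ) < α) {S : PowerLawSystem D α} (P : Probe S r₀ R)
    (hT : α ≤ v * T) (hL : R * α / (v * T) ≤ L) :
    P.commNorm T ≤ 2 * v * Real.exp L * Real.exp α * T * R ^ (D - 1) *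
      xi D γ α (R * α / (v * T)) * (‖P.OX‖ * ‖P.OY‖) := by
  have hD1 : (1 : ℝ) ≤ D := by exact_mod_cast hD
  have hα1 : 1 ≤ α := by linarith
  have hR := P.one_le_dist
  have hl : 0 < R * α / (v * T) := div_pos (mul_pos (by linarith) (by linarith)) (by linarith)
  have h1 := exp_neg_le_xi (D := D) (α := α) hγ1 hl hL
  have h2 : 1 ≤ Real.exp L * xi D γ α (R * α / (v * T)) := by
    calc (1 : ℝ) = Real.exp L * Real.exp (-L) := by rw [← Real.exp_add]; simp
      _ ≤ _ := mul_le_mul_of_nonneg_left h1 (Real.exp_pos _).le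
  have h3 : 1 ≤ Real.exp α := Real.one_le_exp (by linarith)
  have h4 : 1 ≤ R ^ (D - 1) := one_le_pow₀ hR
  have h5 : 1 ≤ v * T := by linarith
  have h6 : 1 ≤ (v * T) * (Real.exp α * R ^ (D - 1)) * (Real.exp L * xi D γ α (R * α / (v * T))) :=
    one_le_mul_of_one_le_of_one_le (one_le_mul_of_one_le_of_one_le h5
      (one_le_mul_of_one_le_of_one_le h3 h4)) h2
  have h7 : 0 ≤ ‖P.OX‖ * ‖P.OY‖ := mul_nonneg (norm_nonneg _) (norm_nonneg _)
  refine (P.commNorm_le_two T).trans ?_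
  calc 2 * (‖P.OX‖ * ‖P.OY‖) ≤ 2 * (‖P.OX‖ * ‖P.OY‖) * ((v * T) * (Real.exp α * R ^ (D - 1)) *
        (Real.exp L * xi D γ α (R * α / (v * T)))) := le_mul_of_one_le_right (by linarith) h6
    _ = _ := by ring

/-- The long-time bound, by summing the errors of short time steps. -/
theorem exists_long_time_bound_area (D : ℕ) (hD : 1 ≤ D) (r₀ : ℝ) {η : ℝ} (hη : 0 < η)
    (hη1 : η ≤ 1) : ∃ c : ℝ, 0 < c ∧ ∀ γ : ℝ, 0 < γ → γ < 1 →
    ∀ α : ℝ, 2 * (D : ℝ) < α → (D : ℝ) + 1 + η ≤ α →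
      ∀ (S : PowerLawSystem D α) (R : ℝ) (P : Probe S r₀ R) (T : ℝ), α ≤ velocity D * T →
        P.commNorm T ≤ c * Real.exp α * T * R ^ (D - 1) *
          xi D γ α (R * α / (velocity D * T)) * (‖P.OX‖ * ‖P.OY‖) := by
  obtain ⟨C, hC0, hC⟩ := exists_ball_truncation_area D hη hη1
  have hv := velocity_pos D
  refine ⟨4 * velocity D * C + 2 * velocity D * Real.exp (4 + 2 * |r₀|), by positivity,
    fun γ hγ hγ1 α hα hαη S R P T hT => ?_⟩
  set v := velocity D with hvdef
  have hD1 : (1 : ℝ) ≤ D := by exact_mod_cast hD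
  have hα1 : 1 ≤ α := by linarith
  have hR1 := P.one_le_dist
  have hR0 : 0 < R := by linarith
  have hvT : 0 < v * T := by linarith
  have hT0 : 0 < T := pos_of_mul_pos_right hvT hv.le
  set l := R * α / (v * T) with hl
  have hl0 : 0 < l := div_pos (mul_pos hR0 (by linarith)) hvT
  have hlR : l ≤ R := by
    rw [hl, div_le_iff₀ hvT]
    exact mul_le_mul_of_nonneg_left hT hR0.le
  have hxi := xi_pos (D := D) (α := α) hγ1 hl0
  have hOO : 0 ≤ ‖P.OX‖ * ‖P.OY‖ := mul_nonneg (norm_nonneg _) (norm_nonneg _)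
  have hbase : 0 ≤ Real.exp α * T * R ^ (D - 1) * xi D γ α l * (‖P.OX‖ * ‖P.OY‖) :=
    mul_nonneg (mul_nonneg (mul_nonneg (mul_nonneg (Real.exp_pos _).le hT0.le)
      (pow_nonneg hR0.le _)) hxi.le) hOO
  -- Beyond this threshold R/2 > r₀, so `OX` acts in the starting ball of radius R/2, and the step
  -- width, at least l/4, exceeds 1.
  rcases le_or_gt l (4 + 2 * |r₀|) with hL | hL
  · refine (trivial_long_time_bound hD hγ1 hα P hT hL).trans ?_
    have : 0 ≤ 4 * v * C := by positivity
    nlinarith [mul_nonneg this hbase]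
  obtain ⟨x, hx⟩ := P.exists_mem
  have hr : r₀ ≤ |r₀| := le_abs_self _
  have hr' := abs_nonneg r₀
  -- Steps of duration at most α/v cost a factor at most e^α each. The N steps of width m together
  -- advance the radius from R/2 to R.
  set N := ⌈v * T / α⌉₊ with hN
  have hM1 : 1 ≤ v * T / α := (one_le_div (by linarith)).2 hT
  have hN1 : v * T / α ≤ N := Nat.le_ceil _
  have hN2 : (N : ℝ) ≤ 2 * (v * T / α) := by
    have := Nat.ceil_lt_add_one (a := v * T / α) (by linarith)
    linarith
  have hN0 : (0 : ℝ) < N := by linarith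
  set m := R / (2 * N) with hm
  have hNm : N * m = R / 2 := by rw [hm]; field_simp
  have hml : l / 4 ≤ m := by
    rw [hm, hl, div_div, div_le_div_iff₀ (by linarith) (by linarith)]
    rw [div_eq_mul_inv, ← mul_assoc, ← div_eq_mul_inv, le_div_iff₀ (by linarith)] at hN2
    nlinarith
  have hm1 : 1 ≤ m := by linarith
  set E := Real.exp (-4 * m) + m ^ (-(α - D - 1)) with hE
  have hE0 : 0 ≤ E := add_nonneg (Real.exp_pos _).le (Real.rpow_nonneg (by linarith) _)
  have hEx : E ≤ xi D γ α l := le_xi hγ hγ1 (by linarith) hl0 hml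
  have hCR : 0 ≤ C * R ^ (D - 1) * E := mul_nonneg (mul_nonneg hC0.le (pow_nonneg hR0.le _)) hE0
  obtain ⟨O', h1, -, h3⟩ := iterate_truncation P.isEvolution (x := (x : Site D)) (ρ := R / 2)
    (l := m) (τ := T / N) (a := C * R ^ (D - 1) * E * Real.exp α) N (by positivity)
    (fun k hk s t hst hts O hO => by
      have hkm : (k : ℝ) * m ≤ N * m :=
        mul_le_mul_of_nonneg_right (Nat.cast_le.2 hk.le) (by linarith)
      have hkm0 : 0 ≤ (k : ℝ) * m := mul_nonneg (Nat.cast_nonneg _) (by linarith)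
      obtain ⟨O', f1, f2, f3⟩ := hC α m (R / 2 + k * m) R hαη hm1 (by linarith) (by linarith) hR1 S
        P.U P.isEvolution s t hst x O hO
      refine ⟨O', f1, f2, f3.trans (mul_le_mul_of_nonneg_right ?_ (norm_nonneg _))⟩
      refine mul_le_mul_of_nonneg_left ?_ hCR
      have h4 : v * (t - s) ≤ α := by
        refine (mul_le_mul_of_nonneg_left hts hv.le).trans ?_
        rw [mul_div_assoc', div_le_iff₀ hN0]
        rw [div_le_iff₀ (by linarith)] at hN1
        linarith
      have := Real.exp_le_exp.2 h4
      linarith)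
    (mul_nonneg hCR (Real.exp_pos _).le) N le_rfl 0 T hT0.le
    (by rw [sub_zero, mul_div_cancel₀ _ hN0.ne']) P.OX
    (P.actsInBall hx (by linarith))
  rw [hNm, add_halves] at h1
  refine (P.commNorm_le_of_actsInBall T hx le_rfl h1).trans ?_
  have hN3 : (N : ℝ) ≤ 2 * (v * T) := by
    refine hN2.trans (mul_le_mul_of_nonneg_left (div_le_self hvT.le hα1) zero_le_two)
  have h5 : ‖heisenberg P.U 0 T P.OX - O'‖ ≤
      2 * (v * T) * (C * R ^ (D - 1) * xi D γ α l * Real.exp α) * ‖P.OX‖ := by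
    refine h3.trans (mul_le_mul_of_nonneg_right ?_ (norm_nonneg _))
    refine mul_le_mul hN3 ?_ (mul_nonneg hCR (Real.exp_pos _).le) (by linarith)
    refine mul_le_mul_of_nonneg_right ?_ (Real.exp_pos _).le
    exact mul_le_mul_of_nonneg_left hEx (mul_nonneg hC0.le (pow_nonneg hR0.le _))
  calc _ ≤ 2 * (2 * (v * T) * (C * R ^ (D - 1) * xi D γ α l * Real.exp α) * ‖P.OX‖) * ‖P.OY‖ :=
        mul_le_mul_of_nonneg_right (mul_le_mul_of_nonneg_left h5 zero_le_two) (norm_nonneg _)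
    _ = 4 * v * C * (Real.exp α * T * R ^ (D - 1) * xi D γ α l * (‖P.OX‖ * ‖P.OY‖)) := by ring
    _ ≤ _ := by
        have : 0 ≤ 2 * v * Real.exp (4 + 2 * |r₀|) := by positivity
        nlinarith [mul_nonneg this hbase]

/-- The long-time bound in one dimension for exponents close to two. -/
theorem exists_long_time_bound_interval (r₀ : ℝ) : ∃ c : ℝ, 0 < c ∧ ∀ γ : ℝ, 0 < γ → γ < 1 →
    ∀ ε : ℝ, 0 < ε → ε ≤ 1 / 16 →
      ∀ (S : PowerLawSystem 1 (2 + ε)) (R : ℝ) (P : Probe S r₀ R) (T : ℝ),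
        2 + ε ≤ velocity 1 * T →
        P.commNorm T ≤ c * Real.exp (2 + ε) * T * R ^ (1 - 1) *
          xi 1 γ (2 + ε) (R * (2 + ε) / (velocity 1 * T)) * (‖P.OX‖ * ‖P.OY‖) := by
  obtain ⟨C, hC0, hC⟩ := exists_interval_truncation (η := 1 / 16) (by norm_num) (by norm_num)
  have hv := velocity_pos 1
  -- A step has duration (2+ε)/v, and 2+ε ≤ 3; the summand 1 ensures A ≥ 1.
  set A : ℝ := 1 + C * Real.exp 3 with hA
  have hA1 : 1 ≤ A := by rw [hA]; have := Real.exp_pos 3; nlinarith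
  refine ⟨400 * A * velocity 1 + 2 * velocity 1 * Real.exp (4 + 2 * |r₀|), by positivity,
    fun γ hγ hγ1 ε hε hε1 S R P T hT => ?_⟩
  set v := velocity 1 with hvdef
  have hR1 := P.one_le_dist
  have hR0 : 0 < R := by linarith
  have hvT : 0 < v * T := by linarith
  have hT0 : 0 < T := pos_of_mul_pos_right hvT hv.le
  set l := R * (2 + ε) / (v * T) with hl
  have hl0 : 0 < l := div_pos (mul_pos hR0 (by linarith)) hvT
  have hlR : l ≤ R := by
    rw [hl, div_le_iff₀ hvT]
    exact mul_le_mul_of_nonneg_left hT hR0.le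
  have hxi := xi_pos (D := 1) (α := 2 + ε) hγ1 hl0
  have hOO : 0 ≤ ‖P.OX‖ * ‖P.OY‖ := mul_nonneg (norm_nonneg _) (norm_nonneg _)
  have hbase : 0 ≤ Real.exp (2 + ε) * T * R ^ (1 - 1) * xi 1 γ (2 + ε) l * (‖P.OX‖ * ‖P.OY‖) :=
    mul_nonneg (mul_nonneg (mul_nonneg (mul_nonneg (Real.exp_pos _).le hT0.le)
      (pow_nonneg hR0.le _)) hxi.le) hOO
  rcases le_or_gt l (4 + 2 * |r₀|) with hL | hL
  · have h := trivial_long_time_bound le_rfl hγ1 (by push_cast; linarith) P hT hL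
    rw [← hl] at h
    have hAv : 0 ≤ 400 * A * v := mul_nonneg (by linarith) hv.le
    have h' := mul_nonneg hAv hbase
    linarith
  obtain ⟨x, hx⟩ := P.exists_mem
  have hr : r₀ ≤ |r₀| := le_abs_self _
  have hr' := abs_nonneg r₀
  obtain ⟨n, hn1, hn2⟩ := exists_nat_pow_near (x := v * T / (2 + ε)) (y := 2)
    ((one_le_div (by linarith)).2 hT) one_lt_two
  have hn1' : (2 : ℝ) ^ n ≤ v * T := hn1.trans (div_le_self hvT.le (by linarith))
  -- The choice η = 1/16 with ε ≤ 1/16 keeps σ = ε + η ≤ 1/8. Using n+1 doublings makes the total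
  -- time at least T. The final spread R/2 is comparable to R, so the loss (R/l)^η is just a
  -- constant.
  have hspread := spreadBound_two_pow P.isEvolution (x := (x : Site 1)) (τ := (2 + ε) / v) (P := R)
    (A := A) (σ := ε + 1 / 16) (η := 1 / 16) (by positivity) hA1 (by norm_num) (by linarith)
    (by linarith) hR0
    (fun ρ m hm hρ hρm s t hst hts O hO => by
      obtain ⟨O', f1, -, f3⟩ := hC ε m ρ R hε.le (by linarith) hm hρ (by linarith) hR1 S P.U
        P.isEvolution s t hst x O hO
      refine ⟨O', f1, f3.trans (mul_le_mul_of_nonneg_right ?_ (norm_nonneg _))⟩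
      have h4 : v * (t - s) ≤ 3 := by
        rw [le_div_iff₀ hv] at hts
        linarith
      have h5 := Real.exp_le_exp.2 h4
      have h6 : 0 ≤ m ^ (-(ε + 1 / 16)) * R ^ (1 / 16 : ℝ) :=
        mul_nonneg (Real.rpow_nonneg (by linarith) _) (Real.rpow_nonneg hR0.le _)
      calc C * (m ^ (-(ε + 1 / 16)) * R ^ (1 / 16 : ℝ)) * (Real.exp (v * (t - s)) - 1) ≤
            C * (m ^ (-(ε + 1 / 16)) * R ^ (1 / 16 : ℝ)) * Real.exp 3 :=
            mul_le_mul_of_nonneg_left (by linarith) (mul_nonneg hC0.le h6)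
        _ = C * Real.exp 3 * (m ^ (-(ε + 1 / 16)) * R ^ (1 / 16 : ℝ)) := by ring
        _ ≤ _ := mul_le_mul_of_nonneg_right (by rw [hA]; linarith) h6)
    (n + 1) (R / 2) (R / 2) (by linarith) (by linarith) (by linarith)
  set Y := (2 : ℝ) ^ (n + 1) * ((R / 2) ^ (-(ε + 1 / 16)) * R ^ (1 / 16 : ℝ)) with hY
  have hYle : Y ≤ 4 * (v * T) * xi 1 γ (2 + ε) l := by
    have h1 : (R / 2) ^ (-(ε + 1 / 16)) * R ^ (1 / 16 : ℝ) ≤ 2 * R ^ (-ε) := by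
      have e : R ^ (-(ε + 1 / 16)) * R ^ (1 / 16 : ℝ) = R ^ (-ε) := by
        rw [← Real.rpow_add hR0]; congr 1; ring
      rw [Real.div_rpow hR0.le (by norm_num), Real.rpow_neg (by norm_num : (0 : ℝ) ≤ 2), div_inv_eq_mul,
        mul_right_comm, e, mul_comm]
      refine mul_le_mul_of_nonneg_right ?_ (Real.rpow_nonneg hR0.le _)
      calc (2 : ℝ) ^ (ε + 1 / 16) ≤ 2 ^ (1 : ℝ) :=
            Real.rpow_le_rpow_of_exponent_le one_le_two (by linarith)
        _ = 2 := Real.rpow_one 2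
    have h2 : R ^ (-ε) ≤ xi 1 γ (2 + ε) l := by
      have h3 := le_xi (D := 1) (γ := γ) (α := 2 + ε) (l := l) (m := R) hγ hγ1
        (by push_cast; linarith) hl0 (by linarith)
      rw [show 2 + ε - ((1 : ℕ) : ℝ) - 1 = ε by push_cast; ring] at h3
      linarith [Real.exp_pos (-4 * R)]
    have h3 : 0 ≤ 2 * R ^ (-ε) := mul_nonneg zero_le_two (Real.rpow_nonneg hR0.le _)
    calc Y ≤ (2 * (v * T)) * (2 * R ^ (-ε)) := by
          rw [hY, pow_succ]
          refine mul_le_mul (by linarith) h1 (mul_nonneg (Real.rpow_nonneg (by linarith) _)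
            (Real.rpow_nonneg hR0.le _)) (by linarith)
      _ ≤ (2 * (v * T)) * (2 * xi 1 γ (2 + ε) l) := by gcongr
      _ = _ := by ring
  -- If Y is not small enough for the multiscale bound, then 96AY ≥ 2 and the trivial bound
  -- suffices.
  have hmain : P.commNorm T ≤ 96 * A * Y * (‖P.OX‖ * ‖P.OY‖) := by
    rcases le_or_gt Y (1 / (48 * A)) with hYs | hYs
    · obtain ⟨O', h1, h2⟩ := hspread hYs 0 T hT0.le (by
        rw [div_lt_iff₀ (by linarith)] at hn2
        rw [sub_zero, mul_div_assoc', le_div_iff₀ hv]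
        linarith) P.OX (P.actsInBall hx (by linarith))
      rw [add_halves] at h1
      have hY0 : 0 ≤ Y := mul_nonneg (by positivity)
        (mul_nonneg (Real.rpow_nonneg (by linarith) _) (Real.rpow_nonneg hR0.le _))
      have hAY : 0 ≤ A * Y * (‖P.OX‖ * ‖P.OY‖) :=
        mul_nonneg (mul_nonneg (by linarith) hY0) hOO
      calc _ ≤ 2 * (6 * A * Y * ‖P.OX‖) * ‖P.OY‖ :=
            (P.commNorm_le_of_actsInBall T hx le_rfl h1).trans
              (mul_le_mul_of_nonneg_right (mul_le_mul_of_nonneg_left h2 zero_le_two)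
                (norm_nonneg _))
        _ ≤ _ := by linarith
    · rw [div_lt_iff₀ (by linarith)] at hYs
      refine (P.commNorm_le_two T).trans (mul_le_mul_of_nonneg_right (by linarith) hOO)
  have he : 1 ≤ Real.exp (2 + ε) := Real.one_le_exp (by linarith)
  calc P.commNorm T ≤ 96 * A * Y * (‖P.OX‖ * ‖P.OY‖) := hmain
    _ ≤ 96 * A * (4 * (v * T) * xi 1 γ (2 + ε) l) * (‖P.OX‖ * ‖P.OY‖) := by gcongr
    _ ≤ 96 * A * (4 * (v * T) * xi 1 γ (2 + ε) l) * (‖P.OX‖ * ‖P.OY‖) * Real.exp (2 + ε) :=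
        le_mul_of_one_le_right (by positivity) he
    _ = 384 * A * v * (Real.exp (2 + ε) * T * R ^ (1 - 1) * xi 1 γ (2 + ε) l *
        (‖P.OX‖ * ‖P.OY‖)) := by
        rw [Nat.sub_self, pow_zero]; ring
    _ ≤ (400 * A * v + 2 * v * Real.exp (4 + 2 * |r₀|)) * (Real.exp (2 + ε) * T * R ^ (1 - 1) *
        xi 1 γ (2 + ε) l * (‖P.OX‖ * ‖P.OY‖)) := by
        refine mul_le_mul_of_nonneg_right ?_ hbase
        have h1 : 0 ≤ A * v := by positivity
        have h2 : 0 ≤ v * Real.exp (4 + 2 * |r₀|) := by positivity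
        linarith
    _ = _ := by ring

/-- The long-time bound, uniformly in the exponent. -/
theorem exists_long_time_bound (D : ℕ) (hD : 1 ≤ D) (r₀ : ℝ) : ∃ c : ℝ, 0 < c ∧
    ∀ γ : ℝ, 0 < γ → γ < 1 → ∀ α : ℝ, 2 * (D : ℝ) < α →
      ∀ (S : PowerLawSystem D α) (R : ℝ) (P : Probe S r₀ R) (T : ℝ), α ≤ velocity D * T →
        P.commNorm T ≤ c * Real.exp α * T * R ^ (D - 1) *
          xi D γ α (R * α / (velocity D * T)) * (‖P.OX‖ * ‖P.OY‖) := by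
  obtain ⟨c₁, hc₁, h₁⟩ := exists_long_time_bound_area D hD r₀ (η := 1 / 16) (by norm_num)
    (by norm_num)
  -- For D ≥ 2, α > 2D ≥ D+2 leaves room for the area argument. Only D = 1 with α ≤ 2 + 1/16 needs
  -- the multiscale bound.
  rcases hD.eq_or_lt with rfl | hD2
  · obtain ⟨c₂, hc₂, h₂⟩ := exists_long_time_bound_interval r₀
    refine ⟨c₁ + c₂, by linarith, fun γ hγ hγ1 α hα S R P T hT => ?_⟩
    push_cast at hα
    have hR := P.one_le_dist
    have hvT : 0 < velocity 1 * T := by linarith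
    have hT0 : 0 < T := pos_of_mul_pos_right hvT (velocity_pos 1).le
    have hxi := xi_pos (D := 1) (α := α) (l := R * α / (velocity 1 * T)) hγ1
      (div_pos (mul_pos (by linarith) (by linarith)) hvT)
    have hb : 0 ≤ Real.exp α * T * R ^ (1 - 1) * xi 1 γ α (R * α / (velocity 1 * T)) *
        (‖P.OX‖ * ‖P.OY‖) :=
      mul_nonneg (mul_nonneg (mul_nonneg (mul_nonneg (Real.exp_pos _).le hT0.le)
        (pow_nonneg (by linarith) _)) hxi.le) (mul_nonneg (norm_nonneg _) (norm_nonneg _))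
    rcases le_total (2 + 1 / 16) α with h | h
    · have := h₁ γ hγ hγ1 α (by push_cast; linarith) (by push_cast; linarith) S R P T hT
      nlinarith [mul_nonneg hc₂.le hb]
    · obtain ⟨ε, rfl⟩ : ∃ ε, α = 2 + ε := ⟨α - 2, by ring⟩
      have := h₂ γ hγ hγ1 ε (by linarith) (by linarith) S R P T hT
      nlinarith [mul_nonneg hc₁.le hb]
  · have hD2' : (2 : ℝ) ≤ D := by exact_mod_cast hD2
    exact ⟨c₁, hc₁, fun γ hγ hγ1 α hα S R P T hT => h₁ γ hγ hγ1 α hα (by linarith) S R P T hT⟩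

/-! ### Fixed exponent: algebraic tail and light cone -/

theorem exp_neg_le_rpow {k : ℝ} (hk : 0 ≤ k) : ∃ M : ℝ, 0 < M ∧ ∀ l : ℝ, 0 < l →
    Real.exp (-(1 / 2) * l) ≤ M * l ^ (-k) := by
  set n := ⌈k⌉₊ with hn
  refine ⟨2 ^ n * n.factorial + 1, by positivity, fun l hl => ?_⟩
  have hM : (1 : ℝ) ≤ 2 ^ n * n.factorial + 1 := by
    have : (0 : ℝ) ≤ 2 ^ n * n.factorial := by positivity
    linarith
  rcases le_or_gt l 1 with h | h
  · have h1 : 1 ≤ l ^ (-k) := Real.one_le_rpow_of_pos_of_le_one_of_nonpos hl h (by linarith)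
    have h2 : Real.exp (-(1 / 2) * l) ≤ 1 := Real.exp_le_one_iff.2 (by linarith)
    nlinarith
  · have h1 := Real.pow_div_factorial_le_exp (l / 2) (by linarith) n
    have h2 : l ^ k ≤ l ^ n := by
      rw [← Real.rpow_natCast]
      exact Real.rpow_le_rpow_of_exponent_le h.le (Nat.le_ceil k)
    have h3 : l ^ k ≤ (2 ^ n * n.factorial + 1) * Real.exp (l / 2) := by
      rw [div_le_iff₀ (by positivity), div_pow, div_le_iff₀ (by positivity)] at h1
      have := Real.exp_pos (l / 2)
      linarith
    rw [Real.rpow_neg hl.le, ← div_eq_mul_inv, le_div_iff₀ (Real.rpow_pos_of_pos hl k),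
      show -(1 / 2) * l = -(l / 2) by ring, Real.exp_neg, mul_comm, ← div_eq_mul_inv,
      div_le_iff₀ (Real.exp_pos _)]
    exact h3

/-- With α fixed, the exponential in ξ is absorbed into the power; γ = 1/2 is an arbitrary choice.
-/
theorem exists_xi_le (D : ℕ) {α : ℝ} (hα : (D : ℝ) + 1 ≤ α) : ∃ M : ℝ, 0 < M ∧
    ∀ l : ℝ, 0 < l → xi D (1 / 2) α l ≤ M * l ^ (-(α - D - 1)) := by
  obtain ⟨M, hM, h⟩ := exp_neg_le_rpow (k := α - D - 1) (by linarith)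
  have h0 : (0 : ℝ) < (16 / (1 - 1 / 2)) ^ α := Real.rpow_pos_of_pos (by norm_num) _
  refine ⟨(16 / (1 - 1 / 2)) ^ α + M, by linarith, fun l hl => ?_⟩
  rw [xi, one_div (l ^ _), ← Real.rpow_neg hl.le, add_mul]
  exact add_le_add le_rfl (h l hl)

theorem exists_short_time_bound_xi (D : ℕ) (hD : 1 ≤ D) (r₀ : ℝ) : ∃ c : ℝ, 0 < c ∧
    ∀ γ : ℝ, 0 < γ → γ < 1 → ∀ α : ℝ, 2 * (D : ℝ) < α →
      ∀ (S : PowerLawSystem D α) (R : ℝ) (P : Probe S r₀ R) (T : ℝ), 0 ≤ T →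
        P.commNorm T ≤ c * (Real.exp (velocity D * T) - 1) * xi D γ α R *
          (‖P.OX‖ * ‖P.OY‖) := by
  obtain ⟨c, hc, h⟩ := exists_short_time_bound D r₀
  have hD1 : (1 : ℝ) ≤ D := by exact_mod_cast hD
  refine ⟨c, hc, fun γ hγ hγ1 α hα S R P T hT => ?_⟩
  have hR := P.one_le_dist
  have hexp : 0 ≤ Real.exp (velocity D * T) - 1 :=
    sub_nonneg.2 (Real.one_le_exp (mul_nonneg (velocity_pos D).le hT))
  refine (h α (by linarith) S R P T hT).trans
    (mul_le_mul_of_nonneg_right ?_ (mul_nonneg (norm_nonneg _) (norm_nonneg _)))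
  exact mul_le_mul_of_nonneg_left (le_xi hγ hγ1 (by linarith) (by linarith) (by linarith))
    (mul_nonneg hc.le hexp)

/-- The long-time bound as a power law, for a fixed exponent. -/
theorem exists_algebraic_bound (D : ℕ) (hD : 1 ≤ D) (r₀ : ℝ) {α : ℝ} (hα : 2 * (D : ℝ) < α) :
    ∃ c : ℝ, 0 < c ∧ ∀ (S : PowerLawSystem D α) (R : ℝ) (P : Probe S r₀ R) (T : ℝ),
      α ≤ velocity D * T →
        P.commNorm T ≤ c * (T ^ (α - D) / R ^ (α - 2 * D)) * (‖P.OX‖ * ‖P.OY‖) := by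
  have hD1 : (1 : ℝ) ≤ D := by exact_mod_cast hD
  obtain ⟨c, hc, h⟩ := exists_long_time_bound D hD r₀
  obtain ⟨M, hM, hxi⟩ := exists_xi_le D (α := α) (by linarith)
  have hv := velocity_pos D
  have hα0 : 0 < α := by linarith
  have hva : 0 < (velocity D / α) ^ (α - D - 1) := Real.rpow_pos_of_pos (div_pos hv hα0) _
  refine ⟨c * Real.exp α * (M * (velocity D / α) ^ (α - D - 1)),
    mul_pos (mul_pos hc (Real.exp_pos _)) (mul_pos hM hva), fun S R P T hT => ?_⟩
  set v := velocity D
  have hR0 : 0 < R := by linarith [P.one_le_dist]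
  have hT0 : 0 < T := pos_of_mul_pos_right (by linarith : 0 < v * T) hv.le
  have hl : 0 < R * α / (v * T) := div_pos (mul_pos hR0 hα0) (mul_pos hv hT0)
  have e1 : (R * α / (v * T)) ^ (-(α - D - 1)) =
      (v / α) ^ (α - D - 1) * T ^ (α - D - 1) * R ^ (-(α - D - 1)) := by
    rw [show R * α / (v * T) = (v / α * T)⁻¹ * R by field_simp,
      Real.mul_rpow (inv_nonneg.2 (mul_nonneg (div_pos hv hα0).le hT0.le)) hR0.le,
      Real.inv_rpow (mul_nonneg (div_pos hv hα0).le hT0.le), ← Real.rpow_neg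
      (mul_nonneg (div_pos hv hα0).le hT0.le), neg_neg, Real.mul_rpow (div_pos hv hα0).le hT0.le]
  have e2 : T * T ^ (α - D - 1) = T ^ (α - D) := by
    rw [← Real.rpow_one_add' hT0.le (by linarith)]; congr 1; ring
  have e3 : R ^ (D - 1) * R ^ (-(α - D - 1)) = 1 / R ^ (α - 2 * D) := by
    rw [one_div, ← Real.rpow_neg hR0.le, ← Real.rpow_natCast, ← Real.rpow_add hR0,
      Nat.cast_sub hD]
    congr 1; push_cast; ring
  refine (h (1 / 2) (by norm_num) (by norm_num) α hα S R P T hT).trans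
    (mul_le_mul_of_nonneg_right ?_ (mul_nonneg (norm_nonneg _) (norm_nonneg _)))
  calc _ ≤ c * Real.exp α * T * R ^ (D - 1) * (M * (R * α / (v * T)) ^ (-(α - D - 1))) :=
        mul_le_mul_of_nonneg_left (hxi _ hl) (mul_nonneg (mul_nonneg (mul_nonneg hc.le
          (Real.exp_pos _).le) hT0.le) (pow_nonneg hR0.le _))
    _ = c * Real.exp α * (M * (v / α) ^ (α - D - 1)) * ((T * T ^ (α - D - 1)) *
        (R ^ (D - 1) * R ^ (-(α - D - 1)))) := by rw [e1]; ring
    _ = _ := by rw [e2, e3, mul_one_div]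

/-- The short-time bound is linear in time, for a fixed exponent. -/
theorem exists_linear_bound (D : ℕ) (hD : 1 ≤ D) (r₀ : ℝ) {α : ℝ} (hα : 2 * (D : ℝ) < α) :
    ∃ c : ℝ, 0 < c ∧ ∀ (S : PowerLawSystem D α) (R : ℝ) (P : Probe S r₀ R) (T : ℝ), 0 ≤ T →
      velocity D * T < α →
        P.commNorm T ≤ c * (T * R ^ (-(α - D - 1))) * (‖P.OX‖ * ‖P.OY‖) := by
  have hD1 : (1 : ℝ) ≤ D := by exact_mod_cast hD
  obtain ⟨c, hc, h⟩ := exists_short_time_bound_xi D hD r₀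
  obtain ⟨M, hM, hxi⟩ := exists_xi_le D (α := α) (by linarith)
  have hv := velocity_pos D
  refine ⟨c * (velocity D * Real.exp α) * M,
    mul_pos (mul_pos hc (mul_pos hv (Real.exp_pos _))) hM, fun S R P T hT hT' => ?_⟩
  set v := velocity D
  have hR0 : 0 < R := by linarith [P.one_le_dist]
  have hvT : 0 ≤ v * T := mul_nonneg hv.le hT
  -- This is e^x - 1 ≤ x e^x, which is 1 - x ≤ e^(-x) multiplied by e^x.
  have hexp : Real.exp (v * T) - 1 ≤ v * T * Real.exp α := by
    have h1 := Real.add_one_le_exp (-(v * T))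
    have h2 : Real.exp (-(v * T)) * Real.exp (v * T) = 1 := by rw [← Real.exp_add]; simp
    have h3 := Real.exp_le_exp.2 hT'.le
    have h4 := Real.exp_pos (v * T)
    nlinarith
  refine (h (1 / 2) (by norm_num) (by norm_num) α hα S R P T hT).trans
    (mul_le_mul_of_nonneg_right ?_ (mul_nonneg (norm_nonneg _) (norm_nonneg _)))
  calc _ ≤ c * (v * T * Real.exp α) * (M * R ^ (-(α - D - 1))) :=
        mul_le_mul (mul_le_mul_of_nonneg_left hexp hc.le) (hxi R hR0)
          (xi_pos (by norm_num) hR0).le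
          (mul_nonneg hc.le (mul_nonneg hvT (Real.exp_pos _).le))
    _ = _ := by ring

/-- For vT ≥ α the algebraic bound is solved for T. For shorter times the linear bound forces T to
be at least a multiple of the larger power R^(α-D-1). -/
theorem exists_light_cone (D : ℕ) (hD : 1 ≤ D) (r₀ : ℝ) {α : ℝ} (hα : 2 * (D : ℝ) < α) {δ : ℝ}
    (hδ : 0 < δ) : ∃ κ : ℝ, 0 < κ ∧
      ∀ (S : PowerLawSystem D α) (R : ℝ) (P : Probe S r₀ R) (T : ℝ), 0 ≤ T → ‖P.OX‖ ≤ 1 →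
        ‖P.OY‖ ≤ 1 → δ ≤ P.commNorm T → κ * R ^ ((α - 2 * D) / (α - D)) ≤ T := by
  have hD1 : (1 : ℝ) ≤ D := by exact_mod_cast hD
  obtain ⟨c₁, hc₁, h₁⟩ := exists_algebraic_bound D hD r₀ hα
  obtain ⟨c₂, hc₂, h₂⟩ := exists_linear_bound D hD r₀ hα
  refine ⟨min ((δ / c₁) ^ (α - D)⁻¹) (δ / c₂),
    lt_min (Real.rpow_pos_of_pos (div_pos hδ hc₁) _) (div_pos hδ hc₂),
    fun S R P T hT hX hY hδT => ?_⟩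
  have hR1 := P.one_le_dist
  have hR0 : 0 < R := by linarith
  have hOO : ‖P.OX‖ * ‖P.OY‖ ≤ 1 := mul_le_one₀ hX (norm_nonneg _) hY
  have hp := Real.rpow_nonneg hR0.le ((α - 2 * D) / (α - D))
  rcases le_or_gt α (velocity D * T) with h | h
  · have hq : 0 < R ^ (α - 2 * D) := Real.rpow_pos_of_pos hR0 _
    have h3 : δ ≤ c₁ * (T ^ (α - D) / R ^ (α - 2 * D)) :=
      hδT.trans ((h₁ S R P T h).trans (mul_le_of_le_one_right (mul_nonneg hc₁.le
        (div_nonneg (Real.rpow_nonneg hT _) hq.le)) hOO))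
    have h4 : δ / c₁ * R ^ (α - 2 * D) ≤ T ^ (α - D) := by
      rw [div_mul_eq_mul_div, div_le_iff₀ hc₁]
      rw [mul_div_assoc', le_div_iff₀ hq] at h3
      linarith
    have h5 := Real.rpow_le_rpow (mul_nonneg (div_pos hδ hc₁).le hq.le) h4
      (inv_nonneg.2 (by linarith : (0 : ℝ) ≤ α - D))
    rw [Real.rpow_rpow_inv hT (by linarith), Real.mul_rpow (div_pos hδ hc₁).le hq.le,
      ← Real.rpow_mul hR0.le, ← div_eq_mul_inv] at h5
    exact (mul_le_mul_of_nonneg_right (min_le_left _ _) hp).trans h5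
  · have hq : 0 < R ^ (α - D - 1) := Real.rpow_pos_of_pos hR0 _
    have h3 : δ ≤ c₂ * (T * R ^ (-(α - D - 1))) :=
      hδT.trans ((h₂ S R P T hT h).trans (mul_le_of_le_one_right (mul_nonneg hc₂.le
        (mul_nonneg hT (Real.rpow_nonneg hR0.le _))) hOO))
    have h4 : δ / c₂ * R ^ (α - D - 1) ≤ T := by
      rw [Real.rpow_neg hR0.le, ← div_eq_mul_inv, mul_div_assoc', le_div_iff₀ hq] at h3
      rw [div_mul_eq_mul_div, div_le_iff₀ hc₂]
      linarith
    -- Since α - D ≥ 1 and D ≥ 1, (α-2D)/(α-D) ≤ α-2D ≤ α-D-1; also R ≥ 1.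
    have h5 : R ^ ((α - 2 * D) / (α - D)) ≤ R ^ (α - D - 1) :=
      Real.rpow_le_rpow_of_exponent_le hR1
        ((div_le_self (by linarith) (by linarith)).trans (by linarith))
    exact (mul_le_mul (min_le_right _ _) h5 hp (div_pos hδ hc₂).le).trans h4

end LongRange

end

theorem theorem1 (D : ℕ) (hD : 1 ≤ D) :
    ∃ v : ℝ, 0 < v ∧
      -- the two-regime bound, with constants independent of `α`
      (∀ γ : ℝ, 0 < γ → γ < 1 → ∀ r₀ : ℝ, ∃ c c' : ℝ, 0 < c ∧ 0 < c' ∧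
        ∀ α : ℝ, 2 * (D : ℝ) < α →
        ∀ (S : LongRange.PowerLawSystem D α) (R : ℝ) (P : LongRange.Probe S r₀ R) (T : ℝ), 0 ≤ T →
          (α ≤ v * T →
            P.commNorm T ≤ c * Real.exp α * T * R ^ (D - 1) *
              LongRange.xi D γ α (R * α / (v * T)) * (‖P.OX‖ * ‖P.OY‖)) ∧
          (v * T < α →
            P.commNorm T ≤ c' * (Real.exp (v * T) - 1) *
              LongRange.xi D γ α R * (‖P.OX‖ * ‖P.OY‖))) ∧
      -- for each finite `α`: the algebraic bound and the light cone
      (∀ r₀ : ℝ, ∀ α : ℝ, 2 * (D : ℝ) < α →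
        (∃ cα : ℝ, 0 < cα ∧
          ∀ (S : LongRange.PowerLawSystem D α) (R : ℝ) (P : LongRange.Probe S r₀ R) (T : ℝ),
            0 ≤ T → α ≤ v * T →
              P.commNorm T ≤ cα * (T ^ (α - D) / R ^ (α - 2 * D)) * (‖P.OX‖ * ‖P.OY‖)) ∧
        (∀ δ : ℝ, 0 < δ → ∃ κ : ℝ, 0 < κ ∧
          ∀ (S : LongRange.PowerLawSystem D α) (R : ℝ) (P : LongRange.Probe S r₀ R) (T : ℝ),
            0 ≤ T → ‖P.OX‖ ≤ 1 → ‖P.OY‖ ≤ 1 → δ ≤ P.commNorm T →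
              κ * R ^ ((α - 2 * D) / (α - D)) ≤ T)) := by
  refine ⟨LongRange.velocity D, LongRange.velocity_pos D, fun γ hγ hγ1 r₀ => ?_, fun r₀ α hα =>
    ⟨?_, fun δ hδ => LongRange.exists_light_cone D hD r₀ hα hδ⟩⟩
  · obtain ⟨c, hc, h⟩ := LongRange.exists_long_time_bound D hD r₀
    obtain ⟨c', hc', h'⟩ := LongRange.exists_short_time_bound_xi D hD r₀
    exact ⟨c, c', hc, hc', fun α hα S R P T hT =>
      ⟨h γ hγ hγ1 α hα S R P T, fun _ => h' γ hγ hγ1 α hα S R P T hT⟩⟩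
  · obtain ⟨c, hc, h⟩ := LongRange.exists_algebraic_bound D hD r₀ hα
    exact ⟨c, hc, fun S R P T _ hT => h S R P T hT⟩
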